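/- Let $q\in\mathbb C^*$ not be a root of unity, $\kappa=q-q^{-1}$, $[k]=\frac{q^k-q^{-k}}{q-q^{-1}}$, $[k]!=[1]\cdots[k]$, $\left[{a\atop b}\right]=\frac{[a]!}{[b]![a-b]!}$, $\delta(z)=\sum_{k\in\mathbb Z}z^k$. Let $U=U_q(\widehat{\mathfrak{sl}}_2)$ in Drinfeld's new realization: it is generated by the coefficients of the currents $e(z)=\sum_{k\in\mathbb Z}e_kz^{-k}$, $f(z)=\sum_{k\in\mathbb Z} f_kz^{-k}$, $\psi^{\pm}(z)=\sum_{r\ge0}\psi^\pm_{\pm r}z^{\mp r}$, by central $q^{\pm c/2}$ and by the gradation operator $d$ ($[d,x_k]=k\,x_k$ for $x=e,f,\psi^\pm$), with $\psi^+_0\psi^-_0=\psi^-_0\psi^+_0=1$ and the relations $$(z-q^{\pm2}w)e_\pm(z)e_\pm(w)=(q^{\pm2}z-w)e_\pm(w)e_\pm(z),\qquad e_+=e,\ e_-=f,$$ $$(q^{\pm c/2}z-q^{\pm2}w)\psi^+(z)e_\pm(w)=(q^{\pm2\pm c/2}z-w)e_\pm(w)\psi^+(z),$$ $$(q^{\mp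 c/2}z-q^{\pm2}w)\psi^-(z)e_\pm(w)=(q^{\pm2\mp c/2}z-w)e_\pm(w)\psi^-(z),$$ $$(z-q^{2-c}w)(z-q^{-2+c}w)\psi^+(z)\psi^-(w)=(q^{2+c}z-w)(q^{-2-c}z-w)\psi^-(w)\psi^+(z),\qquad[\psi^\pm(z),\psi^\pm(w)]=0,$$ $$[e(z),f(w)]=\kappa^{-1}\left(\delta(z/q^cw)\psi^+(zq^{-c/2})-\delta(zq^c/w)\psi^-(wq^{-c/2})\right).$$ Let $V$ be a highest degree representation of $U$: for some $s\in\mathbb C$ and $N\in\mathbb Z$, $V$ is the direct sum of the eigenspaces of $d$ with eigenvalues $s+k$, $k<N$, $k\in\mathbb Z$. A product of operator-valued series in $z_1,\dots,z_r$ is understood through its matrix coefficients $\langle\xi,\cdot\,v\rangle$ between homogeneous vectors $v\in V$ and homogeneous functionals $\xi$ (nonzero on one component only): such a series converges for $|z_1|\gg\dots\gg|z_r|$ to a rational function, and the product is identified with that function (its analytic continuation). Put, for $n\ge0$, $$\tilde e^{(n)}(z)=e(z)e(q^2z)\cdots e(q^{2(n-1)}z),\qquad \tilde f^{(n)}(z)=f(q^{2(n-1)}z)\cdots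 f(q^2z)f(z)$$ (the continuations are regular at these points for $z\ne0$, and the results are operator-valued series in $z$ on $V$; $\tilde e^{(0)}=\tilde f^{(0)}=1$), and $$e^{(n)}(z)=\kappa^{n-1}[n-1]![n]!\,\tilde e^{(n)}(z),\quad f^{(n)}(z)=\kappa^{n-1}[n-1]![n]!\,\tilde f^{(n)}(z)\ (n\ge1),\quad e^{(0)}=f^{(0)}=1.$$ These are the iterated residues: for $n\ge 1$, $e^{(n+1)}(z)={\rm Res}_{y=q^{2n}z}\,e(y)e^{(n)}(z)\frac{dy}{y}$ and $f^{(n+1)}(z)={\rm Res}_{y=q^{2n}z}\,f^{(n)}(z)f(y)\frac{dy}{y}$. Here, for an at most simple pole, ${\rm Res}_{y=a}F(y)\frac{dy}y=\lim_{y\to a}(1-a/y)F(y)$. Let $n,m\ge1$. (1) The matrix coefficients of $\tilde e^{(n)}(z_1)\tilde e^{(m)}(z_2)$ have the form $$\frac{\prod_{j\in Z}(z_1-q^{2j}z_2)}{\prod_{j\in P}(z_1-q^{2j}z_2)}\,L(z_1,z_2),\qquad L\in\mathbb C[z_1^{\pm1},z_2^{\pm1}].$$ That is, their only possible poles in $(\mathbb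 C^*)^2$ are simple poles at $z_1/z_2=q^{2j}$, $j\in P$, and they have zeros at $z_1/z_2=q^{2j}$, $j\in Z$, where $P=\{1,\dots,m\}$, $Z=\{-n+1,\dots,-n+m\}$ if $n\ge m$, and $P=\{m-n+1,\dots,m\}$, $Z=\{-n+1,\dots,0\}$ if $n<m$. The same holds for $\tilde f^{(n)}(z_1)\tilde f^{(m)}(z_2)$ with $P=\{-n,\dots,-n+m-1\}$, $Z=\{0,\dots,m-1\}$ if $n\ge m$, and $P=\{-n,\dots,-1\}$, $Z=\{m-n,\dots,m-1\}$ if $n<m$. (2) For $\max(1,m-n+1)\le k\le m$, $$\mathop{\rm Res}_{z_1=q^{2k}z_2}\tilde e^{(n)}(z_1)\tilde e^{(m)}(z_2)\frac{dz_1}{z_1}=(q-q^{-1})\,\frac{\prod_{j=0}^{k-1}[n+j][n+j+1]}{\prod_{j=1}^{k-1}[j][j+1]}\ \tilde e^{(n+k)}(z_2)\tilde e^{(m-k)}(q^{2k}z_2),$$ and for $\max(1,n-m+1)\le k\le n$, $$\mathop{\rm Res}_{z_1=q^{-2k}z_2}\tilde f^{(n)}(z_1)\tilde f^{(m)}(z_2)\frac{dz_1}{z_1}=(q^{-1}-q)\,\frac{\prod_{j=0}^{k-1}[m+j][m+j+1]}{\prod_{j=1}^{k-1}[j][j+1]}\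 \tilde f^{(n-k)}(z_2)\tilde f^{(m+k)}(q^{-2k}z_2).$$ The products on the right are regular at the indicated points, and a matrix coefficient has a genuine pole on the left exactly when the matrix coefficient on the right is nonzero. (3) As identities of formal series of operators on $V$, $$e^{(n)}(z_1)e^{(m)}(z_2)=\prod_{k=0}^{m-1}\prod_{l=0}^{n-1}g'\!\left(q^{2(l-k)}\tfrac{z_1}{z_2}\right)e^{(m)}(z_2)e^{(n)}(z_1)+\sum_{k=1}^m a_{m,k}\,\delta\!\left(\tfrac{z_1}{q^{2k}z_2}\right)e^{(n+k)}(z_2)e^{(m-k)}(q^{2k}z_2),$$ $$f^{(n)}(z_1)f^{(m)}(z_2)=\prod_{k=0}^{m-1}\prod_{l=0}^{n-1}g\!\left(q^{2(l-k)}\tfrac{z_1}{z_2}\right)f^{(m)}(z_2)f^{(n)}(z_1)-\sum_{k=1}^n a_{n,k}\,\delta\!\left(\tfrac{q^{2k}z_1}{z_2}\right)f^{(n-k)}(z_2)f^{(m+k)}(q^{-2k}z_2),$$ where $g'(z)=\frac{q^{-2}-z}{1-q^{-2}z}$ and $g(z)=\frac{q^{2}-z}{1-q^{2}z}$ are expanded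 at $z=0$, $a_{m,m}=1$ and $a_{m,k}=(q-q^{-1})[m]\left[{m-1\atop k}\right]\left[{m-1\atop k-1}\right]$ for $1\le k<m$. The fields multiplying the delta functions are the (regular) values of the analytic continuations. -/

import Mathlib

open Filter Topology

noncomputable section

namespace DrinfeldSl2

/-! ### The algebra `U_q(sl_2^)` in the new realization -/

/-- Generators: `e k`, `f k` are the coefficients of `z ^ (-k)` in the currents `e(z)`, `f(z)`;
`psiP r` is the coefficient of `z ^ (-r)` in `ψ⁺(z)` and `psiM r` that of `z ^ r` in `ψ⁻(z)`;
`gam`, `gamInv` stand for `q ^ (c / 2)`, `q ^ (- c / 2)`; `d` is the gradation operator. -/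
inductive Gen : Type
  | e (k : ℤ)
  | f (k : ℤ)
  | psiP (r : ℕ)
  | psiM (r : ℕ)
  | gam
  | gamInv
  | d

namespace Gen

/-- The free algebra on the generators. -/
abbrev Free : Type := FreeAlgebra ℂ Gen

def E (k : ℤ) : Free := FreeAlgebra.ι ℂ (e k)

def F (k : ℤ) : Free := FreeAlgebra.ι ℂ (f k)

def D : Free := FreeAlgebra.ι ℂ d

/-- The coefficient of `z ^ (-r)` in `ψ⁺(z)`, zero for `r < 0`. -/
def PP (r : ℤ) : Free := if 0 ≤ r then FreeAlgebra.ι ℂ (psiP r.toNat) else 0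

/-- The coefficient of `z ^ (-r)` in `ψ⁻(z)`, zero for `r > 0`. -/
def PM (r : ℤ) : Free := if r ≤ 0 then FreeAlgebra.ι ℂ (psiM (-r).toNat) else 0

/-- The integer power `q ^ (n c / 2)`. -/
def G (n : ℤ) : Free :=
  if 0 ≤ n then FreeAlgebra.ι ℂ gam ^ n.toNat else FreeAlgebra.ι ℂ gamInv ^ (-n).toNat

end Gen

open Gen in
/-- The defining relations, written for the coefficients of the currents. -/
inductive Rel (q : ℂ) : Free → Free → Prop
  | gam_gamInv : Rel q (G 1 * G (-1)) 1
  | gamInv_gam : Rel q (G (-1) * G 1) 1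
  | gam_central (x : Gen) : Rel q (G 1 * FreeAlgebra.ι ℂ x) (FreeAlgebra.ι ℂ x * G 1)
  | psi_inv : Rel q (PP 0 * PM 0) 1
  | psi_inv_symm : Rel q (PM 0 * PP 0) 1
  | d_e (k : ℤ) : Rel q (D * E k - E k * D) ((k : ℂ) • E k)
  | d_f (k : ℤ) : Rel q (D * F k - F k * D) ((k : ℂ) • F k)
  | d_psiP (k : ℤ) : Rel q (D * PP k - PP k * D) ((k : ℂ) • PP k)
  | d_psiM (k : ℤ) : Rel q (D * PM k - PM k * D) ((k : ℂ) • PM k)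
  /- `(z - q² w) e(z) e(w) = (q² z - w) e(w) e(z)` -/
  | e_e (k l : ℤ) :
      Rel q (E (k + 1) * E l - q ^ (2 : ℤ) • (E k * E (l + 1)))
        (q ^ (2 : ℤ) • (E l * E (k + 1)) - E (l + 1) * E k)
  /- `(z - q⁻² w) f(z) f(w) = (q⁻² z - w) f(w) f(z)` -/
  | f_f (k l : ℤ) :
      Rel q (F (k + 1) * F l - q ^ (-2 : ℤ) • (F k * F (l + 1)))
        (q ^ (-2 : ℤ) • (F l * F (k + 1)) - F (l + 1) * F k)
  /- `(q^(c/2) z - q² w) ψ⁺(z) e(w) = (q^(2+c/2) z - w) e(w) ψ⁺(z)` -/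
  | psiP_e (r k : ℤ) :
      Rel q (G 1 * PP (r + 1) * E k - q ^ (2 : ℤ) • (PP r * E (k + 1)))
        (q ^ (2 : ℤ) • (G 1 * E k * PP (r + 1)) - E (k + 1) * PP r)
  /- `(q^(-c/2) z - q⁻² w) ψ⁺(z) f(w) = (q^(-2-c/2) z - w) f(w) ψ⁺(z)` -/
  | psiP_f (r k : ℤ) :
      Rel q (G (-1) * PP (r + 1) * F k - q ^ (-2 : ℤ) • (PP r * F (k + 1)))
        (q ^ (-2 : ℤ) • (G (-1) * F k * PP (r + 1)) - F (k + 1) * PP r)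
  /- `(q^(-c/2) z - q² w) ψ⁻(z) e(w) = (q^(2-c/2) z - w) e(w) ψ⁻(z)` -/
  | psiM_e (r k : ℤ) :
      Rel q (G (-1) * PM (r + 1) * E k - q ^ (2 : ℤ) • (PM r * E (k + 1)))
        (q ^ (2 : ℤ) • (G (-1) * E k * PM (r + 1)) - E (k + 1) * PM r)
  /- `(q^(c/2) z - q⁻² w) ψ⁻(z) f(w) = (q^(-2+c/2) z - w) f(w) ψ⁻(z)` -/
  | psiM_f (r k : ℤ) :
      Rel q (G 1 * PM (r + 1) * F k - q ^ (-2 : ℤ) • (PM r * F (k + 1)))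
        (q ^ (-2 : ℤ) • (G 1 * F k * PM (r + 1)) - F (k + 1) * PM r)
  | psiP_psiP (r s : ℤ) : Rel q (PP r * PP s) (PP s * PP r)
  | psiM_psiM (r s : ℤ) : Rel q (PM r * PM s) (PM s * PM r)
  /- `(z - q^(2-c) w) (z - q^(-2+c) w) ψ⁺(z) ψ⁻(w) = (q^(2+c) z - w) (q^(-2-c) z - w) ψ⁻(w) ψ⁺(z)` -/
  | psiP_psiM (r s : ℤ) :
      Rel q
        (PP (r + 2) * PM s
          - (q ^ (2 : ℤ) • G (-2) + q ^ (-2 : ℤ) • G 2) * (PP (r + 1) * PM (s + 1))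
          + PP r * PM (s + 2))
        (PM s * PP (r + 2)
          - (q ^ (2 : ℤ) • G 2 + q ^ (-2 : ℤ) • G (-2)) * (PM (s + 1) * PP (r + 1))
          + PM (s + 2) * PP r)
  /- `(q - q⁻¹) [e(z), f(w)] = δ(z / (q^c w)) ψ⁺(z q^(-c/2)) - δ(z q^c / w) ψ⁻(w q^(-c/2))` -/
  | e_f (k l : ℤ) :
      Rel q (E k * F l - F l * E k)
        ((q - q⁻¹)⁻¹ • (G (k - l) * PP (k + l) - G (l - k) * PM (k + l)))

/-- The quantum affine algebra `U_q(sl_2^)` in the new (current) realization. -/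
abbrev Uq (q : ℂ) : Type := RingQuot (Rel q)

/-- The class of a generator in `Uq q`. -/
def Uq.gen (q : ℂ) (x : Gen) : Uq q := RingQuot.mkAlgHom ℂ (Rel q) (FreeAlgebra.ι ℂ x)

/-! ### Highest degree representations -/

section Reps

variable {q : ℂ} {V : Type*} [AddCommGroup V] [Module ℂ V] (ρ : Uq q →ₐ[ℂ] Module.End ℂ V)

/-- The graded component of degree `μ`: the eigenspace of the gradation operator. -/
def degSpace (μ : ℂ) : Submodule ℂ V := Module.End.eigenspace (ρ (Uq.gen q Gen.d)) μ

/-- `V` is the sum of its components of degree `s + k` with `k < N` an integer. -/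
def IsHighestDegree : Prop :=
  ∃ (s : ℂ) (N : ℤ), (⨆ k : {k : ℤ // k < N}, degSpace ρ (s + ((k : ℤ) : ℂ))) = ⊤

/-- Homogeneous vectors. -/
def IsHomVec (v : V) : Prop := ∃ μ : ℂ, v ∈ degSpace ρ μ

/-- Homogeneous functionals: they vanish on all graded components but one. -/
def IsHomDual (ξ : Module.Dual ℂ V) : Prop :=
  ∃ μ : ℂ, ∀ ν : ℂ, ν ≠ μ → ∀ w ∈ degSpace ρ ν, ξ w = 0

/-- The current `e(z)` on `V`, as the family of the coefficients of `z ^ (-k)`. -/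
def eCur (k : ℤ) : Module.End ℂ V := ρ (Uq.gen q (Gen.e k))

/-- The current `f(z)` on `V`. -/
def fCur (k : ℤ) : Module.End ℂ V := ρ (Uq.gen q (Gen.f k))

end Reps

/-! ### Formal series as rational functions -/

/-- The region `|z₁| ≫ |z₂| ≫ … ≫ |z_N|`. -/
def farRegion (N : ℕ) (C : ℝ) : Set (Fin N → ℂ) :=
  {z | (∀ i, z i ≠ 0) ∧ ∀ i j, i < j → C * ‖z j‖ < ‖z i‖}

/-- The formal series `∑ c(k₁, …, k_N) z₁ ^ (-k₁) ⋯ z_N ^ (-k_N)` converges in a region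
`|z₁| ≫ … ≫ |z_N|` to the rational function `P / Q`. -/
def ConvergesTo {N : ℕ} (c : (Fin N → ℤ) → ℂ) (P Q : MvPolynomial (Fin N) ℂ) : Prop :=
  ∃ C : ℝ, ∀ z ∈ farRegion N C, MvPolynomial.eval z Q ≠ 0 ∧
    HasSum (fun k : Fin N → ℤ => c k * ∏ i, z i ^ (-k i))
      (MvPolynomial.eval z P / MvPolynomial.eval z Q)

/-- The rational function defined by the series is regular at `z` with value `w`. -/
def HasValueAt {N : ℕ} (c : (Fin N → ℤ) → ℂ) (z : Fin N → ℂ) (w : ℂ) : Prop :=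
  ∃ P Q : MvPolynomial (Fin N) ℂ, ConvergesTo c P Q ∧ MvPolynomial.eval z Q ≠ 0 ∧
    w = MvPolynomial.eval z P / MvPolynomial.eval z Q

def IsRegularAt {N : ℕ} (c : (Fin N → ℤ) → ℂ) (z : Fin N → ℂ) : Prop := ∃ w, HasValueAt c z w

/-- The value at `z` of the rational function defined by the series (unspecified if it is not
regular there). -/
def valueAt {N : ℕ} (c : (Fin N → ℤ) → ℂ) (z : Fin N → ℂ) : ℂ := Classical.epsilon (HasValueAt c z)

/-- The series `c` defines a rational function of the form
`L(z₁, z₂) ∏_{j ∈ zeros} (z₁ - q^{2j} z₂) / ∏_{j ∈ poles} (z₁ - q^{2j} z₂)`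
with a Laurent polynomial `L`. -/
def HasPolesAndZeros (q : ℂ) (c : (Fin 2 → ℤ) → ℂ) (poles zeros : Finset ℤ) : Prop :=
  ∃ (L : MvPolynomial (Fin 2) ℂ) (a b : ℕ),
    ConvergesTo c
      (L * ∏ j ∈ zeros,
        (MvPolynomial.X 0 - MvPolynomial.C (q ^ (2 * j)) * MvPolynomial.X 1))
      (MvPolynomial.X 0 ^ a * MvPolynomial.X 1 ^ b * ∏ j ∈ poles,
        (MvPolynomial.X 0 - MvPolynomial.C (q ^ (2 * j)) * MvPolynomial.X 1))

/-! ### Products of currents and composed currents -/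

section Currents

variable {q : ℂ} {V : Type*} [AddCommGroup V] [Module ℂ V]

/-- The coefficients of the series `⟨ξ, A₁(z₁) ⋯ A_N(z_N) v⟩`. -/
def matrixCoeff {N : ℕ} (A : Fin N → ℤ → Module.End ℂ V) (ξ : Module.Dual ℂ V) (v : V)
    (k : Fin N → ℤ) : ℂ :=
  ξ ((List.ofFn fun i => A i (k i)).prod v)

/-- The analytic continuation of `⟨ξ, A₁(z₁) ⋯ A_N(z_N) v⟩` at the point `z`. -/
def prodValue {N : ℕ} (A : Fin N → ℤ → Module.End ℂ V) (ξ : Module.Dual ℂ V) (v : V)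
    (z : Fin N → ℂ) : ℂ :=
  valueAt (matrixCoeff A ξ v) z

variable (ρ : Uq q →ₐ[ℂ] Module.End ℂ V)

/-- The operators `B j` are the coefficients of `z ^ (-j)` of the operator-valued function with
matrix coefficients `φ ξ v z`, `z ≠ 0`. -/
def IsFieldOf (φ : Module.Dual ℂ V → V → ℂ → ℂ) (B : ℤ → Module.End ℂ V) : Prop :=
  ∀ ξ v, IsHomDual ρ ξ → IsHomVec ρ v → ∀ z : ℂ, z ≠ 0 →
    HasSum (fun j : ℤ => ξ (B j v) * z ^ (-j)) (φ ξ v z)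

/-- The operator-valued series with matrix coefficients `φ ξ v z`. -/
def fieldOf (φ : Module.Dual ℂ V → V → ℂ → ℂ) : ℤ → Module.End ℂ V :=
  Classical.epsilon (IsFieldOf ρ φ)

/-- The points `z, q² z, …, q^{2(n-1)} z`. -/
def stringUp (q : ℂ) (n : ℕ) (z : ℂ) : Fin n → ℂ := fun i => q ^ (2 * (i : ℕ)) * z

/-- The points `q^{2(n-1)} z, …, q² z, z`. -/
def stringDown (q : ℂ) (n : ℕ) (z : ℂ) : Fin n → ℂ := fun i => q ^ (2 * (i.rev : ℕ)) * z

/-- Matrix coefficients of `e(z) e(q² z) ⋯ e(q^{2(n-1)} z)`. -/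
def eString (n : ℕ) (ξ : Module.Dual ℂ V) (v : V) (z : ℂ) : ℂ :=
  prodValue (fun _ : Fin n => eCur ρ) ξ v (stringUp q n z)

/-- Matrix coefficients of `f(q^{2(n-1)} z) ⋯ f(q² z) f(z)`. -/
def fString (n : ℕ) (ξ : Module.Dual ℂ V) (v : V) (z : ℂ) : ℂ :=
  prodValue (fun _ : Fin n => fCur ρ) ξ v (stringDown q n z)

/-- The composed current `ẽ^{(n)}(z) = e(z) e(q² z) ⋯ e(q^{2(n-1)} z)`. -/
def eTilde (n : ℕ) : ℤ → Module.End ℂ V := fieldOf ρ (eString ρ n)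

/-- The composed current `f̃^{(n)}(z) = f(q^{2(n-1)} z) ⋯ f(q² z) f(z)`. -/
def fTilde (n : ℕ) : ℤ → Module.End ℂ V := fieldOf ρ (fString ρ n)

end Currents

/-! ### `q`-numbers and constants -/

def qNum (q : ℂ) (n : ℕ) : ℂ := (q ^ n - q⁻¹ ^ n) / (q - q⁻¹)

def qFact (q : ℂ) (n : ℕ) : ℂ := ∏ j ∈ Finset.Icc 1 n, qNum q j

/-- The `q`-binomial coefficient, for `k ≤ n`. -/
def qBinom (q : ℂ) (n k : ℕ) : ℂ := qFact q n / (qFact q k * qFact q (n - k))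

/-- The normalization factor `(q - q⁻¹)^{n-1} [n-1]! [n]!`, equal to `1` for `n = 0`. -/
def compNorm (q : ℂ) (n : ℕ) : ℂ := (q - q⁻¹) ^ (n - 1) * qFact q (n - 1) * qFact q n

/-- `∏_{j=0}^{k-1} [n+j] [n+j+1]` divided by `∏_{j=1}^{k-1} [j] [j+1]`. -/
def resConst (q : ℂ) (n k : ℕ) : ℂ :=
  (∏ j ∈ Finset.range k, qNum q (n + j) * qNum q (n + j + 1)) /
    ∏ j ∈ Finset.Ico 1 k, qNum q j * qNum q (j + 1)

/-- The coefficients in the exchange relations. -/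
def exchConst (q : ℂ) (m k : ℕ) : ℂ :=
  if k = m then 1
  else (q - q⁻¹) * qNum q m * qBinom q (m - 1) k * qBinom q (m - 1) (k - 1)

/-- The expansion at `z = 0` of `∏_{k < m} ∏_{l < n} g(q^{2(l-k)} z)`, `g(z) = (t - z) / (1 - t z)`. -/
def exchSeries (q t : ℂ) (n m : ℕ) : PowerSeries ℂ :=
  ∏ k ∈ Finset.range m, ∏ l ∈ Finset.range n,
    ((PowerSeries.C t - PowerSeries.C (q ^ (2 * ((l : ℤ) - (k : ℤ)))) * PowerSeries.X) *
      (1 - PowerSeries.C (t * q ^ (2 * ((l : ℤ) - (k : ℤ)))) * PowerSeries.X)⁻¹)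

/-! ### Composed currents normalized as iterated residues -/

section Normalized

variable {q : ℂ} {V : Type*} [AddCommGroup V] [Module ℂ V] (ρ : Uq q →ₐ[ℂ] Module.End ℂ V)

/-- The current `e^{(n)}(z)`. -/
def eComp (n : ℕ) (j : ℤ) : Module.End ℂ V := compNorm q n • eTilde ρ n j

/-- The current `f^{(n)}(z)`. -/
def fComp (n : ℕ) (j : ℤ) : Module.End ℂ V := compNorm q n • fTilde ρ n j

/-- Matrix coefficients of `e^{(n+k)}(z) e^{(m-k)}(q^{2k} z)`. -/
def eResidue (n m k : ℕ) (ξ : Module.Dual ℂ V) (v : V) (z : ℂ) : ℂ :=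
  prodValue ![eComp ρ (n + k), eComp ρ (m - k)] ξ v ![z, q ^ (2 * k) * z]

/-- Matrix coefficients of `f^{(n-k)}(z) f^{(m+k)}(q^{-2k} z)`. -/
def fResidue (n m k : ℕ) (ξ : Module.Dual ℂ V) (v : V) (z : ℂ) : ℂ :=
  prodValue ![fComp ρ (n - k), fComp ρ (m + k)] ξ v ![z, (q ^ (2 * k))⁻¹ * z]

end Normalized

/-! ### The lists of exponents `j` of the poles and zeros `z₁ / z₂ = q^{2j}` -/

def ePoles (n m : ℕ) : Finset ℤ :=
  if m ≤ n then Finset.Icc 1 (m : ℤ) else Finset.Icc ((m : ℤ) - n + 1) m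

def eZeros (n m : ℕ) : Finset ℤ :=
  if m ≤ n then Finset.Icc (-(n : ℤ) + 1) (-(n : ℤ) + m) else Finset.Icc (-(n : ℤ) + 1) 0

def fZeros (n m : ℕ) : Finset ℤ :=
  if m ≤ n then Finset.Icc 0 ((m : ℤ) - 1) else Finset.Icc ((m : ℤ) - n) ((m : ℤ) - 1)

def fPoles (n m : ℕ) : Finset ℤ :=
  if m ≤ n then Finset.Icc (-(n : ℤ)) (-(n : ℤ) + m - 1) else Finset.Icc (-(n : ℤ)) (-1)

end DrinfeldSl2

end

/-! Put T = q² for e and T = q⁻² for f. Both currents satisfy (z - T w) A(z) A(w) = (T z - w) A(w)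
A(z) and A_k raises the degree by k (`IsCurrent`); the argument is run once for such an A.

Multiplying A(z_1)...A(z_N) by the product of z_i - T z_j over i < j makes it antisymmetric
(`antiProd_perm`). Applied to a vector, the last index is bounded above because degrees in V are;
antisymmetry then bounds every index (`ub_antiProd`), and the grading fixes the sum of the indices
in a homogeneous matrix coefficient. So these coefficients are antisymmetric Laurent polynomials,
that is, the Vandermonde product times a symmetric one (`exists_symmetric`, `exists_symData`). Hence
a matrix coefficient of A(z_1)...A(z_N) is the product over i < j of (z_i - z_j)/(z_i - T z_j),
times a symmetric Laurent polynomial S_N.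

A composed current is the value on a geometric string of ratio T, where the rational factor is a
nonzero constant. For two strings the mixed factor telescopes to the product over 1 ≤ l ≤ b of (z_1
- T^(l-a) z_2)/(z_1 - T^l z_2), with (a, b) = (n, m) for e and (m, n) for f (`isPair_risingString`,
`isPair_endingString`). This gives the poles and zeros.

At z_1 = T^k z_2 the points of the two strings form the same multiset as those of a longer and a
shorter string. Since S_N is symmetric, the residue of one product is a scalar times the regular
value of the other (`pairReg_eq`); the scalar comes from `factor_residue` and becomes a ratio of
q-numbers in `resCoeff_sq`.

For the exchange relations, the product in one order and the exchange series times the product in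
the other order are opposite expansions of one rational function (`act_denPoly_eq_dual`,
`act_polesPoly_psAct_dual`). Partial fractions (`sum_nodalWeight`) reduce their difference to simple
poles, and the two expansions at a simple pole differ by a delta function carrying the residue
(`sub_eq_sp_of_act_lin`, `exchange_hom`). `compNorm_mul` converts the residue constants into
a_{m,k}. -/

noncomputable section

namespace DrinfeldSl2

open MvPolynomial

/-! ### Multiplication of formal distributions by polynomials -/

section Act

variable {ι κ : Type*} {M M' : Type*} [AddCommGroup M] [Module ℂ M] [AddCommGroup M'] [Module ℂ M']

/-- Multiplication by a monomial of a formal distribution, given as the family of coefficients of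
`z ^ (-k)`. -/
def shiftHom : Multiplicative (ι →₀ ℕ) →* Module.End ℂ ((ι → ℤ) → M) where
  toFun u :=
    { toFun := fun c k => c (fun i => k i + (u.toAdd i : ℤ))
      map_add' := fun _ _ => rfl
      map_smul' := fun _ _ => rfl }
  map_one' := by ext c k; simp
  map_mul' u v := by
    ext c k
    simp only [toAdd_mul, Finsupp.add_apply, Nat.cast_add, LinearMap.coe_mk, AddHom.coe_mk,
      Module.End.mul_apply]
    congr 1; ext i; ring

/-- Multiplication of formal distributions by polynomials. -/
def act : MvPolynomial ι ℂ →ₐ[ℂ] Module.End ℂ ((ι → ℤ) → M) :=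
  AddMonoidAlgebra.lift ℂ _ _ shiftHom

theorem act_monomial (u : ι →₀ ℕ) (a : ℂ) (c : (ι → ℤ) → M) (k : ι → ℤ) :
    act (monomial u a) c k = a • c (fun i => k i + (u i : ℤ)) := by
  have : (act (M := M) (monomial u a) : Module.End ℂ ((ι → ℤ) → M)) =
      a • shiftHom (Multiplicative.ofAdd u) := AddMonoidAlgebra.lift_single _ _ _
  rw [this]; rfl

theorem act_mul (P Q : MvPolynomial ι ℂ) (c : (ι → ℤ) → M) : act (P * Q) c = act P (act Q c) := by
  rw [map_mul]; rfl

theorem act_add (P Q : MvPolynomial ι ℂ) (c : (ι → ℤ) → M) : act (P + Q) c = act P c + act Q c := by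
  rw [map_add]; rfl

theorem act_sub (P Q : MvPolynomial ι ℂ) (c : (ι → ℤ) → M) : act (P - Q) c = act P c - act Q c := by
  rw [map_sub]; rfl

theorem act_one (c : (ι → ℤ) → M) : act 1 c = c := by
  rw [map_one]; rfl

theorem act_comm (P Q : MvPolynomial ι ℂ) (c : (ι → ℤ) → M) :
    act P (act Q c) = act Q (act P c) := by
  rw [← act_mul, mul_comm, act_mul]

theorem act_sum {α : Type*} (s : Finset α) (P : α → MvPolynomial ι ℂ) (c : (ι → ℤ) → M) :
    act (∑ x ∈ s, P x) c = ∑ x ∈ s, act (P x) c := by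
  rw [map_sum, LinearMap.sum_apply]

theorem act_C (a : ℂ) (c : (ι → ℤ) → M) : act (C a) c = a • c := by
  ext k; rw [← monomial_zero', act_monomial]; simp

theorem act_C_mul (a : ℂ) (P : MvPolynomial ι ℂ) (c : (ι → ℤ) → M) :
    act (C a * P) c = a • act P c := by
  rw [act_mul, act_C]

theorem act_X [DecidableEq ι] (i : ι) (c : (ι → ℤ) → M) (k : ι → ℤ) :
    act (X i) c k = c (k + Pi.single i 1) := by
  rw [X, act_monomial, one_smul]
  congr 1; ext j
  by_cases h : j = i
  · subst h; simp
  · simp [h]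

theorem act_apply (P : MvPolynomial ι ℂ) (c : (ι → ℤ) → M) (k : ι → ℤ) :
    act P c k = ∑ u ∈ P.support, coeff u P • c (fun i => k i + (u i : ℤ)) := by
  conv_lhs => rw [P.as_sum]
  rw [act_sum, Finset.sum_apply]
  exact Finset.sum_congr rfl fun u _ => act_monomial _ _ _ _

theorem act_eq_zero (P : MvPolynomial ι ℂ) (c : (ι → ℤ) → M) (k : ι → ℤ)
    (h : ∀ u : ι →₀ ℕ, c (fun i => k i + (u i : ℤ)) = 0) : act P c k = 0 := by
  rw [act_apply]; exact Finset.sum_eq_zero fun u _ => by rw [h, smul_zero]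

theorem act_map (φ : M →ₗ[ℂ] M') (P : MvPolynomial ι ℂ) (c : (ι → ℤ) → M) (k : ι → ℤ) :
    act P (fun l => φ (c l)) k = φ (act P c k) := by
  simp only [act_apply, map_sum, map_smul]

theorem act_rename (e : ι ≃ κ) (P : MvPolynomial ι ℂ) (c : (κ → ℤ) → M) (k : κ → ℤ) :
    act (rename e P) c k = act P (fun l => c (l ∘ e.symm)) (k ∘ e) := by
  induction P using MvPolynomial.induction_on' generalizing k with
  | monomial u a =>
    rw [rename_monomial, act_monomial, act_monomial]
    congr 2; ext i
    obtain ⟨j, rfl⟩ := e.surjective i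
    simp [Finsupp.mapDomain_apply e.injective]
  | add P Q hP hQ => rw [map_add, act_add, act_add, Pi.add_apply, Pi.add_apply, hP, hQ]

/-- The linear factor `z_i - t z_j`. -/
def lin (i j : ι) (t : ℂ) : MvPolynomial ι ℂ := X i - C t * X j

theorem act_lin [DecidableEq ι] (i j : ι) (t : ℂ) (c : (ι → ℤ) → M) (k : ι → ℤ) :
    act (lin i j t) c k = c (k + Pi.single i 1) - t • c (k + Pi.single j 1) := by
  rw [lin, act_sub, Pi.sub_apply, act_X, act_C_mul, Pi.smul_apply, act_X]

theorem eval_lin (i j : ι) (t : ℂ) (z : ι → ℂ) : eval z (lin i j t) = z i - t * z j := by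
  simp [lin]

theorem isHomogeneous_lin (i j : ι) (t : ℂ) : (lin i j t).IsHomogeneous 1 := by
  refine (isHomogeneous_X _ _).sub ?_
  simpa using (isHomogeneous_C _ t).mul (isHomogeneous_X ℂ j)

/-- The family of coefficients vanishes far along the direction of `(z_j / z_i) ^ p`. -/
def FarFin [DecidableEq ι] (c : (ι → ℤ) → M) (i j : ι) : Prop :=
  ∀ k : ι → ℤ, ∃ p₀ : ℕ, ∀ p : ℕ, p₀ ≤ p →
    c (k + (p : ℤ) • (Pi.single j 1 - Pi.single i 1)) = 0

variable [DecidableEq ι]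

theorem FarFin.act {c : (ι → ℤ) → M} {i j : ι} (h : FarFin c i j) (P : MvPolynomial ι ℂ) :
    FarFin (act P c) i j := by
  intro k
  choose p₀ hp using fun u : ι →₀ ℕ => h (fun i => k i + (u i : ℤ))
  refine ⟨P.support.sup p₀, fun p hpp => ?_⟩
  rw [act_apply]
  refine Finset.sum_eq_zero fun u hu => ?_
  have := hp u p ((Finset.le_sup hu).trans hpp)
  convert smul_zero (A := M) _ using 2
  rw [← this]
  congr 1; ext l
  simp only [Pi.add_apply]; ring

theorem FarFin.sub {M : Type*} [AddCommGroup M] {c c' : (ι → ℤ) → M} {i j : ι} (h : FarFin c i j) (h' : FarFin c' i j) :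
    FarFin (c - c') i j := by
  intro k
  obtain ⟨p, hp⟩ := h k
  obtain ⟨p', hp'⟩ := h' k
  refine ⟨max p p', fun r hr => ?_⟩
  rw [Pi.sub_apply, hp _ (le_of_max_le_left hr), hp' _ (le_of_max_le_right hr), sub_zero]

theorem FarFin.map (φ : M →ₗ[ℂ] M') {c : (ι → ℤ) → M} {i j : ι} (h : FarFin c i j) :
    FarFin (fun k => φ (c k)) i j := fun k =>
  (h k).imp fun p hp r hr => by simp only [hp r hr, map_zero]

/-- Annihilation by z_i - t z_j is the recursion c_k = t c_{k + e_j - e_i}, and iterating it reaches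
the region where c vanishes. One-sided boundedness thus excludes delta functions, which is what
makes linear factors cancellable. -/
theorem FarFin.eq_zero {c : (ι → ℤ) → M} {i j : ι} (h : FarFin c i j) {t : ℂ}
    (h0 : DrinfeldSl2.act (lin i j t) c = 0) : c = 0 := by
  have step : ∀ k, c k = t • c (k + (Pi.single j 1 - Pi.single i 1)) := by
    intro k
    have := congrFun h0 (k - Pi.single i 1)
    rw [act_lin, Pi.zero_apply, sub_eq_zero, sub_add_cancel] at this
    rw [this]; congr 2; abel
  have iter : ∀ (p : ℕ) k, c k = t ^ p • c (k + (p : ℤ) • (Pi.single j 1 - Pi.single i 1)) := by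
    intro p
    induction p with
    | zero => simp
    | succ p ih =>
      intro k
      rw [ih k, step, smul_smul, ← pow_succ]
      congr 2; push_cast; rw [add_smul, one_smul, add_assoc]
  ext k
  obtain ⟨p, hp⟩ := h k
  rw [iter p k, hp p le_rfl, smul_zero, Pi.zero_apply]

/-- Cancellation of a product of linear factors. -/
theorem act_prod_cancel {α : Type*} (s : Finset α) (P : α → MvPolynomial ι ℂ)
    {c : (ι → ℤ) → M}
    (hP : ∀ x ∈ s, ∃ i j t a, FarFin c i j ∧ P x = C a * lin i j t ∧ a ≠ 0)
    (h0 : act (∏ x ∈ s, P x) c = 0) : c = 0 := by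
  classical
  induction s using Finset.induction_on with
  | empty => rwa [Finset.prod_empty, act_one] at h0
  | insert x s hx ih =>
    rw [Finset.prod_insert hx, act_mul] at h0
    obtain ⟨i, j, t, a, hf, hPx, ha⟩ := hP x (Finset.mem_insert_self _ _)
    rw [hPx, act_C_mul, smul_eq_zero_iff_right ha] at h0
    exact ih (fun y hy => hP y (Finset.mem_insert_of_mem hy)) ((hf.act _).eq_zero h0)

theorem act_X_injective (i : ι) {c : (ι → ℤ) → M} (h : act (X i) c = 0) : c = 0 := by
  ext k
  have := congrFun h (k - Pi.single i 1)
  rwa [act_X, sub_add_cancel] at this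

theorem act_X_pow_injective (i : ι) (n : ℕ) {c : (ι → ℤ) → M} (h : act (X i ^ n) c = 0) :
    c = 0 := by
  induction n with
  | zero => rwa [pow_zero, act_one] at h
  | succ n ih =>
    rw [pow_succ, act_mul, act_comm] at h
    exact ih (act_X_injective i h)

theorem act_X_pow (i : ι) (n : ℕ) (c : (ι → ℤ) → M) (k : ι → ℤ) :
    act (X i ^ n) c k = c (k + Pi.single i (n : ℤ)) := by
  induction n generalizing k with
  | zero => simp
  | succ n ih =>
    rw [pow_succ', act_mul, act_X, ih]
    congr 1; rw [add_assoc, ← Pi.single_add]; push_cast; rw [add_comm (1 : ℤ)]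

end Act

section Delta

variable {ι : Type*}

open Classical in
/-- The distribution `z ^ (-u)`. -/
def delta (u : ι → ℤ) : (ι → ℤ) → ℂ := fun k => if k = u then 1 else 0

/-- Laurent polynomials are represented in the form P z^(-u), that is, as `act P (delta u)`; this
reads off their coefficients. -/
theorem act_delta (P : MvPolynomial ι ℂ) (u : ι → ℤ) (k : ι → ℤ) (v : ι →₀ ℕ)
    (h : ∀ i, k i + v i = u i) : act P (delta u) k = coeff v P := by
  rw [act_apply, Finset.sum_eq_single v]
  · simp [delta, funext h]
  · intro w _ hw
    rw [delta, if_neg, smul_zero]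
    intro h'
    apply hw; ext i
    have h1 := congrFun h' i
    have h2 := h i
    omega
  · intro hv; rw [notMem_support_iff.mp hv, zero_smul]

end Delta

end DrinfeldSl2

end

/-! ### Passage from formal coefficients to values of rational functions -/

noncomputable section

namespace DrinfeldSl2

open MvPolynomial

/-! ### Convergence of formal distributions to rational functions -/

section Convergence

variable {ι : Type*} [Fintype ι]

/-- The monomial `z ^ (-k)`. -/
def mono (z : ι → ℂ) (k : ι → ℤ) : ℂ := ∏ i, z i ^ (-k i)

theorem mono_add {z : ι → ℂ} (hz : ∀ i, z i ≠ 0) (k l : ι → ℤ) :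
    mono z (k + l) = mono z k * mono z l := by
  simp only [mono, ← Finset.prod_mul_distrib]
  exact Finset.prod_congr rfl fun i _ => by rw [Pi.add_apply, neg_add, zpow_add₀ (hz i)]

theorem mono_single [DecidableEq ι] (z : ι → ℂ) (i : ι) (n : ℤ) :
    mono z (Pi.single i n) = z i ^ (-n) := by
  rw [mono, Finset.prod_eq_single i]
  · simp
  · intro j _ hj; simp [hj]
  · simp

theorem mono_ne_zero {z : ι → ℂ} (hz : ∀ i, z i ≠ 0) (k : ι → ℤ) : mono z k ≠ 0 :=
  Finset.prod_ne_zero_iff.mpr fun i _ => zpow_ne_zero _ (hz i)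

theorem hasSum_act {z : ι → ℂ} (hz : ∀ i, z i ≠ 0) {c : (ι → ℤ) → ℂ} {s : ℂ}
    (h : HasSum (fun k => c k * mono z k) s) (P : MvPolynomial ι ℂ) :
    HasSum (fun k => act P c k * mono z k) (eval z P * s) := by
  induction P using MvPolynomial.induction_on' with
  | monomial u a =>
    have h1 := ((Equiv.addRight (fun i => (u i : ℤ))).hasSum_iff.mpr h).mul_left (eval z (monomial u a))
    refine h1.congr_fun ?_
    intro k
    rw [act_monomial, eval_monomial, Function.comp_apply, Equiv.coe_addRight, mono_add hz,
      smul_eq_mul]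
    have : mono z (fun i => (u i : ℤ)) * (u.prod fun n e => z n ^ e) = 1 := by
      rw [Finsupp.prod_fintype _ _ (by simp), mono, ← Finset.prod_mul_distrib]
      exact Finset.prod_eq_one fun i _ => by
        rw [zpow_neg, zpow_natCast, inv_mul_cancel₀ (pow_ne_zero _ (hz i))]
    calc a * c (fun i => k i + (u i : ℤ)) * mono z k
        = a * c (k + fun i => (u i : ℤ)) * mono z k *
          (mono z (fun i => (u i : ℤ)) * (u.prod fun n e => z n ^ e)) := by
            rw [this, mul_one]; rfl
      _ = _ := by ring
  | add P Q hP hQ =>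
    rw [(eval z).map_add, add_mul]
    exact (hP.add hQ).congr_fun fun k => by rw [act_add, Pi.add_apply, add_mul]

/-- The series of (z_i - t z_j) c is multiplied by the geometric series of 1/(z_i - t z_j) in w = t
z_j / z_i. The double sum converges absolutely; grouped by monomial, it telescopes to the series of
c. -/
theorem hasSum_of_act_lin [DecidableEq ι] {z : ι → ℂ} (hz : ∀ i, z i ≠ 0) {c : (ι → ℤ) → ℂ}
    {i j : ι} {t s : ℂ} (hc : FarFin c i j) (ht : ‖t * z j‖ < ‖z i‖)
    (h : HasSum (fun k => act (lin i j t) c k * mono z k) s) :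
    HasSum (fun k => c k * mono z k) (s / (z i - t * z j)) := by
  obtain ⟨g, hg⟩ : ∃ g, g = act (lin i j t) c := ⟨_, rfl⟩
  obtain ⟨e, he⟩ : ∃ e : ι → ℤ, e = Pi.single j 1 - Pi.single i 1 := ⟨_, rfl⟩
  obtain ⟨w, hw⟩ : ∃ w : ℂ, w = t * z j / z i := ⟨_, rfl⟩
  rw [← hg] at h
  unfold FarFin at hc
  rw [← he] at hc
  have hw1 : ‖w‖ < 1 := by
    rw [hw, norm_div]; exact (div_lt_one (norm_pos_iff.mpr (hz i))).mpr ht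
  have hmono : ∀ (p : ℕ) k, mono z (k + (p : ℤ) • e) = mono z k * ((z j)⁻¹ * z i) ^ p := by
    intro p
    induction p with
    | zero => simp
    | succ p ih =>
      intro k
      rw [Nat.cast_succ, add_smul, one_smul, ← add_assoc, mono_add hz, ih, he, sub_eq_add_neg,
        mono_add hz, ← Pi.single_neg, mono_single, mono_single, pow_succ, zpow_neg_one, neg_neg,
        zpow_one]
      ring
  have hsum : HasSum (fun x : ℕ × (ι → ℤ) => w ^ x.1 * (g x.2 * mono z x.2))
      ((1 - w)⁻¹ * s) := by
    have hs : Summable fun p : ℕ => ‖w ^ p‖ := by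
      simpa only [norm_pow] using summable_geometric_of_lt_one (norm_nonneg _) hw1
    exact HasSum.mul (f := fun p : ℕ => w ^ p) (g := fun k => g k * mono z k)
      (hasSum_geometric_of_norm_lt_one hw1) h
      (summable_mul_of_summable_norm (f := fun p : ℕ => w ^ p) (g := fun k => g k * mono z k)
        hs h.summable.norm)
  -- The pair (k, p) goes to (p, k - e_i + p(e_j - e_i)): this is the term of the double sum which,
  -- after multiplication by 1/z_i, contributes to the monomial z^(-k).
  let E : (ι → ℤ) × ℕ ≃ ℕ × (ι → ℤ) :=
    (Equiv.prodComm _ _).trans (Equiv.prodShear (Equiv.refl ℕ) fun p =>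
      Equiv.addRight (-Pi.single i 1 + (p : ℤ) • e))
  have hsum' := (E.hasSum_iff.mpr hsum).mul_left (z i)⁻¹
  have hval : (z i)⁻¹ * ((1 - w)⁻¹ * s) = s / (z i - t * z j) := by
    have h1 : z i - t * z j = z i * (1 - w) := by
      rw [hw]; field_simp [hz i]
    rw [h1, div_eq_mul_inv, mul_inv]; ring
  rw [hval] at hsum'
  refine hsum'.prod_fiberwise fun k => ?_
  have hterm : ∀ p : ℕ, (z i)⁻¹ * (w ^ p * (g (k + (-Pi.single i 1 + (p : ℤ) • e)) *
      mono z (k + (-Pi.single i 1 + (p : ℤ) • e)))) =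
      t ^ p * g (k - Pi.single i 1 + (p : ℤ) • e) * mono z k := by
    intro p
    rw [← add_assoc, ← sub_eq_add_neg, hmono, sub_eq_add_neg, mono_add hz, ← Pi.single_neg,
      mono_single, neg_neg, zpow_one, hw, div_eq_mul_inv, mul_pow, mul_pow, mul_pow]
    have h1 : z i * (z i)⁻¹ = 1 := mul_inv_cancel₀ (hz i)
    have h2 : z j ^ p * ((z j)⁻¹) ^ p = 1 := by rw [← mul_pow, mul_inv_cancel₀ (hz j), one_pow]
    have h3 : z i ^ p * ((z i)⁻¹) ^ p = 1 := by rw [← mul_pow, h1, one_pow]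
    calc _ = (z i * (z i)⁻¹) * (z j ^ p * ((z j)⁻¹) ^ p) * (z i ^ p * ((z i)⁻¹) ^ p) *
          (t ^ p * g (k + Pi.single i (-1) + (p : ℤ) • e) * mono z k) := by ring
      _ = _ := by rw [h1, h2, h3]; ring
  have hstep : ∀ p : ℕ, t ^ p * g (k - Pi.single i 1 + (p : ℤ) • e) =
      t ^ p * c (k + (p : ℤ) • e) - t ^ (p + 1) * c (k + ((p + 1 : ℕ) : ℤ) • e) := by
    intro p
    rw [hg, act_lin, smul_eq_mul, pow_succ]
    have h1 : k - Pi.single i 1 + (p : ℤ) • e + Pi.single i 1 = k + (p : ℤ) • e := by abel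
    have h2 : k - Pi.single i 1 + (p : ℤ) • e + Pi.single j 1 = k + ((p + 1 : ℕ) : ℤ) • e := by
      rw [Nat.cast_succ, add_smul, one_smul]
      have h3 : e + Pi.single i 1 = Pi.single j 1 := by rw [he]; abel
      rw [← h3]; abel
    rw [h1, h2]; ring
  obtain ⟨p₀, hp₀⟩ := hc k
  -- The telescoping sum over p is finite, since c vanishes far along e, and only the term c_k at p
  -- = 0 survives.
  have hfin : HasSum (fun p : ℕ => t ^ p * g (k - Pi.single i 1 + (p : ℤ) • e)) (c k) := by
    have hz0 : ∀ p ∉ Finset.range p₀, t ^ p * g (k - Pi.single i 1 + (p : ℤ) • e) = 0 := by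
      intro p hp
      rw [Finset.mem_range, not_lt] at hp
      rw [hstep, hp₀ p hp, hp₀ (p + 1) (by omega)]; ring
    have := hasSum_sum_of_ne_finset_zero hz0 (L := SummationFilter.unconditional ℕ)
    rw [Finset.sum_congr rfl fun p _ => hstep p,
      Finset.sum_range_sub' (fun p : ℕ => t ^ p * c (k + (p : ℤ) • e)) p₀, hp₀ p₀ le_rfl] at this
    simpa using this
  refine (hfin.mul_right (mono z k)).congr_fun fun p => ?_
  exact hterm p

theorem hasSum_of_act_prod [DecidableEq ι] {α : Type*} (S : Finset α) (i j : α → ι) (t : α → ℂ)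
    {z : ι → ℂ} (hz : ∀ i, z i ≠ 0) {c : (ι → ℤ) → ℂ} {s : ℂ}
    (hc : ∀ x ∈ S, FarFin c (i x) (j x)) (ht : ∀ x ∈ S, ‖t x * z (j x)‖ < ‖z (i x)‖)
    (h : HasSum (fun k => act (∏ x ∈ S, lin (i x) (j x) (t x)) c k * mono z k) s) :
    HasSum (fun k => c k * mono z k) (s / ∏ x ∈ S, (z (i x) - t x * z (j x))) := by
  classical
  induction S using Finset.induction_on generalizing s with
  | empty => simpa [act_one] using h
  | insert x S hx ih =>
    rw [Finset.prod_insert hx, act_mul] at h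
    have := hasSum_of_act_lin hz ((hc x (Finset.mem_insert_self _ _)).act _)
      (ht x (Finset.mem_insert_self _ _)) h
    rw [Finset.prod_insert hx, ← div_div]
    exact ih (fun y hy => hc y (Finset.mem_insert_of_mem hy))
      (fun y hy => ht y (Finset.mem_insert_of_mem hy)) this

theorem hasSum_delta {z : ι → ℂ} (u : ι → ℤ) :
    HasSum (fun k => delta u k * mono z k) (mono z u) := by
  have : HasSum (fun k => delta u k * mono z k) (delta u u * mono z u) :=
    hasSum_single u fun k hk => by rw [delta, if_neg hk, zero_mul]
  simpa [delta] using this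

/-- The monomial `z ^ u` as a polynomial. -/
def monoPoly (u : ι → ℕ) : MvPolynomial ι ℂ := ∏ i, X i ^ u i

theorem eval_monoPoly (z : ι → ℂ) (u : ι → ℕ) :
    eval z (monoPoly u) = (mono z fun i => (u i : ℤ))⁻¹ := by
  simp [monoPoly, mono, map_prod]

/-- A distribution which becomes a Laurent polynomial after multiplication by linear factors
converges to a rational function. -/
theorem convergesTo_of_act {N : ℕ} {α : Type*} (S : Finset α) (i j : α → Fin N) (t : α → ℂ)
    (hij : ∀ x ∈ S, i x < j x) {c : (Fin N → ℤ) → ℂ}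
    (hc : ∀ x ∈ S, FarFin c (i x) (j x)) (P : MvPolynomial (Fin N) ℂ) (u : Fin N → ℕ)
    (h : act (∏ x ∈ S, lin (i x) (j x) (t x)) c = act P (delta fun i => (u i : ℤ))) :
    ConvergesTo c P (monoPoly u * ∏ x ∈ S, lin (i x) (j x) (t x)) := by
  -- This constant exceeds every ‖t x‖, so in the region each linear factor is nonzero and its
  -- inverse expands geometrically.
  refine ⟨1 + ∑ x ∈ S, ‖t x‖, fun z hz => ?_⟩
  have hlt : ∀ x ∈ S, ‖t x * z (j x)‖ < ‖z (i x)‖ := by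
    intro x hx
    refine lt_of_le_of_lt ?_ (hz.2 _ _ (hij x hx))
    rw [norm_mul]
    refine mul_le_mul_of_nonneg_right ?_ (norm_nonneg _)
    have := Finset.single_le_sum (f := fun x => ‖t x‖) (fun x _ => norm_nonneg _) hx
    linarith
  have hne : ∀ x ∈ S, z (i x) - t x * z (j x) ≠ 0 := by
    intro x hx h0
    have := hlt x hx
    rw [sub_eq_zero] at h0
    rw [h0] at this
    exact lt_irrefl _ this
  constructor
  · rw [map_mul, eval_monoPoly, map_prod]
    refine mul_ne_zero (inv_ne_zero (mono_ne_zero hz.1 _)) (Finset.prod_ne_zero_iff.mpr ?_)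
    intro x hx; rw [eval_lin]; exact hne x hx
  · have h1 := hasSum_act hz.1 (hasSum_delta (z := z) fun i => (u i : ℤ)) P
    rw [← h] at h1
    have h2 := hasSum_of_act_prod S i j t hz.1 hc hlt h1
    have h3 : eval z P / eval z (monoPoly u * ∏ x ∈ S, lin (i x) (j x) (t x)) =
        eval z P * mono z (fun i => (u i : ℤ)) / ∏ x ∈ S, (z (i x) - t x * z (j x)) := by
      rw [map_mul, eval_monoPoly, map_prod, Finset.prod_congr rfl fun x _ => eval_lin _ _ _ _,
        ← div_div, div_inv_eq_mul]
    rw [h3]; exact h2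

theorem farRegion_mono {N : ℕ} {C C' : ℝ} (h : C ≤ C') : farRegion N C' ⊆ farRegion N C :=
  fun _ hz => ⟨hz.1, fun i j hij =>
    (mul_le_mul_of_nonneg_right h (norm_nonneg _)).trans_lt (hz.2 i j hij)⟩

/-- The region contains a product of infinite sets, on which a polynomial is determined by its
values: real intervals from R^(2(N-i)) to R^(2(N-i)+1). Leaving out every other power of R gives
consecutive variables a ratio larger than R, hence larger than C. -/
theorem eq_of_eval_farRegion {N : ℕ} {P Q : MvPolynomial (Fin N) ℂ} (C : ℝ)
    (h : ∀ z ∈ farRegion N C, eval z P = eval z Q) : P = Q := by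
  set R : ℝ := |C| + 2 with hR
  have hR1 : 1 < R := by have := abs_nonneg C; linarith
  have hR0 : 0 < R := by linarith
  refine funext_set (fun i : Fin N => (fun x : ℝ => (x : ℂ)) ''
    Set.Ioo (R ^ (2 * (N - (i : ℕ)))) (R ^ (2 * (N - (i : ℕ)) + 1))) ?_ ?_
  · intro i
    exact (Set.Ioo_infinite (pow_lt_pow_right₀ hR1 (Nat.lt_succ_self _))).image
      Complex.ofReal_injective.injOn
  · intro z hz
    have hz' : ∀ i : Fin N, R ^ (2 * (N - (i : ℕ))) < ‖z i‖ ∧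
        ‖z i‖ < R ^ (2 * (N - (i : ℕ)) + 1) := by
      intro i
      obtain ⟨x, hx, hxz⟩ := hz i (Set.mem_univ _)
      have hx0 : 0 < x := lt_trans (by positivity) hx.1
      simp only at hxz
      rw [← hxz, Complex.norm_real, Real.norm_of_nonneg hx0.le]; exact hx
    refine h z ⟨fun i h0 => ?_, fun i j hij => ?_⟩
    · have := (hz' i).1
      rw [h0, norm_zero] at this
      exact absurd this (not_lt.mpr (by positivity))
    · have h1 := (hz' i).1
      have h2 := (hz' j).2
      have h3 : R ^ (2 * (N - (j : ℕ)) + 1) * R ≤ R ^ (2 * (N - (i : ℕ))) := by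
        rw [← pow_succ]; exact pow_le_pow_right₀ hR1.le (by have := j.2; omega)
      have hCR : C ≤ R := by have := le_abs_self C; linarith
      calc C * ‖z j‖ ≤ R * ‖z j‖ := mul_le_mul_of_nonneg_right hCR (norm_nonneg _)
        _ ≤ R * R ^ (2 * (N - (j : ℕ)) + 1) := mul_le_mul_of_nonneg_left h2.le hR0.le
        _ ≤ _ := by rw [mul_comm]; exact h3
        _ < _ := h1

/-- Written without division, this makes `valueAt` independent of the fraction chosen to represent
the series. -/
theorem ConvergesTo.unique {N : ℕ} {c : (Fin N → ℤ) → ℂ} {P Q P' Q' : MvPolynomial (Fin N) ℂ}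
    (h : ConvergesTo c P Q) (h' : ConvergesTo c P' Q') : P * Q' = P' * Q := by
  obtain ⟨C, hC⟩ := h
  obtain ⟨C', hC'⟩ := h'
  refine eq_of_eval_farRegion (max C C') fun z hz => ?_
  obtain ⟨h1, h2⟩ := hC z (farRegion_mono (le_max_left _ _) hz)
  obtain ⟨h1', h2'⟩ := hC' z (farRegion_mono (le_max_right _ _) hz)
  rw [map_mul, map_mul]
  exact (div_eq_div_iff h1 h1').mp (h2.unique h2')

theorem HasValueAt.unique {N : ℕ} {c : (Fin N → ℤ) → ℂ} {z : Fin N → ℂ} {w w' : ℂ}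
    (h : HasValueAt c z w) (h' : HasValueAt c z w') : w = w' := by
  obtain ⟨P, Q, hc, hQ, rfl⟩ := h
  obtain ⟨P', Q', hc', hQ', rfl⟩ := h'
  rw [div_eq_div_iff hQ hQ', ← map_mul, ← map_mul, hc.unique hc']

theorem HasValueAt.valueAt_eq {N : ℕ} {c : (Fin N → ℤ) → ℂ} {z : Fin N → ℂ} {w : ℂ}
    (h : HasValueAt c z w) : valueAt c z = w :=
  (Classical.epsilon_spec (p := HasValueAt c z) ⟨w, h⟩).unique h

theorem HasValueAt.smul {N : ℕ} {c : (Fin N → ℤ) → ℂ} {z : Fin N → ℂ} {w : ℂ}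
    (h : HasValueAt c z w) (a : ℂ) : HasValueAt (fun k => a * c k) z (a * w) := by
  obtain ⟨P, Q, ⟨C, hC⟩, hQ, rfl⟩ := h
  refine ⟨MvPolynomial.C a * P, Q, ⟨C, fun y hy => ⟨(hC y hy).1, ?_⟩⟩, hQ, ?_⟩
  · have := (hC y hy).2.mul_left a
    rw [map_mul, eval_C, mul_div_assoc]
    exact this.congr_fun fun k => mul_assoc _ _ _
  · rw [map_mul, eval_C, mul_div_assoc]

end Convergence

/-! ### Uniqueness of Laurent expansions -/

/-- On the unit circle this is a Fourier series with zero sum, absolutely convergent because it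
converges at z = 1. Pairing it in L² with a single character isolates each coefficient. -/
theorem eq_zero_of_hasSum_zpow {a : ℤ → ℂ}
    (h : ∀ z : ℂ, z ≠ 0 → HasSum (fun j : ℤ => a j * z ^ (-j)) 0) : a = 0 := by
  have : Fact ((0 : ℝ) < 1) := ⟨one_pos⟩
  let F : ℤ → C(AddCircle (1 : ℝ), ℂ) := fun j => a j • fourier (-j)
  have hsum : Summable F := by
    refine Summable.of_norm ?_
    have h1 := (h 1 one_ne_zero).summable.norm
    refine h1.congr fun j => ?_
    rw [norm_smul, fourier_norm, mul_one, one_zpow, mul_one]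
  have hF0 : HasSum F 0 := by
    have h0 : ∑' j, F j = 0 := by
      ext x
      have h1 := ContinuousMap.hasSum_apply hsum.hasSum x
      have h2 := h (AddCircle.toCircle x : ℂ) (Circle.coe_ne_zero _)
      refine h1.unique (h2.congr_fun fun j => ?_)
      simp only [F, ContinuousMap.smul_apply, fourier_apply, smul_eq_mul]
      rw [AddCircle.toCircle_zsmul, Circle.coe_zpow]
    rw [← h0]; exact hsum.hasSum
  have h2 := hF0.mapL (ContinuousMap.toLp (E := ℂ) 2 AddCircle.haarAddCircle ℂ)
  ext j
  have h3 := h2.mapL (innerSL ℂ (fourierLp (T := 1) 2 (-j)))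
  simp only [map_zero] at h3
  have h4 := h3.unique (hasSum_single j fun i hi => ?_)
  · simp only [F, map_smul, smul_eq_mul, innerSL_apply_apply] at h4
    have h5 := orthonormal_iff_ite.mp (orthonormal_fourier (T := 1)) (-j) (-j)
    rw [if_pos rfl] at h5
    change _ = a j * inner ℂ (fourierLp (T := 1) 2 (-j)) (fourierLp (T := 1) 2 (-j)) at h4
    rw [h5, mul_one] at h4
    exact h4.symm
  · simp only [F, map_smul, smul_eq_mul, innerSL_apply_apply]
    have h5 := orthonormal_iff_ite.mp (orthonormal_fourier (T := 1)) (-j) (-i)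
    rw [if_neg (by simpa using fun h => hi h.symm)] at h5
    change a i * inner ℂ (fourierLp (T := 1) 2 (-j)) (fourierLp (T := 1) 2 (-i)) = 0
    rw [h5, mul_zero]

theorem eq_of_hasSum_zpow {a b : ℤ → ℂ} {φ : ℂ → ℂ}
    (ha : ∀ z : ℂ, z ≠ 0 → HasSum (fun j : ℤ => a j * z ^ (-j)) (φ z))
    (hb : ∀ z : ℂ, z ≠ 0 → HasSum (fun j : ℤ => b j * z ^ (-j)) (φ z)) : a = b := by
  rw [← sub_eq_zero]
  refine eq_zero_of_hasSum_zpow fun z hz => ?_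
  have := (ha z hz).sub (hb z hz)
  rw [sub_self] at this
  exact this.congr_fun fun j => by rw [Pi.sub_apply, sub_mul]

end DrinfeldSl2

end

/-! ### Algebraic tools: antisymmetry, substitution of proportional variables, grading -/

noncomputable section

namespace DrinfeldSl2

open MvPolynomial

/-! ### Antisymmetric distributions -/

section Pairs

variable {R R' : Type*} [CommSemiring R] [CommSemiring R']

/-- The pairs `i < j`. -/
def pairs (N : ℕ) : Finset (Fin N × Fin N) := Finset.univ.filter fun x => x.1 < x.2

theorem mem_pairs {N : ℕ} {x : Fin N × Fin N} : x ∈ pairs N ↔ x.1 < x.2 := by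
  simp [pairs]

/-- The product over all pairs `i < j`. -/
def pairProd {N : ℕ} (f : Fin N → Fin N → R) : R := ∏ x ∈ pairs N, f x.1 x.2

theorem pairProd_congr {N : ℕ} {f g : Fin N → Fin N → R} (h : ∀ i j, i < j → f i j = g i j) :
    pairProd f = pairProd g :=
  Finset.prod_congr rfl fun x hx => h x.1 x.2 (mem_pairs.mp hx)

theorem pairProd_mul {N : ℕ} (f g : Fin N → Fin N → R) :
    pairProd (fun i j => f i j * g i j) = pairProd f * pairProd g :=
  Finset.prod_mul_distrib

theorem map_pairProd {F : Type*} [FunLike F R R'] [MonoidHomClass F R R'] {N : ℕ} (φ : F) (f : Fin N → Fin N → R) :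
    φ (pairProd f) = pairProd fun i j => φ (f i j) := map_prod φ _ _

theorem pairProd_const {N : ℕ} (a : R) : pairProd (fun _ _ : Fin N => a) = a ^ (pairs N).card :=
  Finset.prod_const _

theorem pairProd_append {n m : ℕ} (f : Fin (n + m) → Fin (n + m) → R) :
    pairProd f = (pairProd fun i j => f (Fin.castAdd m i) (Fin.castAdd m j)) *
      (pairProd fun i j => f (Fin.natAdd n i) (Fin.natAdd n j)) *
      ∏ i, ∏ j, f (Fin.castAdd m i) (Fin.natAdd n j) := by
  simp only [pairProd, pairs, Finset.prod_filter, Fintype.prod_prod_type, Fin.prod_univ_add]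
  have h1 : ∀ (i : Fin n) (j : Fin m), Fin.castAdd m i < Fin.natAdd n j := fun i j => by
    rw [Fin.lt_def, Fin.val_castAdd, Fin.val_natAdd]; omega
  have h2 : ∀ (i : Fin n) (j : Fin m), ¬ Fin.natAdd n j < Fin.castAdd m i := fun i j =>
    (h1 i j).not_gt
  have h3 : ∀ i j : Fin n, Fin.castAdd m i < Fin.castAdd m j ↔ i < j := fun i j => Iff.rfl
  have h4 : ∀ i j : Fin m, Fin.natAdd n i < Fin.natAdd n j ↔ i < j := fun i j => by
    rw [Fin.lt_def, Fin.lt_def, Fin.val_natAdd, Fin.val_natAdd]; omega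
  simp only [h1, h2, h3, h4, if_true, if_false, Finset.prod_mul_distrib, Finset.prod_const_one,
    one_mul]
  ring

/-- An adjacent transposition permutes the ordered pairs other than (i, i + 1) among themselves and
reverses that one; r is the product over the others. -/
theorem pairProd_swap {N : ℕ} (i : Fin N) (f : Fin (N + 1) → Fin (N + 1) → R) :
    ∃ r : R, pairProd f = f i.castSucc i.succ * r ∧
      (pairProd fun a b => f (Equiv.swap i.castSucc i.succ a) (Equiv.swap i.castSucc i.succ b)) =
        f i.succ i.castSucc * r := by
  have hmem : (i.castSucc, i.succ) ∈ pairs (N + 1) := mem_pairs.mpr Fin.castSucc_lt_succ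
  refine ⟨∏ x ∈ (pairs (N + 1)).erase (i.castSucc, i.succ), f x.1 x.2,
    (Finset.mul_prod_erase _ _ hmem).symm, ?_⟩
  rw [pairProd, ← Finset.mul_prod_erase _ _ hmem]
  congr 1
  · simp
  · refine Finset.prod_equiv ((Equiv.swap i.castSucc i.succ).prodCongr
      (Equiv.swap i.castSucc i.succ)) ?_ fun _ _ => rfl
    rintro ⟨a, b⟩
    simp only [Finset.mem_erase, mem_pairs, Equiv.prodCongr_apply, Prod.map, ne_eq, Prod.mk.injEq,
      Equiv.swap_apply_def]
    simp only [Fin.ext_iff, Fin.lt_def, Fin.val_castSucc, Fin.val_succ]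
    split_ifs <;> simp only [Fin.val_castSucc, Fin.val_succ] <;> first | omega | simp_all

end Pairs

section Antisymmetric

theorem perm_induction {N : ℕ} {p : Equiv.Perm (Fin N) → Prop} (one : p 1)
    (mul : ∀ σ τ, p σ → p τ → p (σ * τ))
    (swap : ∀ (n : ℕ) (h : n + 1 = N) (i : Fin n),
      p (Equiv.swap (Fin.cast h i.castSucc) (Fin.cast h i.succ))) (σ) : p σ := by
  cases N with
  | zero => rw [Subsingleton.elim σ 1]; exact one
  | succ n =>
    have hσ : σ ∈ Submonoid.closure (Set.range fun i : Fin n => Equiv.swap i.castSucc i.succ) := by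
      rw [Equiv.Perm.mclosure_swap_castSucc_succ]; trivial
    induction hσ using Submonoid.closure_induction with
    | mem x hx => obtain ⟨i, rfl⟩ := hx; exact swap n rfl i
    | one => exact one
    | mul x y _ _ hx hy => exact mul x y hx hy

theorem antisymm_of_swap {M : Type*} [AddCommGroup M] {N : ℕ} {F : (Fin (N + 1) → ℤ) → M}
    (h : ∀ (i : Fin N) k, F (k ∘ Equiv.swap i.castSucc i.succ) = -F k)
    (σ : Equiv.Perm (Fin (N + 1))) (k : Fin (N + 1) → ℤ) :
    F (k ∘ σ) = (Equiv.Perm.sign σ : ℤ) • F k := by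
  induction σ using perm_induction generalizing k with
  | one => simp
  | mul σ τ hσ hτ =>
    rw [Equiv.Perm.coe_mul, ← Function.comp_assoc, hτ, hσ, smul_smul, map_mul, Units.val_mul,
      mul_comm]
  | swap n hn i =>
    obtain rfl : n = N := by omega
    rw [Fin.cast_refl, id, id, h, Equiv.Perm.sign_swap (Fin.castSucc_lt_succ).ne]
    simp

theorem act_delta_injective {ι : Type*} [Finite ι] {P : MvPolynomial ι ℂ} {u : ι → ℤ}
    (h : act P (delta u) = 0) : P = 0 := by
  ext v
  rw [← act_delta P u (fun i => u i - v i) v (fun i => by ring), h, Pi.zero_apply, coeff_zero]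

theorem exists_act_delta {ι : Type*} [Finite ι] (F : (ι → ℤ) → ℂ) (hF : F.support.Finite)
    (u : ι → ℤ) (hu : ∀ k i, u i < k i → F k = 0) :
    ∃ P : MvPolynomial ι ℂ, F = act P (delta u) := by
  classical
  refine ⟨∑ k ∈ hF.toFinset, monomial (Finsupp.equivFunOnFinite.symm fun i => (u i - k i).toNat)
    (F k), ?_⟩
  ext l
  rw [act_sum, Finset.sum_apply]
  have h1 : ∀ k ∈ hF.toFinset, act (monomial (Finsupp.equivFunOnFinite.symm fun i =>
      (u i - k i).toNat) (F k)) (delta u) l = if k = l then F l else 0 := by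
    intro k hk
    rw [Set.Finite.mem_toFinset, Function.mem_support] at hk
    have hk' : ∀ i, k i ≤ u i := fun i => by
      by_contra hlt; exact hk (hu k i (not_le.mp hlt))
    rw [act_monomial, delta]
    by_cases hkl : k = l
    · subst hkl
      rw [if_pos rfl, if_pos, smul_eq_mul, mul_one]
      ext i
      have := hk' i
      rw [Finsupp.coe_equivFunOnFinite_symm]
      omega
    · rw [if_neg hkl, if_neg, smul_zero]
      intro h; apply hkl; ext i
      have := congrFun h i
      have h2 := hk' i
      rw [Finsupp.coe_equivFunOnFinite_symm] at this
      omega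
  rw [Finset.sum_congr rfl h1, Finset.sum_ite_eq']
  split_ifs with h
  · rfl
  · rw [Set.Finite.mem_toFinset, Function.mem_support, not_not] at h; exact h

variable {N : ℕ}

/-- The substitution z_i = z_j, called φ, does not see the swap, so φ P = -φ P = 0. Modulo X_i - X_j
the substitution φ is the identity, hence P lies in the ideal. -/
theorem X_sub_X_dvd {P : MvPolynomial (Fin N) ℂ} {i j : Fin N}
    (h : rename (Equiv.swap i j) P = -P) : X i - X j ∣ P := by
  set φ : MvPolynomial (Fin N) ℂ →ₐ[ℂ] MvPolynomial (Fin N) ℂ :=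
    aeval fun l => if l = i then X j else X l with hφ
  have h1 : φ (rename (Equiv.swap i j) P) = φ P := by
    rw [hφ, aeval_rename]
    congr 2
    ext1 l
    simp only [Function.comp_apply, Equiv.swap_apply_def]
    split_ifs <;> simp_all
  rw [h, map_neg, neg_eq_iff_add_eq_zero, ← two_mul] at h1
  have h2 : φ P = 0 := (mul_eq_zero.mp h1).resolve_left two_ne_zero
  rw [← Ideal.mem_span_singleton, ← Ideal.Quotient.eq_zero_iff_mem]
  have h3 : (Ideal.Quotient.mkₐ ℂ (Ideal.span {(X i - X j : MvPolynomial (Fin N) ℂ)})) =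
      (Ideal.Quotient.mkₐ ℂ (Ideal.span {(X i - X j : MvPolynomial (Fin N) ℂ)})).comp φ := by
    refine algHom_ext fun l => ?_
    rw [AlgHom.comp_apply, hφ, aeval_X]
    split_ifs with hl
    · subst hl
      rw [Ideal.Quotient.mkₐ_eq_mk, Ideal.Quotient.eq]
      exact Ideal.subset_span rfl
    · rfl
  have h4 := DFunLike.congr_fun h3 P
  rw [AlgHom.comp_apply, h2, map_zero] at h4
  exact h4

theorem irreducible_X_sub_X {i j : Fin N} (h : i ≠ j) :
    Irreducible (X i - X j : MvPolynomial (Fin N) ℂ) := by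
  have hc : coeff (Finsupp.single i 1) (X i - X j : MvPolynomial (Fin N) ℂ) = 1 := by
    rw [coeff_sub, coeff_X, coeff_X, if_pos rfl, if_neg, sub_zero]
    intro h'; exact h (Finsupp.single_left_injective one_ne_zero h').symm
  apply irreducible_of_totalDegree_eq_one
  · refine IsHomogeneous.totalDegree ((isHomogeneous_X _ _).sub (isHomogeneous_X _ _)) ?_
    intro h0; rw [h0, coeff_zero] at hc; exact zero_ne_one hc
  · intro x hx
    have := hx (Finsupp.single i 1)
    rw [hc] at this
    exact isUnit_of_dvd_one this

/-- The Vandermonde product `∏_{i < j} (z_i - z_j)`. -/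
def vdm (N : ℕ) : MvPolynomial (Fin N) ℂ := pairProd fun i j => X i - X j

theorem vdm_ne_zero : vdm N ≠ 0 :=
  Finset.prod_ne_zero_iff.mpr fun _ hx => (irreducible_X_sub_X (mem_pairs.mp hx).ne).ne_zero

/-- Each factor divides P, and distinct factors are irreducible and coprime, so their product
divides P. -/
theorem vdm_dvd {P : MvPolynomial (Fin N) ℂ}
    (h : ∀ i j : Fin N, i ≠ j → rename (Equiv.swap i j) P = -P) : vdm N ∣ P := by
  refine Finset.prod_dvd_of_isRelPrime ?_ fun x hx => X_sub_X_dvd (h _ _ (mem_pairs.mp hx).ne)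
  rintro ⟨a, b⟩ hab ⟨c, d⟩ hcd hne
  have hab' : a < b := mem_pairs.mp hab
  have hcd' : c < d := mem_pairs.mp hcd
  rw [Function.onFun, (irreducible_X_sub_X hab'.ne).isRelPrime_iff_not_dvd]
  rintro ⟨Q, hQ⟩
  -- A divisibility between two factors would carry the hyperplane z_a = z_b into z_c = z_d; testing
  -- on coordinate vectors forces {c, d} = {a, b}.
  have key : ∀ z : Fin N → ℂ, z a = z b → z c = z d := by
    intro z hz
    have := congrArg (eval z) hQ
    simp only [map_sub, map_mul, eval_X, hz, sub_self, zero_mul] at this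
    exact sub_eq_zero.mp this
  have hd : d = a ∨ d = b := by
    by_contra! hd
    have := key (Pi.single d 1) (by simp [hd.1.symm, hd.2.symm])
    simp [hcd'.ne] at this
  have hc : c = a ∨ c = b := by
    by_contra! hc
    have := key (Pi.single c 1) (by simp [hc.1.symm, hc.2.symm])
    simp [hcd'.ne'] at this
  apply hne
  rcases hc with rfl | rfl <;> rcases hd with rfl | rfl
  · exact absurd hcd' (lt_irrefl _)
  · rfl
  · exact absurd hcd' hab'.not_gt
  · exact absurd hcd' (lt_irrefl _)

theorem rename_swap_vdm (i : Fin N) :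
    rename (Equiv.swap i.castSucc i.succ) (vdm (N + 1)) = -vdm (N + 1) := by
  obtain ⟨r, h1, h2⟩ := pairProd_swap i fun a b => (X a - X b : MvPolynomial (Fin (N + 1)) ℂ)
  have h3 : rename (Equiv.swap i.castSucc i.succ) (vdm (N + 1)) =
      pairProd fun a b => (X (Equiv.swap i.castSucc i.succ a) -
        X (Equiv.swap i.castSucc i.succ b) : MvPolynomial (Fin (N + 1)) ℂ) := by
    refine (map_pairProd (rename (R := ℂ) (Equiv.swap i.castSucc i.succ)) _).trans
      (pairProd_congr fun a b _ => ?_)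
    simp
  rw [h3, h2, vdm, h1]; ring

/-- An antisymmetric Laurent polynomial is the product of the Vandermonde product and of a
symmetric Laurent polynomial. -/
theorem exists_symmetric {F : (Fin N → ℤ) → ℂ}
    (hanti : ∀ (σ : Equiv.Perm (Fin N)) k, F (k ∘ σ) = (Equiv.Perm.sign σ : ℤ) • F k)
    (hfin : F.support.Finite) (m : ℤ) (hm : ∀ k i, m < k i → F k = 0) :
    ∃ S : MvPolynomial (Fin N) ℂ, (∀ σ : Equiv.Perm (Fin N), rename σ S = S) ∧
      F = act (vdm N * S) (delta fun _ => m) := by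
  obtain ⟨P, hP⟩ := exists_act_delta F hfin (fun _ => m) hm
  have hsign : ∀ σ : Equiv.Perm (Fin N), rename σ P = (Equiv.Perm.sign σ : ℤ) • P := by
    intro σ
    rw [← sub_eq_zero]
    refine act_delta_injective (u := fun _ => m) ?_
    ext k
    have h1 : (fun l : Fin N → ℤ => delta (fun _ => m) (l ∘ σ.symm)) = delta fun _ : Fin N => m := by
      ext l
      have : (l ∘ σ.symm = fun _ => m) ↔ (l = fun _ => m) := by
        constructor
        · intro h; ext i; simpa using congrFun h (σ i)
        · rintro rfl; rfl
      by_cases h : l = fun _ => m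
      · rw [delta, delta, if_pos (this.mpr h), if_pos h]
      · rw [delta, delta, if_neg (mt this.mp h), if_neg h]
    rw [act_sub, Pi.sub_apply, act_rename, h1, map_zsmul, LinearMap.smul_apply, Pi.smul_apply,
      ← hP, hanti, sub_self, Pi.zero_apply]
  obtain ⟨S, hS⟩ := vdm_dvd (P := P) fun i j hij => by
    rw [hsign, Equiv.Perm.sign_swap hij]; simp
  refine ⟨S, fun σ => ?_, by rw [← hS, hP]⟩
  induction σ using perm_induction with
  | one => simp
  | mul σ τ hσ hτ => rw [Equiv.Perm.coe_mul, ← rename_rename, hτ, hσ]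
  | swap n hn i =>
    obtain _ | N := N
    · omega
    obtain rfl : n = N := by omega
    simp only [Fin.cast_refl, id]
    have h1 := hsign (Equiv.swap i.castSucc i.succ)
    rw [Equiv.Perm.sign_swap (Fin.castSucc_lt_succ).ne, hS, map_mul, rename_swap_vdm] at h1
    simp only [Units.val_neg, Units.val_one, neg_smul, one_smul, neg_mul, neg_inj] at h1
    exact mul_left_cancel₀ vdm_ne_zero h1

end Antisymmetric

end DrinfeldSl2

end

noncomputable section

set_option linter.unusedSectionVars false

namespace DrinfeldSl2

open MvPolynomial

/-! ### Specialization of variables -/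

section Specialize

variable {ι κ : Type*} [Fintype ι] [DecidableEq ι] [DecidableEq κ] {M M' : Type*}
  [AddCommGroup M] [Module ℂ M] [AddCommGroup M'] [Module ℂ M']

/-- The sums of the exponents over the fibres of `τ`. -/
def push (τ : ι → κ) (k : ι → ℤ) : κ → ℤ := fun x => ∑ i, if τ i = x then k i else 0

theorem push_add (τ : ι → κ) (k l : ι → ℤ) : push τ (k + l) = push τ k + push τ l := by
  ext x
  simp only [push, Pi.add_apply, ← Finset.sum_add_distrib]
  exact Finset.sum_congr rfl fun i _ => by split_ifs <;> simp

theorem push_single (τ : ι → κ) (i : ι) (n : ℤ) :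
    push τ (Pi.single i n) = Pi.single (τ i) n := by
  ext x
  rw [push, Finset.sum_eq_single i]
  · by_cases h : τ i = x
    · subst h; simp
    · rw [if_neg h, Pi.single_eq_of_ne (Ne.symm h)]
  · intro j _ hj; simp [hj]
  · simp

theorem sum_push [Fintype κ] (τ : ι → κ) (k : ι → ℤ) : ∑ x, push τ k x = ∑ i, k i := by
  simp only [push]
  rw [Finset.sum_comm]
  exact Finset.sum_congr rfl fun i _ => by simp

open Classical in
/-- The substitution `z_i = p_i z_{τ i}` in a formal distribution. -/
def sp (τ : ι → κ) (p : ι → ℂ) (c : (ι → ℤ) → M) (j : κ → ℤ) : M :=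
  ∑ᶠ k : ι → ℤ, if push τ k = j then mono p k • c k else 0

/-- The substitution along `τ` only involves finite sums. -/
def LocFin (τ : ι → κ) (c : (ι → ℤ) → M) : Prop :=
  ∀ j : κ → ℤ, {k | push τ k = j ∧ c k ≠ 0}.Finite

open Classical in
theorem LocFin.support {τ : ι → κ} {c : (ι → ℤ) → M} (h : LocFin τ c) (p : ι → ℂ) (j : κ → ℤ) :
    (Function.support fun k => if push τ k = j then mono p k • c k else 0).Finite := by
  refine (h j).subset fun k hk => ?_
  rw [Function.mem_support] at hk
  by_cases h1 : push τ k = j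
  · rw [if_pos h1] at hk
    exact ⟨h1, fun h0 => hk (by rw [h0, smul_zero])⟩
  · rw [if_neg h1] at hk; exact absurd rfl hk

theorem LocFin.add {τ : ι → κ} {c c' : (ι → ℤ) → M} (h : LocFin τ c) (h' : LocFin τ c') :
    LocFin τ (c + c') := fun j => by
  refine ((h j).union (h' j)).subset fun k hk => ?_
  by_cases h0 : c k = 0
  · exact Or.inr ⟨hk.1, fun h1 => hk.2 (by rw [Pi.add_apply, h0, h1, add_zero])⟩
  · exact Or.inl ⟨hk.1, h0⟩

theorem LocFin.smul {τ : ι → κ} {c : (ι → ℤ) → M} (h : LocFin τ c) (a : ℂ) :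
    LocFin τ (a • c) := fun j =>
  (h j).subset fun k hk => ⟨hk.1, fun h0 => hk.2 (by rw [Pi.smul_apply, h0, smul_zero])⟩

theorem LocFin.act_X {τ : ι → κ} {c : (ι → ℤ) → M} (h : LocFin τ c) (i : ι) :
    LocFin τ (act (X i) c) := fun j => by
  refine ((h (j + Pi.single (τ i) 1)).preimage
    (add_left_injective (Pi.single i (1 : ℤ))).injOn).subset fun k hk => ?_
  refine ⟨?_, ?_⟩
  · simp only
    rw [push_add, push_single, hk.1]
  · have := hk.2
    rwa [DrinfeldSl2.act_X] at this

theorem LocFin.act {τ : ι → κ} {c : (ι → ℤ) → M} (h : LocFin τ c) (P : MvPolynomial ι ℂ) :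
    LocFin τ (act P c) := by
  induction P using MvPolynomial.induction_on generalizing c with
  | C a => rw [act_C]; exact h.smul a
  | add P Q hP hQ => rw [act_add]; exact (hP h).add (hQ h)
  | mul_X P i hP => rw [act_mul]; exact hP (h.act_X i)

theorem sp_add (τ : ι → κ) (p : ι → ℂ) {c c' : (ι → ℤ) → M} (h : LocFin τ c)
    (h' : LocFin τ c') : sp τ p (c + c') = sp τ p c + sp τ p c' := by
  ext j
  rw [Pi.add_apply, sp, sp, sp, ← finsum_add_distrib (h.support p j) (h'.support p j)]
  refine finsum_congr fun k => ?_
  split_ifs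
  · rw [Pi.add_apply, smul_add]
  · rw [add_zero]

theorem sp_map (τ : ι → κ) (p : ι → ℂ) {c : (ι → ℤ) → M} (h : LocFin τ c) (φ : M →ₗ[ℂ] M')
    (j : κ → ℤ) : sp τ p (fun k => φ (c k)) j = φ (sp τ p c j) := by
  rw [sp, sp]
  refine Eq.trans ?_ (AddMonoidHom.map_finsum φ.toAddMonoidHom (h.support p j)).symm
  refine finsum_congr fun k => ?_
  simp only [LinearMap.toAddMonoidHom_coe]
  split_ifs
  · rw [map_smul]
  · rw [map_zero]

theorem sp_smul (τ : ι → κ) (p : ι → ℂ) {c : (ι → ℤ) → M} (h : LocFin τ c) (a : ℂ) :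
    sp τ p (a • c) = a • sp τ p c := by
  ext j
  exact sp_map τ p h (LinearMap.lsmul ℂ M a) j

theorem finsum_ite_comp {X : Type*} (e : X ≃ X) {P Q : X → Prop} [DecidablePred P]
    [DecidablePred Q] (hPQ : ∀ k, Q (e k) ↔ P k) (a : ℂ) (f g : X → M)
    (hfg : ∀ k, P k → f k = a • g (e k)) :
    ∑ᶠ k, (if P k then f k else 0) = a • ∑ᶠ k, if Q k then g k else 0 := by
  rw [← finsum_comp_equiv e (f := fun k => if Q k then g k else 0), smul_finsum]
  refine finsum_congr fun k => ?_
  by_cases h : P k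
  · rw [if_pos h, if_pos ((hPQ k).mpr h), hfg k h]
  · rw [if_neg h, if_neg (mt (hPQ k).mp h), smul_zero]

theorem sp_act_X (τ : ι → κ) {p : ι → ℂ} (hp : ∀ i, p i ≠ 0) (c : (ι → ℤ) → M) (i : ι) :
    sp τ p (act (X i) c) = act (C (p i) * X (τ i)) (sp τ p c) := by
  ext j
  rw [act_C_mul, Pi.smul_apply, act_X, sp, sp]
  classical
  refine finsum_ite_comp (Equiv.addRight (Pi.single i (1 : ℤ))) (fun k => ?_) _ _ _ fun k _ => ?_
  · rw [Equiv.coe_addRight, push_add, push_single, add_left_inj]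
  · rw [act_X, smul_smul, Equiv.coe_addRight, mono_add hp,
      mono_single, zpow_neg_one, mul_comm (mono p k), ← mul_assoc, mul_inv_cancel₀ (hp i), one_mul]

/-- Through this lemma polynomial relations between distributions are specialized to proportional
arguments. Local finiteness allows the sums defining `sp` to be split. -/
theorem sp_act (τ : ι → κ) {p : ι → ℂ} (hp : ∀ i, p i ≠ 0) {c : (ι → ℤ) → M}
    (h : LocFin τ c) (P : MvPolynomial ι ℂ) :
    sp τ p (act P c) = act (aeval (fun i => C (p i) * X (τ i)) P) (sp τ p c) := by
  induction P using MvPolynomial.induction_on generalizing c with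
  | C a => rw [act_C, sp_smul τ p h, aeval_C, algebraMap_eq, act_C]
  | add P Q hP hQ => rw [act_add, sp_add τ p (h.act P) (h.act Q), hP h, hQ h, map_add, act_add]
  | mul_X P i hP =>
    rw [act_mul, hP (h.act_X i), sp_act_X τ hp, ← act_mul]
    congr 2
    rw [map_mul, aeval_X]

theorem locFin_delta (τ : ι → κ) (u : ι → ℤ) : LocFin τ (delta u) := fun j => by
  refine (Set.finite_singleton u).subset fun k hk => ?_
  by_contra h
  exact hk.2 (by rw [delta, if_neg (show ¬k = u from h)])

theorem sp_delta (τ : ι → κ) (p : ι → ℂ) (u : ι → ℤ) :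
    sp τ p (delta u) = mono p u • delta (push τ u) := by
  ext j
  rw [sp, finsum_eq_single _ u]
  · by_cases h : push τ u = j
    · simp [delta, h]
    · simp [delta, h, Ne.symm h]
  · intro k hk; simp [delta, hk]

/-- A common upper bound for the entries together with their sum bounds each entry from below. -/
theorem finite_of_sum_eq (s m : ℤ) : {k : ι → ℤ | ∑ i, k i = s ∧ ∀ i, k i ≤ m}.Finite := by
  refine (Set.Finite.pi' fun _ : ι => Set.finite_Icc (s - Fintype.card ι * |m|) |m|).subset
    fun k hk i => ?_
  have h1 : ∀ i, k i ≤ |m| := fun i => (hk.2 i).trans (le_abs_self m)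
  refine ⟨?_, h1 i⟩
  have h2 : ∑ l ∈ Finset.univ.erase i, k l ≤ ∑ _l ∈ Finset.univ.erase i, |m| :=
    Finset.sum_le_sum fun l _ => h1 l
  have h3 : ∑ _l ∈ Finset.univ.erase i, |m| ≤ ∑ _l : ι, |m| :=
    Finset.sum_le_sum_of_subset_of_nonneg (Finset.erase_subset _ _) fun _ _ _ => abs_nonneg m
  have h4 := Finset.add_sum_erase Finset.univ k (Finset.mem_univ i)
  rw [hk.1] at h4
  have h5 : ∑ _l : ι, |m| = Fintype.card ι * |m| := by simp
  linarith

theorem locFin_of_bounded [Fintype κ] (τ : ι → κ) {c : (ι → ℤ) → M} (m : ℤ)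
    (h : ∀ k i, m < k i → c k = 0) : LocFin τ c := fun j => by
  refine (finite_of_sum_eq (∑ x, j x) m).subset fun k hk => ⟨?_, fun i => ?_⟩
  · rw [← hk.1, sum_push]
  · by_contra h'; exact hk.2 (h k i (not_le.mp h'))

end Specialize

/-! ### Graded modules -/

section Graded

variable {q : ℂ} {V : Type*} [AddCommGroup V] [Module ℂ V] {ρ : Uq q →ₐ[ℂ] Module.End ℂ V}

theorem iSup_degSpace (hV : IsHighestDegree ρ) : ⨆ μ, degSpace ρ μ = ⊤ := by
  obtain ⟨s, N, h⟩ := hV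
  rw [eq_top_iff, ← h]
  exact iSup_le fun k => le_iSup (degSpace ρ) _

theorem hom_induction (hV : IsHighestDegree ρ) {p : V → Prop}
    (hom : ∀ v, IsHomVec ρ v → p v) (add : ∀ v w, p v → p w → p (v + w)) (v : V) : p v := by
  have hv : v ∈ ⨆ μ, degSpace ρ μ := by rw [iSup_degSpace hV]; trivial
  induction hv using Submodule.iSup_induction' with
  | mem μ x hx => exact hom x ⟨μ, hx⟩
  | zero => exact hom 0 ⟨0, Submodule.zero_mem _⟩
  | add x y _ _ hx hy => exact add x y hx hy

/-- Eigenspaces are independent, and those of eigenvalue s + k with k < N already span V, so every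
other eigenspace is zero. If μ does not lie in s + ℤ, all the spaces in question are zero. -/
theorem exists_degBound (hV : IsHighestDegree ρ) (μ : ℂ) :
    ∃ m : ℤ, ∀ k : ℤ, m ≤ k → degSpace ρ (μ + k) = ⊥ := by
  obtain ⟨s, N, h⟩ := hV
  have hind := Module.End.eigenspaces_iSupIndep (ρ (Uq.gen q Gen.d))
  have key : ∀ ν : ℂ, (∀ k : ℤ, k < N → s + k ≠ ν) → degSpace ρ ν = ⊥ := by
    intro ν hν
    have hd := hind ν
    rw [disjoint_iff] at hd
    have htop : ⨆ j, ⨆ (_ : j ≠ ν), Module.End.eigenspace (ρ (Uq.gen q Gen.d)) j = ⊤ := by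
      rw [eq_top_iff, ← h]
      refine iSup_le fun k => ?_
      exact le_iSup₂ (f := fun j (_ : j ≠ ν) => Module.End.eigenspace (ρ (Uq.gen q Gen.d)) j)
        (s + ((k : ℤ) : ℂ)) (hν k k.2)
    rw [htop, inf_top_eq] at hd
    exact hd
  by_cases hμ : ∃ l : ℤ, μ = s + l
  · obtain ⟨l, rfl⟩ := hμ
    refine ⟨N - l, fun k hk => key _ fun k' hk' he => ?_⟩
    rw [add_assoc, add_right_inj] at he
    have : k' = l + k := by exact_mod_cast he
    omega
  · refine ⟨0, fun k _ => key _ fun k' _ he => hμ ⟨k' - k, ?_⟩⟩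
    push_cast
    linear_combination -he

/-- A functional on one graded component, extended by zero along the eigenspace decomposition, is
homogeneous. Such functionals detect every component of w. -/
theorem eq_zero_of_homDual (hV : IsHighestDegree ρ) {w : V}
    (h : ∀ ξ, IsHomDual ρ ξ → ξ w = 0) : w = 0 := by
  classical
  have hint := DirectSum.isInternal_submodule_of_iSupIndep_of_iSup_eq_top
    (Module.End.eigenspaces_iSupIndep (ρ (Uq.gen q Gen.d))) (iSup_degSpace hV)
  let E := LinearEquiv.ofBijective (DirectSum.coeLinearMap fun μ => degSpace ρ μ) hint
  have hE : E.symm w = 0 := by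
    refine DFinsupp.ext fun μ => ?_
    refine (Module.forall_dual_apply_eq_zero_iff ℂ _).mp fun f => ?_
    refine h (f ∘ₗ (DirectSum.component ℂ ℂ (fun μ => degSpace ρ μ) μ) ∘ₗ
      E.symm.toLinearMap) ⟨μ, fun ν hν x hx => ?_⟩
    have hx' : E.symm x = DirectSum.lof ℂ ℂ (fun μ => degSpace ρ μ) ν ⟨x, hx⟩ := by
      rw [LinearEquiv.symm_apply_eq]
      exact (DirectSum.coeLinearMap_lof (fun μ => degSpace ρ μ) ν ⟨x, hx⟩).symm
    simp only [LinearMap.comp_apply, LinearEquiv.coe_coe, hx']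
    rw [DirectSum.component.of, dif_neg hν]
    simp
  simpa using hE

theorem eq_of_homDual (hV : IsHighestDegree ρ) {w w' : V}
    (h : ∀ ξ, IsHomDual ρ ξ → ξ w = ξ w') : w = w' := by
  rw [← sub_eq_zero]
  exact eq_zero_of_homDual hV fun ξ hξ => by rw [map_sub, h ξ hξ, sub_self]

/-- This is what determines `fieldOf`: Laurent coefficients are unique, homogeneous functionals
separate vectors, and homogeneous vectors span. -/
theorem IsFieldOf.unique (hV : IsHighestDegree ρ) {φ : Module.Dual ℂ V → V → ℂ → ℂ}
    {B B' : ℤ → Module.End ℂ V} (h : IsFieldOf ρ φ B) (h' : IsFieldOf ρ φ B') : B = B' := by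
  ext j v
  refine hom_induction hV (p := fun v => B j v = B' j v) (fun v hv => ?_)
    (fun v w h1 h2 => by rw [map_add, map_add, h1, h2]) v
  refine eq_of_homDual hV fun ξ hξ => ?_
  exact congrFun (eq_of_hasSum_zpow (h ξ v hξ hv) (h' ξ v hξ hv)) j

theorem IsFieldOf.fieldOf_eq (hV : IsHighestDegree ρ) {φ : Module.Dual ℂ V → V → ℂ → ℂ}
    {B : ℤ → Module.End ℂ V} (h : IsFieldOf ρ φ B) : fieldOf ρ φ = B :=
  (Classical.epsilon_spec (p := IsFieldOf ρ φ) ⟨B, h⟩).unique hV h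

variable (ρ) in
/-- A family of operators which is homogeneous up to a shift `h` of the degree. -/
def HomFam {ι : Type*} [Fintype ι] (h : ℤ) (c : (ι → ℤ) → Module.End ℂ V) : Prop :=
  ∀ k μ, ∀ v ∈ degSpace ρ μ, c k v ∈ degSpace ρ (μ + ((∑ i, k i + h : ℤ) : ℂ))

variable (ρ) in
/-- The `j`-th coefficient has degree `j`. -/
def HomField (B : ℤ → Module.End ℂ V) : Prop :=
  ∀ (j : ℤ) μ, ∀ v ∈ degSpace ρ μ, B j v ∈ degSpace ρ (μ + (j : ℂ))

theorem HomFam.act {ι : Type*} [Fintype ι] {h : ℤ} {c : (ι → ℤ) → Module.End ℂ V}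
    (hc : HomFam ρ h c) {P : MvPolynomial ι ℂ} {d : ℕ} (hP : P.IsHomogeneous d) :
    HomFam ρ (h + d) (act P c) := by
  intro k μ v hv
  rw [act_apply, LinearMap.sum_apply]
  refine Submodule.sum_mem _ fun u hu => ?_
  rw [LinearMap.smul_apply]
  refine Submodule.smul_mem _ _ ?_
  have h1 := hc (fun i => k i + (u i : ℤ)) μ v hv
  have h2 : ∑ i, (u i : ℤ) = d := by
    have := hP (mem_support_iff.mp hu)
    rw [show (1 : ι → ℕ) = fun _ => 1 from rfl, ← Finsupp.degree_eq_weight_one,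
      Finsupp.degree_eq_sum] at this
    exact_mod_cast this
  rwa [Finset.sum_add_distrib, h2, show ∑ i, k i + (d : ℤ) + h = ∑ i, k i + (h + d) by ring] at h1

/-- Degree counting: only indices with one prescribed sum can contribute. If the degrees of ξ and v
do not differ by an integer, every coefficient vanishes and s is arbitrary. -/
theorem HomFam.dual {ι : Type*} [Fintype ι] {h : ℤ} {c : (ι → ℤ) → Module.End ℂ V}
    (hc : HomFam ρ h c) {ξ : Module.Dual ℂ V} {v : V} (hξ : IsHomDual ρ ξ) (hv : IsHomVec ρ v) :
    ∃ s : ℤ, ∀ k, ξ (c k v) ≠ 0 → ∑ i, k i = s := by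
  obtain ⟨μ, hμ⟩ := hv
  obtain ⟨ν, hν⟩ := hξ
  by_cases hs : ∃ s : ℤ, ν = μ + s
  · obtain ⟨s, rfl⟩ := hs
    refine ⟨s - h, fun k hk => ?_⟩
    by_contra hne
    refine hk (hν _ (fun he => hne ?_) _ (hc k μ v hμ))
    rw [add_right_inj] at he
    have : ∑ i, k i + h = s := by exact_mod_cast he
    omega
  · exact ⟨0, fun k hk => absurd (hν _ (fun he => hs ⟨_, he.symm⟩) _ (hc k μ v hμ)) hk⟩

end Graded

end DrinfeldSl2

end

/-! ### Universal form of the matrix coefficients of products of currents -/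

noncomputable section

namespace DrinfeldSl2

open MvPolynomial

/-! ### Products of currents -/

section Words

variable {q : ℂ} {V : Type*} [AddCommGroup V] [Module ℂ V] {ρ : Uq q →ₐ[ℂ] Module.End ℂ V}

/-- The coefficients of `A₁(z₁) ⋯ A_N(z_N)`. -/
def word {N : ℕ} (A : Fin N → ℤ → Module.End ℂ V) (k : Fin N → ℤ) : Module.End ℂ V :=
  (List.ofFn fun i => A i (k i)).prod

theorem matrixCoeff_eq {N : ℕ} (A : Fin N → ℤ → Module.End ℂ V) (ξ : Module.Dual ℂ V) (v : V) :
    matrixCoeff A ξ v = fun k => ξ (word A k v) := rfl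

theorem word_succ {N : ℕ} (A : Fin (N + 1) → ℤ → Module.End ℂ V) (k : Fin (N + 1) → ℤ) :
    word A k = A 0 (k 0) * word (fun i => A i.succ) fun i => k i.succ := by
  rw [word, List.ofFn_succ, List.prod_cons]; rfl

theorem word_succ_last {N : ℕ} (A : Fin (N + 1) → ℤ → Module.End ℂ V) (k : Fin (N + 1) → ℤ) :
    word A k = word (fun i => A i.castSucc) (fun i => k i.castSucc) *
      A (Fin.last N) (k (Fin.last N)) := by
  rw [word, List.ofFn_succ', List.concat_eq_append, List.prod_append, List.prod_singleton]; rfl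

theorem word_append {n m : ℕ} (A : ℤ → Module.End ℂ V) (k : Fin n → ℤ) (l : Fin m → ℤ) :
    word (fun _ => A) (Fin.append k l) = word (fun _ => A) k * word (fun _ => A) l := by
  simp only [word]
  rw [← List.prod_append, ← List.ofFn_fin_append]
  congr 2; ext i
  refine Fin.addCases (fun i => ?_) (fun i => ?_) i <;> simp

theorem homFam_word {N : ℕ} {A : Fin N → ℤ → Module.End ℂ V} (hA : ∀ i, HomField ρ (A i)) :
    HomFam ρ 0 (word A) := by
  induction N with
  | zero => intro k μ v hv; simpa [word] using hv
  | succ N ih =>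
    intro k μ v hv
    have h1 := hA 0 (k 0) _ _ (ih (fun i => hA i.succ) (fun i => k i.succ) μ v hv)
    rw [word_succ, Module.End.mul_apply, Fin.sum_univ_succ]
    convert h1 using 2
    push_cast; ring

/-- Moving p units of degree from the letter i to a letter j on its right raises the degree of the
subword after i, and that degree is bounded above on v. The induction strips letters until i is the
first one. -/
theorem farFin_word (hV : IsHighestDegree ρ) {N : ℕ} {A : Fin N → ℤ → Module.End ℂ V}
    (hA : ∀ i, HomField ρ (A i)) {v : V} (hv : IsHomVec ρ v) {i j : Fin N} (hij : i < j) :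
    FarFin (fun k => word A k v) i j := by
  obtain ⟨μ, hμ⟩ := hv
  induction N with
  | zero => exact i.elim0
  | succ N ih =>
    intro k
    obtain ⟨j, rfl⟩ := Fin.exists_succ_eq.mpr (Fin.pos_iff_ne_zero.mp (i.zero_le.trans_lt hij))
    have key : ∃ p₀ : ℕ, ∀ p : ℕ, p₀ ≤ p → word (fun i => A i.succ)
        (fun l => (k + (p : ℤ) • (Pi.single j.succ 1 - Pi.single i 1) : Fin (N + 1) → ℤ) l.succ) v = 0 := by
      rcases Fin.eq_zero_or_eq_succ i with rfl | ⟨i, rfl⟩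
      · obtain ⟨m, hm⟩ := exists_degBound hV μ
        refine ⟨(m - ∑ l : Fin N, k l.succ).toNat, fun p hp => ?_⟩
        have h1 := homFam_word (fun i => hA i.succ)
          (fun l => (k + (p : ℤ) • (Pi.single j.succ 1 - Pi.single 0 1) : Fin (N + 1) → ℤ) l.succ) μ v hμ
        rw [hm, Submodule.mem_bot] at h1
        · exact h1
        · have h2 : ∑ l : Fin N, (Pi.single (M := fun _ => ℤ) j.succ (1 : ℤ)) l.succ = 1 := by
            rw [Finset.sum_eq_single j]
            · simp
            · intro l _ hl; rw [Pi.single_eq_of_ne]; simpa using hl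
            · simp
          simp only [Pi.add_apply, Pi.smul_apply, Pi.sub_apply, smul_eq_mul, add_zero,
            Finset.sum_add_distrib, ← Finset.mul_sum, Finset.sum_sub_distrib, h2]
          simp only [Pi.single_apply, Fin.succ_ne_zero, if_false, Finset.sum_const_zero]
          omega
      · obtain ⟨p₀, hp₀⟩ := ih (fun i => hA i.succ) (Fin.succ_lt_succ_iff.mp hij)
          (fun l => k l.succ)
        refine ⟨p₀, fun p hp => ?_⟩
        rw [← hp₀ p hp]
        congr 2
        ext l
        simp [Pi.single_apply]
    obtain ⟨p₀, hp₀⟩ := key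
    exact ⟨p₀, fun p hp => by simp only; rw [word_succ, Module.End.mul_apply, hp₀ p hp, map_zero]⟩

theorem word_adjacent (A : ℤ → Module.End ℂ V) {N : ℕ} (i : Fin N) (k : Fin (N + 1) → ℤ) :
    ∃ L R : Module.End ℂ V, ∀ k' : Fin (N + 1) → ℤ,
      (∀ l, l ≠ i.castSucc → l ≠ i.succ → k' l = k l) →
      word (fun _ => A) k' = L * (A (k' i.castSucc) * A (k' i.succ)) * R := by
  induction N with
  | zero => exact i.elim0
  | succ N ih =>
    rcases Fin.eq_zero_or_eq_succ i with rfl | ⟨i, rfl⟩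
    · refine ⟨1, word (fun _ => A) fun l : Fin N => k l.succ.succ, fun k' hk' => ?_⟩
      rw [word_succ, word_succ, one_mul, mul_assoc]
      congr 3
      ext l
      exact hk' _ (by simp) (by simp [Fin.ext_iff])
    · obtain ⟨L, R, h⟩ := ih i fun l => k l.succ
      refine ⟨A (k 0) * L, R, fun k' hk' => ?_⟩
      rw [word_succ, h (fun l => k' l.succ) fun l h1 h2 => hk' _
        (fun h => h1 (Fin.succ_injective _ (by rw [h, Fin.succ_castSucc])))
        (fun h => h2 (Fin.succ_injective _ h)), hk' 0 (by simp [Fin.ext_iff]) (by simp [Fin.ext_iff])]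
      simp only [mul_assoc, Fin.succ_castSucc]

variable (ρ) in
/-- A current of degree zero with the exchange relation
`(z - T w) A(z) A(w) = (T z - w) A(w) A(z)`. -/
structure IsCurrent (T : ℂ) (A : ℤ → Module.End ℂ V) : Prop where
  hom : HomField ρ A
  rel : ∀ k l, A (k + 1) * A l - T • (A k * A (l + 1)) = T • (A l * A (k + 1)) - A (l + 1) * A k

/-- The coefficients of `∏_{i < j} (z_i - T z_j) A(z₁) ⋯ A(z_n)`. -/
def antiProd (T : ℂ) (A : ℤ → Module.End ℂ V) (n : ℕ) : (Fin n → ℤ) → Module.End ℂ V :=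
  act (pairProd fun i j => lin i j T) (word fun _ => A)

theorem act_lin_word {T : ℂ} {A : ℤ → Module.End ℂ V} (hA : IsCurrent ρ T A) {N : ℕ} (i : Fin N) :
    act (lin i.castSucc i.succ T) (word fun _ : Fin (N + 1) => A) =
      -act (lin i.succ i.castSucc T)
        (fun k => word (fun _ => A) (k ∘ Equiv.swap i.castSucc i.succ)) := by
  ext1 k
  obtain ⟨L, R, h⟩ := word_adjacent A i k
  have hne : i.castSucc ≠ i.succ := (Fin.castSucc_lt_succ).ne
  have hsw : ∀ l, l ≠ i.castSucc → l ≠ i.succ → Equiv.swap i.castSucc i.succ l = l :=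
    fun l => Equiv.swap_apply_of_ne_of_ne
  rw [Pi.neg_apply, act_lin, act_lin]
  rw [h _ fun l h1 h2 => by simp [h1], h _ fun l h1 h2 => by simp [h2],
    h _ fun l h1 h2 => by simp [hsw l h1 h2, h2], h _ fun l h1 h2 => by simp [hsw l h1 h2, h1]]
  simp only [Function.comp_apply, Equiv.swap_apply_left, Equiv.swap_apply_right, Pi.add_apply,
    Pi.single_eq_same, Pi.single_eq_of_ne hne, Pi.single_eq_of_ne hne.symm, add_zero]
  have := hA.rel (k i.castSucc) (k i.succ)
  calc L * (A (k i.castSucc + 1) * A (k i.succ)) * R -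
        T • (L * (A (k i.castSucc) * A (k i.succ + 1)) * R)
      = L * (A (k i.castSucc + 1) * A (k i.succ) - T • (A (k i.castSucc) * A (k i.succ + 1))) * R := by
        simp only [mul_sub, sub_mul, mul_smul_comm, smul_mul_assoc]
    _ = _ := by
        rw [this]
        simp only [mul_sub, sub_mul, mul_smul_comm, smul_mul_assoc, neg_sub]

/-- By the exchange relation, (z_i - T z_j) A(z_i) A(z_j) with j = i + 1 is minus the same
expression with the two variables exchanged. The remaining linear factors are permuted among
themselves, and adjacent transpositions generate the symmetric group. -/
theorem antiProd_perm {T : ℂ} {A : ℤ → Module.End ℂ V} (hA : IsCurrent ρ T A) {n : ℕ}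
    (σ : Equiv.Perm (Fin n)) (k : Fin n → ℤ) :
    antiProd T A n (k ∘ σ) = (Equiv.Perm.sign σ : ℤ) • antiProd T A n k := by
  cases n with
  | zero => simp [Subsingleton.elim σ 1]
  | succ n =>
    refine antisymm_of_swap (fun i k => ?_) σ k
    obtain ⟨r, h1, h2⟩ := pairProd_swap i fun a b : Fin (n + 1) => lin a b T
    have h3 : rename (Equiv.swap i.castSucc i.succ) (pairProd fun a b : Fin (n + 1) => lin a b T) =
        lin i.succ i.castSucc T * r := by
      rw [← h2]
      refine (map_pairProd (rename (R := ℂ) (Equiv.swap i.castSucc i.succ)) _).trans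
        (pairProd_congr fun a b _ => ?_)
      simp [lin]
    have h4 := act_rename (Equiv.swap i.castSucc i.succ) (pairProd fun a b => lin a b T)
      (fun k => word (fun _ => A) (k ∘ Equiv.swap i.castSucc i.succ)) k
    rw [h3, mul_comm, act_mul] at h4
    have h5 : (fun l : Fin (n + 1) → ℤ => word (fun _ => A)
        ((l ∘ (Equiv.swap i.castSucc i.succ).symm) ∘ Equiv.swap i.castSucc i.succ)) =
        word fun _ => A := by
      ext1 l; congr 1; ext x; simp
    rw [h5] at h4
    rw [antiProd, ← h4, h1, mul_comm, act_mul, act_lin_word hA, map_neg, Pi.neg_apply, neg_neg]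

/-- For every vector, the coefficients vanish when one of the degrees is large. -/
def UB {ι : Type*} (G : (ι → ℤ) → Module.End ℂ V) : Prop :=
  ∀ v, ∃ m : ℕ, ∀ k i, (m : ℤ) < k i → G k v = 0

theorem UB.of_hom (hV : IsHighestDegree ρ) {ι : Type*} {G : (ι → ℤ) → Module.End ℂ V}
    (h : ∀ v, IsHomVec ρ v → ∃ m : ℤ, ∀ k i, m < k i → G k v = 0) : UB G := by
  intro v
  refine hom_induction hV (p := fun v => ∃ m : ℕ, ∀ k i, (m : ℤ) < k i → G k v = 0)
    (fun v hv => ?_) (fun v w => ?_) v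
  · obtain ⟨m, hm⟩ := h v hv
    exact ⟨m.toNat, fun k i hk => hm k i ((Int.self_le_toNat m).trans_lt hk)⟩
  · rintro ⟨m, hm⟩ ⟨m', hm'⟩
    refine ⟨max m m', fun k i hk => ?_⟩
    rw [Nat.cast_max, max_lt_iff] at hk
    rw [map_add, hm k i hk.1, hm' k i hk.2, add_zero]

theorem HomField.eq_zero (hV : IsHighestDegree ρ) {B : ℤ → Module.End ℂ V} (hB : HomField ρ B)
    {v : V} (hv : IsHomVec ρ v) : ∃ m : ℤ, ∀ k, m < k → B k v = 0 := by
  obtain ⟨μ, hμ⟩ := hv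
  obtain ⟨m, hm⟩ := exists_degBound hV μ
  refine ⟨m, fun k hk => ?_⟩
  have := hB k μ v hμ
  rwa [hm k hk.le, Submodule.mem_bot] at this

theorem act_apply_vec {ι : Type*} (P : MvPolynomial ι ℂ) (G : (ι → ℤ) → Module.End ℂ V) (v : V)
    (k : ι → ℤ) : act P G k v = act P (fun l => G l v) k :=
  (act_map (LinearMap.applyₗ v) P G k).symm

/-- The rightmost current kills v once its index is large, even after multiplication by a
polynomial, which only raises indices. Antisymmetry moves any index to the last place. -/
theorem ub_antiProd (hV : IsHighestDegree ρ) {T : ℂ} {A : ℤ → Module.End ℂ V}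
    (hA : IsCurrent ρ T A) (n : ℕ) : UB (antiProd T A n) := by
  refine UB.of_hom hV fun v hv => ?_
  cases n with
  | zero => exact ⟨0, fun k i => i.elim0⟩
  | succ n =>
    obtain ⟨m, hm⟩ := hA.hom.eq_zero hV hv
    have hlast : ∀ k, m < k (Fin.last n) → antiProd T A (n + 1) k v = 0 := by
      intro k hk
      rw [antiProd, act_apply_vec]
      refine act_eq_zero _ _ _ fun u => ?_
      rw [word_succ_last, Module.End.mul_apply, hm _ (by omega), map_zero]
    refine ⟨m, fun k i hk => ?_⟩
    have h1 := hlast (k ∘ Equiv.swap i (Fin.last n)) (by simpa using hk)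
    rw [antiProd_perm hA, LinearMap.smul_apply] at h1
    rcases Int.units_eq_one_or (Equiv.Perm.sign (Equiv.swap i (Fin.last n))) with h | h <;>
      simpa [h] using h1

theorem isHomogeneous_pairProd (T : ℂ) (n : ℕ) :
    (pairProd fun i j : Fin n => lin i j T).IsHomogeneous (pairs n).card := by
  have := IsHomogeneous.prod (pairs n) (fun x => lin x.1 x.2 T) (fun _ => 1)
    fun x _ => isHomogeneous_lin _ _ _
  rw [Finset.sum_const, smul_eq_mul, mul_one] at this
  exact this

theorem homFam_antiProd {T : ℂ} {A : ℤ → Module.End ℂ V} (hA : IsCurrent ρ T A) (n : ℕ) :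
    HomFam ρ (pairs n).card (antiProd T A n) := by
  have := (homFam_word fun _ : Fin n => hA.hom).act (isHomogeneous_pairProd T n)
  rwa [zero_add] at this

/-- Bounded homogeneous matrix coefficients are Laurent polynomials. -/
theorem HomFam.finite {ι : Type*} [Fintype ι] [DecidableEq ι] {h : ℤ}
    {G : (ι → ℤ) → Module.End ℂ V} (hG : HomFam ρ h G) {v : V} {m : ℤ}
    (hm : ∀ k i, m < k i → G k v = 0) {ξ : Module.Dual ℂ V} (hξ : IsHomDual ρ ξ)
    (hv : IsHomVec ρ v) : (Function.support fun k => ξ (G k v)).Finite := by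
  obtain ⟨s, hs⟩ := hG.dual hξ hv
  refine (finite_of_sum_eq s m).subset fun k hk => ⟨hs k hk, fun i => ?_⟩
  by_contra hlt
  exact hk (by simp only [hm k i (not_le.mp hlt), map_zero])

end Words

/-! ### Specialization of a product of currents to proportional arguments -/

section Fuse

variable {q : ℂ} {V : Type*} [AddCommGroup V] [Module ℂ V] {ρ : Uq q →ₐ[ℂ] Module.End ℂ V}

/-- The coefficients of `G(p₁ z, …, p_N z)`. -/
def fuse {N : ℕ} (p : Fin N → ℂ) {G : (Fin N → ℤ) → Module.End ℂ V} (hG : UB G) (j : ℤ) :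
    Module.End ℂ V where
  toFun v := sp (fun _ => (0 : Fin 1)) p (fun k => G k v) fun _ => j
  map_add' v w := by
    obtain ⟨m, hm⟩ := hG v
    obtain ⟨m', hm'⟩ := hG w
    have := sp_add (fun _ => (0 : Fin 1)) p (locFin_of_bounded _ m hm) (locFin_of_bounded _ m' hm')
    rw [← Pi.add_apply, ← this]
    congr 1; ext k; simp
  map_smul' a v := by
    obtain ⟨m, hm⟩ := hG v
    have := sp_smul (fun _ => (0 : Fin 1)) p (locFin_of_bounded _ m hm) a
    rw [RingHom.id_apply, ← Pi.smul_apply, ← this]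
    congr 1; ext k; simp

theorem fuse_dual {N : ℕ} (p : Fin N → ℂ) {G : (Fin N → ℤ) → Module.End ℂ V} (hG : UB G) (j : ℤ)
    (ξ : Module.Dual ℂ V) (v : V) :
    ξ (fuse p hG j v) = sp (fun _ => (0 : Fin 1)) p (fun k => ξ (G k v)) fun _ => j := by
  obtain ⟨m, hm⟩ := hG v
  exact (sp_map _ p (locFin_of_bounded _ m hm) ξ _).symm

theorem fuse_mem {N : ℕ} (p : Fin N → ℂ) {G : (Fin N → ℤ) → Module.End ℂ V} (hG : UB G) {h : ℤ}
    (hh : HomFam ρ h G) (j : ℤ) {μ : ℂ} {v : V} (hv : v ∈ degSpace ρ μ) :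
    fuse p hG j v ∈ degSpace ρ (μ + ((j + h : ℤ) : ℂ)) := by
  change ∑ᶠ _, _ ∈ _
  refine finsum_induction (p := fun w => w ∈ degSpace ρ (μ + ((j + h : ℤ) : ℂ)))
    (Submodule.zero_mem _) (fun _ _ => Submodule.add_mem _) fun k => ?_
  split_ifs with hk
  · have h1 := congrFun hk 0
    have h2 := sum_push (fun _ : Fin N => (0 : Fin 1)) k
    rw [Fin.sum_univ_one, h1] at h2
    rw [h2]
    exact Submodule.smul_mem _ _ (hh k μ v hv)
  · exact Submodule.zero_mem _

theorem mono_push {ι κ : Type*} [Fintype ι] [Fintype κ] [DecidableEq κ] (τ : ι → κ) (p : ι → ℂ)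
    {z : κ → ℂ} (hz : ∀ x, z x ≠ 0) (k : ι → ℤ) :
    mono p k * mono z (push τ k) = mono (fun i => p i * z (τ i)) k := by
  have h1 : mono z (push τ k) = ∏ i, z (τ i) ^ (-k i) := by
    have h2 : ∀ x, z x ^ (-push τ k x) = ∏ i, if τ i = x then z x ^ (-k i) else 1 := by
      intro x
      rw [push, ← Finset.sum_neg_distrib]
      have h3 : ∀ s : Finset ι, z x ^ (∑ i ∈ s, -(if τ i = x then k i else 0)) =
          ∏ i ∈ s, if τ i = x then z x ^ (-k i) else 1 := by
        intro s
        classical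
        induction s using Finset.induction_on with
        | empty => simp
        | insert a s ha ih =>
          rw [Finset.sum_insert ha, Finset.prod_insert ha, zpow_add₀ (hz x), ih]
          congr 1
          split_ifs <;> simp
      exact h3 _
    rw [mono, Finset.prod_congr rfl fun x _ => h2 x, Finset.prod_comm]
    exact Finset.prod_congr rfl fun i _ => by simp
  rw [h1, mono, mono, ← Finset.prod_mul_distrib]
  exact Finset.prod_congr rfl fun i _ => (mul_zpow _ _ _).symm

theorem hasSum_sp {N : ℕ} {p : Fin N → ℂ} (hp : ∀ i, p i ≠ 0) (P : MvPolynomial (Fin N) ℂ)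
    (u : Fin N → ℤ) {z : ℂ} (hz : z ≠ 0) :
    HasSum (fun j : ℤ => sp (fun _ => (0 : Fin 1)) p (act P (delta u)) (fun _ => j) * z ^ (-j))
      (eval (fun i => p i * z) P * mono (fun i => p i * z) u) := by
  have hz' : ∀ _ : Fin 1, z ≠ 0 := fun _ => hz
  have h1 := hasSum_act (z := fun _ : Fin 1 => z) hz'
    ((hasSum_delta (z := fun _ : Fin 1 => z) (push (fun _ : Fin N => (0 : Fin 1)) u)).mul_left
      (mono p u)|>.congr_fun fun k => (mul_assoc _ _ _))
    (aeval (fun i => C (p i) * X (0 : Fin 1)) P)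
  rw [mono_push _ _ hz'] at h1
  have h2 : eval (fun _ : Fin 1 => z) (aeval (fun i => C (p i) * X (0 : Fin 1)) P) =
      eval (fun i => p i * z) P := by
    rw [← coe_aeval_eq_eval, ← coe_aeval_eq_eval]
    have : (aeval (R := ℂ) (fun _ : Fin 1 => z)).comp
        (aeval fun i => C (p i) * X (0 : Fin 1)) = aeval fun i => p i * z := by
      refine algHom_ext fun i => ?_
      simp
    exact DFunLike.congr_fun this P
  rw [h2] at h1
  refine ((Equiv.funUnique (Fin 1) ℤ).symm.hasSum_iff.mpr h1).congr_fun fun j => ?_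
  rw [Function.comp_apply, sp_act _ hp (locFin_delta _ _), sp_delta]
  congr 1
  simp [mono, Equiv.funUnique]

end Fuse

end DrinfeldSl2

end

noncomputable section

namespace DrinfeldSl2

open MvPolynomial

/-! ### Composed currents -/

section Composed

variable {q : ℂ} {V : Type*} [AddCommGroup V] [Module ℂ V] {ρ : Uq q →ₐ[ℂ] Module.End ℂ V}

/-- The proportions `p n 0, …, p n (n - 1)` of the arguments of the `n`-fold composed current. -/
structure IsString (T : ℂ) (p : ∀ n : ℕ, Fin n → ℂ) : Prop where
  ne_zero : ∀ n i, p n i ≠ 0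
  regular : ∀ n i j, i < j → p n i - T * p n j ≠ 0

/-- The composed current `A(p₁ z) ⋯ A(p_n z)`. -/
def compCur (hV : IsHighestDegree ρ) {T : ℂ} {A : ℤ → Module.End ℂ V} (hA : IsCurrent ρ T A)
    (p : ∀ n : ℕ, Fin n → ℂ) (n : ℕ) (j : ℤ) : Module.End ℂ V :=
  (pairProd fun i j => p n i - T * p n j)⁻¹ •
    fuse (p n) (ub_antiProd hV hA n) (j - (pairs n).card)

variable (hV : IsHighestDegree ρ) {T : ℂ} {A : ℤ → Module.End ℂ V} (hA : IsCurrent ρ T A)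
  {p : ∀ n : ℕ, Fin n → ℂ}

theorem homField_compCur (n : ℕ) : HomField ρ (compCur hV hA p n) := by
  intro j μ v hv
  have := fuse_mem (p n) (ub_antiProd hV hA n) (homFam_antiProd hA n) (j - (pairs n).card) hv
  rw [sub_add_cancel] at this
  exact Submodule.smul_mem _ _ this

theorem IsString.pairProd_ne_zero (hp : IsString T p) (n : ℕ) :
    (pairProd fun i j => p n i - T * p n j) ≠ 0 :=
  Finset.prod_ne_zero_iff.mpr fun _ hx => hp.regular n _ _ (mem_pairs.mp hx)

theorem antiProd_dual (n : ℕ) (ξ : Module.Dual ℂ V) (v : V) :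
    (fun k => ξ (antiProd T A n k v)) =
      act (pairProd fun i j => lin i j T) (matrixCoeff (fun _ : Fin n => A) ξ v) := by
  ext k
  rw [antiProd, act_apply_vec, ← act_map]
  rfl

/-- Clearing the factors z_i - T z_j leaves a Laurent polynomial, and these factors do not vanish on
the string. So the rational function is regular there, and its restriction to the string is a
Laurent polynomial in z whose coefficients are those of `compCur`. -/
theorem string_value (hp : IsString T p) (n : ℕ) {ξ : Module.Dual ℂ V} {v : V}
    (hξ : IsHomDual ρ ξ) (hv : IsHomVec ρ v) {z : ℂ} (hz : z ≠ 0) :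
    ∃ w, HasValueAt (matrixCoeff (fun _ : Fin n => A) ξ v) (fun i => p n i * z) w ∧
      HasSum (fun j : ℤ => ξ (compCur hV hA p n j v) * z ^ (-j)) w := by
  obtain ⟨m, hm⟩ := ub_antiProd hV hA n v
  obtain ⟨P, hP⟩ := exists_act_delta (fun k => ξ (antiProd T A n k v))
    ((homFam_antiProd hA n).finite hm hξ hv) (fun _ => (m : ℤ))
    fun k i hk => by simp only [hm k i hk, map_zero]
  have hpz : ∀ i, p n i * z ≠ 0 := fun i => mul_ne_zero (hp.ne_zero n i) hz
  have hD : eval (fun i => p n i * z) (pairProd fun i j => lin i j T) =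
      (pairProd fun i j => p n i - T * p n j) * z ^ (pairs n).card := by
    rw [map_pairProd, ← pairProd_const, ← pairProd_mul]
    refine pairProd_congr fun i j _ => ?_
    rw [eval_lin]; ring
  have hD0 := hp.pairProd_ne_zero n
  refine ⟨_, ⟨P, monoPoly (fun _ => m) * pairProd fun i j => lin i j T, ?_, ?_, rfl⟩, ?_⟩
  · refine convergesTo_of_act (pairs n) (fun x => x.1) (fun x => x.2) (fun _ => T)
      (fun x hx => mem_pairs.mp hx) (fun x hx => ?_) P (fun _ => m) ?_
    · exact (farFin_word hV (fun _ => hA.hom) hv (mem_pairs.mp hx)).map ξ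
    · rw [← hP, antiProd_dual]; rfl
  · rw [map_mul, eval_monoPoly, hD]
    exact mul_ne_zero (inv_ne_zero (mono_ne_zero hpz _)) (mul_ne_zero hD0 (pow_ne_zero _ hz))
  · have h1 := (hasSum_sp (hp.ne_zero n) P (fun _ => (m : ℤ)) hz).mul_left
      ((pairProd fun i j => p n i - T * p n j)⁻¹ * (z ^ (pairs n).card)⁻¹)
    rw [← hP] at h1
    have h2 : (pairProd fun i j => p n i - T * p n j)⁻¹ * (z ^ (pairs n).card)⁻¹ *
        (eval (fun i => p n i * z) P * mono (fun i => p n i * z) fun _ => (m : ℤ)) =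
        eval (fun i => p n i * z) P / eval (fun i => p n i * z)
          (monoPoly (fun _ => m) * pairProd fun i j => lin i j T) := by
      rw [map_mul, eval_monoPoly, hD]
      have h3 := mono_ne_zero hpz fun _ => (m : ℤ)
      have h4 := pow_ne_zero (pairs n).card hz
      generalize (mono (fun i => p n i * z) fun _ => (m : ℤ)) = a at h3
      generalize eval (fun i => p n i * z) P = b
      field_simp
    rw [h2] at h1
    -- On the string the linear factors contribute a power of z equal to the number of pairs;
    -- dividing by it is the index shift in `compCur`.
    refine ((Equiv.subRight ((pairs n).card : ℤ)).hasSum_iff.mpr h1).congr_fun fun j => ?_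
    rw [Function.comp_apply, Equiv.subRight_apply, compCur, LinearMap.smul_apply, map_smul,
      fuse_dual, smul_eq_mul, neg_sub, sub_eq_add_neg _ j, zpow_add₀ hz, zpow_natCast]
    have h4 := pow_ne_zero (pairs n).card hz
    field_simp

/-- The external product of two families. -/
def box {ι κ : Type*} (c : (ι → ℤ) → Module.End ℂ V) (c' : (κ → ℤ) → Module.End ℂ V)
    (k : ι ⊕ κ → ℤ) : Module.End ℂ V :=
  c (k ∘ Sum.inl) * c' (k ∘ Sum.inr)

theorem act_inl_box {ι κ : Type*} [DecidableEq ι] [DecidableEq κ] (P : MvPolynomial ι ℂ)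
    (c : (ι → ℤ) → Module.End ℂ V) (c' : (κ → ℤ) → Module.End ℂ V) :
    act (rename Sum.inl P) (box c c') = box (act P c) c' := by
  induction P using MvPolynomial.induction_on generalizing c with
  | C a =>
    rw [rename_C, act_C, act_C]; ext1 k; simp [box]
  | add P Q hP hQ =>
    rw [map_add, act_add, act_add, hP, hQ]; ext1 k; simp [box, add_mul]
  | mul_X P i hP =>
    rw [map_mul, rename_X, act_mul, act_mul, ← hP]
    congr 1; ext1 k
    rw [act_X, box, box, act_X]
    congr 2
    · ext j; simp [Pi.single_apply]
    · ext j; simp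

theorem act_inr_box {ι κ : Type*} [DecidableEq ι] [DecidableEq κ] (P : MvPolynomial κ ℂ)
    (c : (ι → ℤ) → Module.End ℂ V) (c' : (κ → ℤ) → Module.End ℂ V) :
    act (rename Sum.inr P) (box c c') = box c (act P c') := by
  induction P using MvPolynomial.induction_on generalizing c' with
  | C a =>
    rw [rename_C, act_C, act_C]; ext1 k; simp [box]
  | add P Q hP hQ =>
    rw [map_add, act_add, act_add, hP, hQ]; ext1 k; simp [box, mul_add]
  | mul_X P i hP =>
    rw [map_mul, rename_X, act_mul, act_mul, ← hP]
    congr 1; ext1 k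
    rw [act_X, box, box, act_X]
    congr 2
    · ext j; simp
    · ext j; simp [Pi.single_apply]

variable (T) in
/-- The product of the linear factors between two groups of variables. -/
def cross (n m : ℕ) : MvPolynomial (Fin n ⊕ Fin m) ℂ :=
  ∏ i, ∏ j, lin (Sum.inl i) (Sum.inr j) T

/-- Pairs among n + m variables lie inside one of the two blocks or join them; the mixed factors are
exactly what the product of the two antisymmetrized blocks lacks. -/
theorem act_cross_box (n m : ℕ) :
    act (cross T n m) (box (antiProd T A n) (antiProd T A m)) =
      fun k => antiProd T A (n + m) (k ∘ finSumFinEquiv.symm) := by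
  ext1 k
  have h1 : rename finSumFinEquiv.symm (pairProd fun i j : Fin (n + m) => lin i j T) =
      rename Sum.inl (pairProd fun i j : Fin n => lin i j T) *
      rename Sum.inr (pairProd fun i j : Fin m => lin i j T) * cross T n m := by
    refine (map_pairProd (rename (R := ℂ) finSumFinEquiv.symm) _).trans ?_
    rw [pairProd_append, cross]
    congr 2
    · refine Eq.trans ?_ (map_pairProd (rename (R := ℂ) Sum.inl) _).symm
      exact pairProd_congr fun i j _ => by simp [lin]
    · refine Eq.trans ?_ (map_pairProd (rename (R := ℂ) Sum.inr) _).symm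
      exact pairProd_congr fun i j _ => by simp [lin]
    · ext i; simp [lin]
  have h2 := act_rename finSumFinEquiv.symm (pairProd fun i j : Fin (n + m) => lin i j T)
    (box (word fun _ : Fin n => A) (word fun _ : Fin m => A)) k
  have h3 : (fun l : Fin (n + m) → ℤ => box (word fun _ : Fin n => A) (word fun _ : Fin m => A)
      (l ∘ (finSumFinEquiv (m := n) (n := m)).symm.symm)) = word fun _ => A := by
    ext1 l
    rw [box, ← word_append]
    congr 1
    ext i
    refine Fin.addCases (fun i => ?_) (fun i => ?_) i <;> simp
  rw [h3, h1, mul_comm, act_mul, act_mul, act_inr_box, act_inl_box] at h2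
  exact h2

/-- The first block has no bound uniform in the indices of the second. The indices of the second
block are bounded in terms of v, leaving finitely many, and for each of them the first block is
bounded on the resulting vector. -/
theorem finite_box_support (hV : IsHighestDegree ρ) (hA : IsCurrent ρ T A) (n m : ℕ) (v : V) (j : Fin 2 → ℤ) :
    {k : Fin n ⊕ Fin m → ℤ | push (Sum.elim (fun _ => (0 : Fin 2)) fun _ => 1) k = j ∧
      box (antiProd T A n) (antiProd T A m) k v ≠ 0}.Finite := by
  obtain ⟨b, hb⟩ := ub_antiProd hV hA m v
  have hL := finite_of_sum_eq (ι := Fin m) (j 1) b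
  have hK : ∀ l : Fin m → ℤ, {k : Fin n → ℤ | ∑ i, k i = j 0 ∧
      antiProd T A n k (antiProd T A m l v) ≠ 0}.Finite := by
    intro l
    obtain ⟨b', hb'⟩ := ub_antiProd hV hA n (antiProd T A m l v)
    refine (finite_of_sum_eq (ι := Fin n) (j 0) b').subset fun k hk => ⟨hk.1, fun i => ?_⟩
    by_contra h; exact hk.2 (hb' k i (not_le.mp h))
  have hU := (hL.biUnion fun l _ => (hK l).prod (Set.finite_singleton l))
  refine (hU.preimage (Equiv.sumArrowEquivProdArrow (Fin n) (Fin m) ℤ).injective.injOn).subset ?_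
  rintro k ⟨hk1, hk2⟩
  simp only [Set.mem_preimage, Set.mem_iUnion, Set.mem_prod, Set.mem_singleton_iff,
    Set.mem_ofPred_eq]
  have e0 := congrFun hk1 0
  have e1 := congrFun hk1 1
  simp only [push, Fintype.sum_sum_type, Sum.elim_inl, Sum.elim_inr, if_true, one_ne_zero,
    zero_ne_one, if_false, Finset.sum_const_zero, add_zero, zero_add] at e0 e1
  refine ⟨_, ⟨e1, fun i => ?_⟩, ⟨e0, hk2⟩, rfl⟩
  by_contra h
  refine hk2 ?_
  rw [box, Module.End.mul_apply, hb _ i (not_le.mp h), map_zero]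

theorem sp_box (n m : ℕ) (ξ : Module.Dual ℂ V) (v : V) (j : Fin 2 → ℤ) :
    sp (Sum.elim (fun _ : Fin n => (0 : Fin 2)) fun _ : Fin m => 1) (Sum.elim (p n) (p m))
      (fun k => ξ (box (antiProd T A n) (antiProd T A m) k v)) j =
    ξ (fuse (p n) (ub_antiProd hV hA n) (j 0) (fuse (p m) (ub_antiProd hV hA m) (j 1) v)) := by
  classical
  set τ : Fin n ⊕ Fin m → Fin 2 := Sum.elim (fun _ : Fin n => (0 : Fin 2)) fun _ : Fin m => 1
  have hloc : LocFin τ fun k => ξ (box (antiProd T A n) (antiProd T A m) k v) := fun j =>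
    (finite_box_support hV hA n m v j).subset fun k hk => ⟨hk.1, fun h => hk.2 (by simp only [h, map_zero])⟩
  let e : (Fin n ⊕ Fin m → ℤ) ≃ (Fin m → ℤ) × (Fin n → ℤ) :=
    (Equiv.sumArrowEquivProdArrow (Fin n) (Fin m) ℤ).trans (Equiv.prodComm _ _)
  have hpush : ∀ k l, push τ (e.symm (l, k)) = j ↔ push (fun _ : Fin m => (0 : Fin 1)) l =
      (fun _ => j 1) ∧ push (fun _ : Fin n => (0 : Fin 1)) k = (fun _ => j 0) := by
    intro k l
    simp only [_root_.funext_iff, Fin.forall_fin_two, Fin.forall_fin_one, push, Fintype.sum_sum_type]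
    simp [τ, e, and_comm, Equiv.sumArrowEquivProdArrow]
  have hmono : ∀ k l, mono (Sum.elim (p n) (p m)) (e.symm (l, k)) = mono (p m) l * mono (p n) k := by
    intro k l
    rw [mono, Fintype.prod_sum_type, mul_comm]; rfl
  have hbox : ∀ k l, ξ (box (antiProd T A n) (antiProd T A m) (e.symm (l, k)) v) =
      ξ (antiProd T A n k (antiProd T A m l v)) := fun _ _ => rfl
  rw [sp, ← finsum_comp_equiv e.symm, finsum_curry _
    ((hloc.support _ j).preimage e.symm.injective.injOn)]
  obtain ⟨b, hb⟩ := ub_antiProd hV hA m v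
  have h1 := sp_map (fun _ => (0 : Fin 1)) (p m) (locFin_of_bounded _ b hb)
    (ξ ∘ₗ fuse (p n) (ub_antiProd hV hA n) (j 0)) (fun _ => j 1)
  refine Eq.trans ?_ h1
  rw [sp]
  refine finsum_congr fun l => ?_
  simp only [hpush, hmono, hbox, LinearMap.comp_apply]
  by_cases hl : push (fun _ : Fin m => (0 : Fin 1)) l = fun _ => j 1
  · simp only [hl, true_and, if_true]
    rw [fuse_dual, sp, smul_finsum]
    refine finsum_congr fun k => ?_
    split_ifs
    · rw [smul_smul]
    · rw [smul_zero]
  · simp only [hl, false_and, if_false, finsum_zero]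

end Composed

end DrinfeldSl2

end

noncomputable section

namespace DrinfeldSl2

open MvPolynomial

/-! ### Symmetric functions of the arguments -/

theorem exists_perm_of_map_eq {α : Type*} {N : ℕ} {w w' : Fin N → α}
    (h : Multiset.map w Finset.univ.val = Multiset.map w' Finset.univ.val) :
    ∃ σ : Equiv.Perm (Fin N), w' = w ∘ σ := by
  classical
  have hcard : ∀ a, Nonempty ({i // w' i = a} ≃ {i // w i = a}) := by
    intro a
    refine ⟨Fintype.equivOfCardEq ?_⟩
    have h1 := congrArg (Multiset.count a) h
    rw [Multiset.count_map, Multiset.count_map] at h1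
    rw [Fintype.card_subtype, Fintype.card_subtype, Finset.card_def, Finset.card_def,
      Finset.filter_val, Finset.filter_val]
    simp only [eq_comm (a := a)] at h1
    exact h1.symm
  let σ : Equiv.Perm (Fin N) := (Equiv.sigmaFiberEquiv w').symm.trans
    ((Equiv.sigmaCongrRight fun a => (hcard a).some).trans (Equiv.sigmaFiberEquiv w))
  refine ⟨σ, funext fun i => ?_⟩
  exact ((hcard (w' i)).some ⟨i, rfl⟩).2.symm

section SymData

variable {q : ℂ} {V : Type*} [AddCommGroup V] [Module ℂ V] {ρ : Uq q →ₐ[ℂ] Module.End ℂ V}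

/-- The matrix coefficients of the products of currents, divided by their universal factor, are
the symmetric Laurent polynomials `S N / (z_1 ⋯ z_N) ^ M N`. -/
structure IsSymData (T : ℂ) (A : ℤ → Module.End ℂ V) (ξ : Module.Dual ℂ V) (v : V)
    (S : ∀ N, MvPolynomial (Fin N) ℂ) (M : ℕ → ℕ) : Prop where
  symm : ∀ N (σ : Equiv.Perm (Fin N)), rename σ (S N) = S N
  eq : ∀ N, (fun k => ξ (antiProd T A N k v)) = act (vdm N * S N) (delta fun _ => (M N : ℤ))

theorem exists_symData (hV : IsHighestDegree ρ) {T : ℂ} {A : ℤ → Module.End ℂ V}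
    (hA : IsCurrent ρ T A) {ξ : Module.Dual ℂ V} {v : V}
    (hξ : IsHomDual ρ ξ) (hv : IsHomVec ρ v) : ∃ S M, IsSymData T A ξ v S M := by
  have h : ∀ N, ∃ (S : MvPolynomial (Fin N) ℂ) (m : ℕ), (∀ σ : Equiv.Perm (Fin N), rename σ S = S) ∧
      (fun k => ξ (antiProd T A N k v)) = act (vdm N * S) (delta fun _ => (m : ℤ)) := by
    intro N
    obtain ⟨m, hm⟩ := ub_antiProd hV hA N v
    obtain ⟨S, hS⟩ := exists_symmetric (F := fun k => ξ (antiProd T A N k v))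
      (fun σ k => by rw [antiProd_perm hA, LinearMap.smul_apply, map_zsmul])
      ((homFam_antiProd hA N).finite hm hξ hv) m
      fun k i hk => by simp only [hm k i hk, map_zero]
    exact ⟨S, m, hS⟩
  choose S M hS using h
  exact ⟨S, M, fun N => (hS N).1, fun N => (hS N).2⟩

/-- The value of the symmetric Laurent polynomial at the points `w`. -/
def symVal (S : ∀ N, MvPolynomial (Fin N) ℂ) (M : ℕ → ℕ) (N : ℕ) (w : Fin N → ℂ) : ℂ :=
  eval w (S N) * mono w fun _ => (M N : ℤ)

variable {T : ℂ} {A : ℤ → Module.End ℂ V} {ξ : Module.Dual ℂ V} {v : V}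
  {S : ∀ N, MvPolynomial (Fin N) ℂ} {M : ℕ → ℕ}

/-- Only the multiset of points matters. This is the mechanism by which products of two differently
cut pairs of strings are compared. -/
theorem IsSymData.symVal_congr (h : IsSymData T A ξ v S M) {N N' : ℕ} (hN : N = N')
    {w : Fin N → ℂ} {w' : Fin N' → ℂ}
    (hw : Multiset.map w Finset.univ.val = Multiset.map w' Finset.univ.val) :
    symVal S M N w = symVal S M N' w' := by
  subst hN
  obtain ⟨σ, rfl⟩ := exists_perm_of_map_eq hw
  rw [symVal, symVal]
  congr 1
  · conv_lhs => rw [← h.symm N σ]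
    rw [eval_rename]
  · rw [mono, mono]
    exact (Equiv.prod_comp σ fun i => w i ^ (-(M N : ℤ))).symm

end SymData

/-! ### Products of two composed currents -/

section PairPoly

variable (T : ℂ) (p : ∀ n : ℕ, Fin n → ℂ)

/-- `∏ (p_a z₁ - p_b z₂)`. -/
def numPoly (n m : ℕ) : MvPolynomial (Fin 2) ℂ :=
  ∏ i, ∏ j, (C (p n i) * X 0 - C (p m j) * X 1)

/-- `∏ (p_a z₁ - T p_b z₂)`. -/
def denPoly (n m : ℕ) : MvPolynomial (Fin 2) ℂ :=
  ∏ i, ∏ j, (C (p n i) * X 0 - C T * (C (p m j) * X 1))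

/-- The arguments of the two groups of currents. -/
def pts (n m : ℕ) (x y : ℂ) : Fin (n + m) → ℂ :=
  Fin.append (fun i => p n i * x) fun j => p m j * y

/-- The arguments of the two groups of currents as polynomials. -/
def ptsPoly (n m : ℕ) : Fin (n + m) → MvPolynomial (Fin 2) ℂ :=
  Fin.append (fun i => C (p n i) * X 0) fun j => C (p m j) * X 1

/-- The value at the string of the universal factor of the `n`-fold product. -/
def strConst (n : ℕ) : ℂ :=
  (pairProd fun i j => p n i - p n j) / pairProd fun i j => p n i - T * p n j

variable {T p}

theorem denPoly_cancel {M : Type*} [AddCommGroup M] [Module ℂ M] (hp : IsString T p) {n m : ℕ}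
    {c : (Fin 2 → ℤ) → M} (hc : FarFin c 0 1) (h : act (denPoly T p n m) c = 0) : c = 0 := by
  rw [denPoly, ← Finset.prod_product'] at h
  refine act_prod_cancel _ _ (fun x _ => ?_) h
  refine ⟨0, 1, T * p m x.2 / p n x.1, p n x.1, hc, ?_, hp.ne_zero _ _⟩
  have h0 := hp.ne_zero n x.1
  have h1 : (C T * C (p m x.2) : MvPolynomial (Fin 2) ℂ) =
      C (p n x.1) * C (T * p m x.2 / p n x.1) := by
    rw [← C_mul, ← C_mul, mul_div_cancel₀ _ h0]
  rw [lin]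
  linear_combination (-(X 1 : MvPolynomial (Fin 2) ℂ)) * h1

end PairPoly

section Pair

variable {q : ℂ} {V : Type*} [AddCommGroup V] [Module ℂ V] {ρ : Uq q →ₐ[ℂ] Module.End ℂ V}
  (hV : IsHighestDegree ρ) {T : ℂ} {A : ℤ → Module.End ℂ V} (hA : IsCurrent ρ T A)
  {p : ∀ n : ℕ, Fin n → ℂ} {ξ : Module.Dual ℂ V} {v : V}
  {S : ∀ N, MvPolynomial (Fin N) ℂ} {M : ℕ → ℕ}

/-- The coefficients of the product of two composed currents. -/
def pairFam (hV : IsHighestDegree ρ) (hA : IsCurrent ρ T A) (p : ∀ n : ℕ, Fin n → ℂ) (n m : ℕ)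
    (k : Fin 2 → ℤ) : Module.End ℂ V :=
  compCur hV hA p n (k 0) * compCur hV hA p m (k 1)

theorem word_pair (B B' : ℤ → Module.End ℂ V) (k : Fin 2 → ℤ) :
    word ![B, B'] k = B (k 0) * B' (k 1) := by
  simp [word, List.ofFn_succ]

theorem pairFam_eq_word (n m : ℕ) :
    pairFam hV hA p n m = word ![compCur hV hA p n, compCur hV hA p m] := by
  ext1 k; rw [word_pair]; rfl

theorem homFields_pair (n m : ℕ) :
    ∀ i, HomField ρ (![compCur hV hA p n, compCur hV hA p m] i) := by
  intro i
  fin_cases i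
  · exact homField_compCur hV hA n
  · exact homField_compCur hV hA m

theorem farFin_pairFam (hv : IsHomVec ρ v) (n m : ℕ) :
    FarFin (fun k => pairFam hV hA p n m k v) 0 1 := by
  rw [pairFam_eq_word]
  exact farFin_word hV (homFields_pair hV hA n m) hv Fin.zero_lt_one

theorem aeval_vdm (n m : ℕ) : aeval (ptsPoly p n m) (vdm (n + m)) =
    C (pairProd fun i j => p n i - p n j) * C (pairProd fun i j => p m i - p m j) *
      (X 0 ^ (pairs n).card * X 1 ^ (pairs m).card) * numPoly p n m := by
  have h : ∀ (N : ℕ) (r : Fin N → ℂ) (x : Fin 2),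
      (pairProd fun i j => (C (r i) * X x - C (r j) * X x : MvPolynomial (Fin 2) ℂ)) =
        C (pairProd fun i j => r i - r j) * X x ^ (pairs N).card := by
    intro N r x
    rw [map_pairProd C, ← pairProd_const, ← pairProd_mul]
    exact pairProd_congr fun i j _ => by rw [map_sub, sub_mul]
  rw [vdm, map_pairProd, pairProd_append, numPoly]
  simp only [map_sub, aeval_X, ptsPoly, Fin.append_left, Fin.append_right, h]
  ring

/-- `act_cross_box` expresses the product of two blocks through the product of n + m currents, whose
matrix coefficient is the Vandermonde product times S. The identity is obtained by restricting each
block to its string. -/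
theorem act_denPoly_pairFam (hp : IsString T p) (hS : IsSymData T A ξ v S M) (n m : ℕ) :
    act (denPoly T p n m) (fun k => ξ (pairFam hV hA p n m k v)) =
      act (C (strConst T p n * strConst T p m * mono (Sum.elim (p n) (p m)) fun _ => (M (n + m) : ℤ)) *
        (numPoly p n m * aeval (ptsPoly p n m) (S (n + m))))
        (delta fun x => ((![n * M (n + m), m * M (n + m)] x : ℕ) : ℤ)) := by
  set τ : Fin n ⊕ Fin m → Fin 2 := Sum.elim (fun _ => 0) fun _ => 1 with hτ
  set P : Fin n ⊕ Fin m → ℂ := Sum.elim (p n) (p m) with hP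
  have hP0 : ∀ i, P i ≠ 0 := by rintro (i | i) <;> exact hp.ne_zero _ _
  set g : (Fin n ⊕ Fin m → ℤ) → ℂ := fun k => ξ (box (antiProd T A n) (antiProd T A m) k v) with hg
  have hloc : LocFin τ g := fun j =>
    (finite_box_support hV hA n m v j).subset fun k hk =>
      ⟨hk.1, fun h => hk.2 (by simp only [hg, h, map_zero])⟩
  have hψ : (fun i => (C (P i) * X (τ i) : MvPolynomial (Fin 2) ℂ)) ∘ finSumFinEquiv.symm =
      ptsPoly p n m := by
    ext1 i
    refine Fin.addCases (fun i => ?_) (fun i => ?_) i <;> simp [ptsPoly, P, τ]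
  -- the relation before the specialization
  have h1 : act (cross T n m) g = act (rename finSumFinEquiv.symm (vdm (n + m) * S (n + m)))
      (delta fun _ => (M (n + m) : ℤ)) := by
    ext k
    have h2 := congrFun (act_cross_box (A := A) (T := T) n m) k
    have h3 : act (cross T n m) g k =
        ξ (act (cross T n m) (box (antiProd T A n) (antiProd T A m)) k v) := by
      rw [act_apply_vec, ← act_map]
    rw [h3, h2, act_rename]
    have h4 : (fun l : Fin (n + m) → ℤ =>
        delta (fun _ : Fin n ⊕ Fin m => (M (n + m) : ℤ)) (l ∘ finSumFinEquiv.symm.symm)) =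
        delta fun _ => (M (n + m) : ℤ) := by
      ext l
      have : (l ∘ (finSumFinEquiv (m := n) (n := m)).symm.symm = fun _ => (M (n + m) : ℤ)) ↔
          (l = fun _ => (M (n + m) : ℤ)) := by
        constructor
        · intro h; ext i; simpa using congrFun h (finSumFinEquiv.symm i)
        · rintro rfl; rfl
      by_cases h : l = fun _ => (M (n + m) : ℤ)
      · rw [delta, delta, if_pos (this.mpr h), if_pos h]
      · rw [delta, delta, if_neg (mt this.mp h), if_neg h]
    rw [h4, ← hS.eq]
  have h2 := congrArg (sp τ P) h1
  rw [sp_act τ hP0 hloc, sp_act τ hP0 (locFin_delta _ _), sp_delta, aeval_rename, hψ, map_mul,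
    aeval_vdm] at h2
  have h3 : aeval (fun i => C (P i) * X (τ i)) (cross T n m) = denPoly T p n m := by
    rw [cross, denPoly, map_prod]
    refine Finset.prod_congr rfl fun i _ => ?_
    rw [map_prod]
    refine Finset.prod_congr rfl fun j _ => ?_
    rw [lin, map_sub, map_mul, aeval_X, aeval_X, algHom_C, algebraMap_eq]
    rfl
  have h4 : push τ (fun _ => (M (n + m) : ℤ)) =
      fun x => ((![n * M (n + m), m * M (n + m)] x : ℕ) : ℤ) := by
    ext x
    fin_cases x <;> simp [push, τ]
  have hDn := hp.pairProd_ne_zero n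
  have hDm := hp.pairProd_ne_zero m
  -- Each specialized block is its composed current times a nonzero constant and a power of its
  -- variable; both are injective multiplications and are removed at the end.
  have h5 : sp τ P g = act (X 0 ^ (pairs n).card * X 1 ^ (pairs m).card)
      (((pairProd fun i j => p n i - T * p n j) * pairProd fun i j => p m i - T * p m j) •
        fun k => ξ (pairFam hV hA p n m k v)) := by
    ext j
    rw [hg, sp_box hV hA, act_mul, act_X_pow, act_X_pow]
    simp only [Pi.smul_apply, pairFam, compCur, Pi.add_apply, Pi.single_eq_same, Module.End.mul_apply,
      LinearMap.smul_apply, map_smul, smul_eq_mul]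
    rw [Pi.single_eq_of_ne (show (0 : Fin 2) ≠ 1 by decide),
      Pi.single_eq_of_ne (show (1 : Fin 2) ≠ 0 by decide), add_zero, add_zero, add_sub_cancel_right,
      add_sub_cancel_right]
    field_simp
  rw [h3, h4, h5, act_comm] at h2
  rw [← sub_eq_zero]
  refine act_X_pow_injective 0 (pairs n).card (act_X_pow_injective 1 (pairs m).card ?_)
  rw [act_comm, ← act_mul, map_sub, sub_eq_zero]
  have h6 := congrArg (fun c => ((pairProd fun i j => p n i - T * p n j) *
    pairProd fun i j => p m i - T * p m j)⁻¹ • c) h2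
  simp only [← map_smul, smul_smul, inv_mul_cancel₀ (mul_ne_zero hDn hDm), one_smul] at h6
  rw [h6, ← act_mul, map_smul, ← act_C_mul]
  congr 2
  rw [strConst, strConst]
  simp only [map_mul, div_eq_mul_inv, mul_inv]
  ring

end Pair

end DrinfeldSl2

end

/-! ### Two strings: rational factor, poles, zeros and residues -/

noncomputable section

namespace DrinfeldSl2

open MvPolynomial

/-! ### The product of two composed currents as a rational function -/

theorem farFin_delta {ι : Type*} [DecidableEq ι] {i j : ι} (hij : i ≠ j) (u : ι → ℤ) :
    FarFin (delta u) i j := by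
  intro k
  refine ⟨(u j - k j).toNat + 1, fun r hr => ?_⟩
  rw [delta, if_neg]
  intro h
  have := congrFun h j
  simp only [Pi.add_apply, Pi.smul_apply, Pi.sub_apply, Pi.single_eq_same,
    Pi.single_eq_of_ne hij.symm, sub_zero, smul_eq_mul, mul_one] at this
  omega

theorem act_prod_lin_cancel {M α : Type*} [AddCommGroup M] [Module ℂ M] (s : Finset α) (t : α → ℂ)
    {c c' : (Fin 2 → ℤ) → M} (hc : FarFin c 0 1) (hc' : FarFin c' 0 1)
    (h : act (∏ x ∈ s, lin 0 1 (t x)) c = act (∏ x ∈ s, lin 0 1 (t x)) c') : c = c' := by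
  rw [← sub_eq_zero]
  refine act_prod_cancel s (fun x => lin 0 1 (t x)) (fun x _ => ⟨0, 1, t x, 1, hc.sub hc', ?_, one_ne_zero⟩) ?_
  · rw [map_one, one_mul]
  · rw [map_sub, h, sub_self]

theorem lin_dvd {t : ℂ} {P : MvPolynomial (Fin 2) ℂ} (h : ∀ y, y ≠ 0 → eval ![t * y, y] P = 0) :
    lin 0 1 t ∣ P := by
  set φ : MvPolynomial (Fin 2) ℂ →ₐ[ℂ] MvPolynomial (Fin 2) ℂ :=
    aeval ![C t * X 1, X 1] with hφ
  have h2 : φ P = 0 := by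
    refine funext_set (fun _ => {0}ᶜ) (fun _ => Set.Infinite.mono (s := {0}ᶜ) subset_rfl
      (Set.finite_singleton (0 : ℂ)).infinite_compl) fun z hz => ?_
    have h1 : eval z (φ P) = eval ![t * z 1, z 1] P := by
      rw [hφ, ← coe_aeval_eq_eval, ← coe_aeval_eq_eval]
      have : (aeval (R := ℂ) z).comp (aeval ![C t * X 1, X 1]) = aeval ![t * z 1, z 1] := by
        refine algHom_ext fun i => ?_
        fin_cases i <;> simp
      exact DFunLike.congr_fun this P
    rw [h1, map_zero]
    exact h _ (hz 1 (Set.mem_univ _))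
  rw [← Ideal.mem_span_singleton, ← Ideal.Quotient.eq_zero_iff_mem]
  have h3 : (Ideal.Quotient.mkₐ ℂ (Ideal.span {(lin 0 1 t : MvPolynomial (Fin 2) ℂ)})) =
      (Ideal.Quotient.mkₐ ℂ (Ideal.span {(lin 0 1 t : MvPolynomial (Fin 2) ℂ)})).comp φ := by
    refine algHom_ext fun l => ?_
    rw [AlgHom.comp_apply, hφ, aeval_X]
    fin_cases l
    · simp only [Fin.zero_eta, Matrix.cons_val_zero]
      rw [Ideal.Quotient.mkₐ_eq_mk, Ideal.Quotient.eq]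
      exact Ideal.subset_span rfl
    · rfl
  have h4 := DFunLike.congr_fun h3 P
  rw [AlgHom.comp_apply, h2, map_zero] at h4
  exact h4

/-- The denominator `∏_{l = 1}^b (z_1 - T ^ l z_2)`. -/
def polesPoly (T : ℂ) (b : ℕ) : MvPolynomial (Fin 2) ℂ :=
  ∏ l ∈ Finset.range b, lin 0 1 (T ^ (l + 1))

/-- The numerator `∏_{l = 1}^b (z_1 - T ^ (l - a) z_2)`. -/
def zerosPoly (T : ℂ) (a b : ℕ) : MvPolynomial (Fin 2) ℂ :=
  ∏ l ∈ Finset.range b, lin 0 1 (T ^ ((l : ℤ) + 1 - a))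

/-- `∏_{l = 1}^n (1 - T) / (1 - T ^ l)`. -/
def stringConst (T : ℂ) (n : ℕ) : ℂ := ∏ l ∈ Finset.range n, (1 - T) / (1 - T ^ (l + 1))

/-- The universal factor of the product of the composed currents of orders `n` and `m` has the
poles and zeros determined by the numbers `a` and `b`. -/
structure IsPair (T : ℂ) (p : ∀ n : ℕ, Fin n → ℂ) (n m a b : ℕ) : Prop where
  fac : numPoly p n m * polesPoly T b = denPoly T p n m * zerosPoly T a b
  const : strConst T p n * strConst T p m = stringConst T a * stringConst T b

section PairValue

variable {q : ℂ} {V : Type*} [AddCommGroup V] [Module ℂ V] {ρ : Uq q →ₐ[ℂ] Module.End ℂ V}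
  {hV : IsHighestDegree ρ} {T : ℂ} {A : ℤ → Module.End ℂ V} {hA : IsCurrent ρ T A}
  {p : ∀ n : ℕ, Fin n → ℂ} {ξ : Module.Dual ℂ V} {v : V}
  {S : ∀ N, MvPolynomial (Fin N) ℂ} {M : ℕ → ℕ} {n m a b : ℕ}

/-- The matrix coefficients of the product of two composed currents. -/
def pairCoeff (hV : IsHighestDegree ρ) (hA : IsCurrent ρ T A) (p : ∀ n : ℕ, Fin n → ℂ) (n m : ℕ)
    (ξ : Module.Dual ℂ V) (v : V) : (Fin 2 → ℤ) → ℂ :=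
  matrixCoeff ![compCur hV hA p n, compCur hV hA p m] ξ v

theorem pairCoeff_eq (n m : ℕ) : pairCoeff hV hA p n m ξ v =
    fun k => ξ (pairFam hV hA p n m k v) := by
  rw [pairFam_eq_word]; rfl

theorem farFin_pairCoeff (hv : IsHomVec ρ v) (n m : ℕ) : FarFin (pairCoeff hV hA p n m ξ v) 0 1 := by
  rw [pairCoeff_eq]; exact (farFin_pairFam hV hA hv n m).map ξ

/-- The Laurent polynomial with numerator `Z` times the symmetric part. -/
def pairNum (T : ℂ) (p : ∀ n : ℕ, Fin n → ℂ) (S : ∀ N, MvPolynomial (Fin N) ℂ) (M : ℕ → ℕ)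
    (n m : ℕ) (Z : MvPolynomial (Fin 2) ℂ) : MvPolynomial (Fin 2) ℂ :=
  C (strConst T p n * strConst T p m * mono (Sum.elim (p n) (p m)) fun _ => (M (n + m) : ℤ)) *
    (Z * aeval (ptsPoly p n m) (S (n + m)))

/-- The distribution with which the Laurent polynomial is to be multiplied. -/
def pairDelta (M : ℕ → ℕ) (n m : ℕ) : (Fin 2 → ℤ) → ℂ :=
  delta fun x => ((![n * M (n + m), m * M (n + m)] x : ℕ) : ℤ)

theorem farFin_pairDelta (M : ℕ → ℕ) (n m : ℕ) : FarFin (pairDelta M n m) 0 1 :=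
  farFin_delta Fin.zero_ne_one _

theorem pairNum_mul (E Z : MvPolynomial (Fin 2) ℂ) :
    pairNum T p S M n m (E * Z) = E * pairNum T p S M n m Z := by
  rw [pairNum, pairNum]; ring

/-- After multiplication by `denPoly` the two sides agree by `IsPair.fac`. Since both sides vanish
far along e_1 - e_0, the factors of `denPoly` cancel. -/
theorem act_polesPoly (hp : IsString T p) (hS : IsSymData T A ξ v S M) (hv : IsHomVec ρ v)
    (h : IsPair T p n m a b) : act (polesPoly T b) (pairCoeff hV hA p n m ξ v) =
      act (pairNum T p S M n m (zerosPoly T a b)) (pairDelta M n m) := by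
  have h1 : act (denPoly T p n m) (act (polesPoly T b) (pairCoeff hV hA p n m ξ v) -
      act (pairNum T p S M n m (zerosPoly T a b)) (pairDelta M n m)) = 0 := by
    have h2 := act_denPoly_pairFam hV hA hp hS n m
    rw [← pairCoeff_eq] at h2
    change _ = act (pairNum T p S M n m (numPoly p n m)) (pairDelta M n m) at h2
    rw [map_sub, act_comm, h2, ← act_mul, ← act_mul, ← pairNum_mul, ← pairNum_mul, ← h.fac,
      mul_comm, sub_self]
  rw [← sub_eq_zero]
  exact denPoly_cancel hp (((farFin_pairCoeff hv n m).act _).sub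
    ((farFin_pairDelta M n m).act _)) h1

theorem eval_pairNum (Z : MvPolynomial (Fin 2) ℂ) (x y : ℂ) :
    eval ![x, y] (pairNum T p S M n m Z) * mono ![x, y]
        (fun i => ((![n * M (n + m), m * M (n + m)] i : ℕ) : ℤ)) =
      strConst T p n * strConst T p m * eval ![x, y] Z * symVal S M (n + m) (pts p n m x y) := by
  have h1 : eval ![x, y] (aeval (ptsPoly p n m) (S (n + m))) =
      eval (pts p n m x y) (S (n + m)) := by
    rw [← coe_aeval_eq_eval, ← coe_aeval_eq_eval]
    have : (aeval (R := ℂ) ![x, y]).comp (aeval (ptsPoly p n m)) = aeval (pts p n m x y) := by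
      refine algHom_ext fun i => ?_
      refine Fin.addCases (fun i => ?_) (fun i => ?_) i <;> simp [ptsPoly, pts]
    exact DFunLike.congr_fun this _
  have h2 : mono (pts p n m x y) (fun _ => (M (n + m) : ℤ)) =
      mono (Sum.elim (p n) (p m)) (fun _ => (M (n + m) : ℤ)) *
        mono ![x, y] (fun i => ((![n * M (n + m), m * M (n + m)] i : ℕ) : ℤ)) := by
    simp only [mono, Fin.prod_univ_add, Fintype.prod_sum_type, Fin.prod_univ_two, pts,
      Fin.append_left, Fin.append_right, Sum.elim_inl, Sum.elim_inr, mul_zpow,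
      Finset.prod_mul_distrib, Finset.prod_const, Finset.card_univ, Fintype.card_fin,
      Matrix.cons_val_zero, Matrix.cons_val_one]
    rw [← zpow_natCast, ← zpow_natCast, ← zpow_mul, ← zpow_mul]
    push_cast
    rw [neg_mul, neg_mul, mul_comm (M (n + m) : ℤ), mul_comm (M (n + m) : ℤ)]
    ring
  rw [pairNum, map_mul (eval ![x, y]), eval_C, map_mul (eval ![x, y]), h1, symVal, h2]
  ring

theorem pair_hasValueAt {α : Type*} {s : Finset α} {t : α → ℂ} {c : (Fin 2 → ℤ) → ℂ}
    {Z : MvPolynomial (Fin 2) ℂ} (hc : FarFin c 0 1)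
    (h : act (∏ l ∈ s, lin 0 1 (t l)) c = act (pairNum T p S M n m Z) (pairDelta M n m))
    {x y : ℂ} (hx : x ≠ 0) (hy : y ≠ 0) (hne : ∀ l ∈ s, x - t l * y ≠ 0) :
    HasValueAt c ![x, y] (strConst T p n * strConst T p m *
      (eval ![x, y] Z / ∏ l ∈ s, (x - t l * y)) * symVal S M (n + m) (pts p n m x y)) := by
  have h1 := convergesTo_of_act s (fun _ => 0) (fun _ => 1) t (fun _ _ => Fin.zero_lt_one)
    (fun _ _ => hc) _ _ h
  have hxy : ∀ i, ![x, y] i ≠ 0 := by intro i; fin_cases i <;> assumption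
  have h2 : eval ![x, y] (∏ l ∈ s, lin 0 1 (t l)) = ∏ l ∈ s, (x - t l * y) := by
    rw [map_prod]; simp [eval_lin]
  refine ⟨_, _, h1, ?_, ?_⟩
  · rw [map_mul, eval_monoPoly, h2]
    exact mul_ne_zero (inv_ne_zero (mono_ne_zero hxy _)) (Finset.prod_ne_zero_iff.mpr hne)
  · rw [map_mul, eval_monoPoly, h2, ← div_div, div_inv_eq_mul, eval_pairNum]
    ring

theorem hasPolesAndZeros_of_act {poles zeros : Finset ℤ} {c : (Fin 2 → ℤ) → ℂ} (hc : FarFin c 0 1)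
    {q : ℂ} (h : act (∏ j ∈ poles, lin 0 1 (q ^ (2 * j))) c =
      act (pairNum T p S M n m (∏ j ∈ zeros, lin 0 1 (q ^ (2 * j)))) (pairDelta M n m)) :
    HasPolesAndZeros q c poles zeros := by
  have h1 := convergesTo_of_act poles (fun _ => 0) (fun _ => 1) (fun j => q ^ (2 * j))
    (fun _ _ => Fin.zero_lt_one) (fun _ _ => hc) _ _ h
  refine ⟨pairNum T p S M n m 1, n * M (n + m), m * M (n + m), ?_⟩
  convert h1 using 1
  · rw [mul_comm, ← mul_one (∏ j ∈ zeros, lin 0 1 (q ^ (2 * j))), pairNum_mul]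
    rfl
  · rw [monoPoly, Fin.prod_univ_two]; rfl

end PairValue

end DrinfeldSl2

end

noncomputable section

namespace DrinfeldSl2

open MvPolynomial

/-! ### Geometric strings -/

theorem pairProd_succ {R : Type*} [CommSemiring R] {N : ℕ} (f : Fin (N + 1) → Fin (N + 1) → R) :
    pairProd f = (∏ j : Fin N, f 0 j.succ) * pairProd fun i j : Fin N => f i.succ j.succ := by
  have h : ∀ {N : ℕ} (g : Fin N → Fin N → R),
      pairProd g = ∏ i, ∏ j, if i < j then g i j else 1 := by
    intro N g
    rw [pairProd, pairs, Finset.prod_filter, ← Finset.univ_product_univ, Finset.prod_product]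
  rw [h, h, Fin.prod_univ_succ, Fin.prod_univ_succ]
  simp only [Fin.prod_univ_succ (n := N), Fin.succ_lt_succ_iff, Fin.succ_pos, if_true,
    Fin.not_lt_zero, if_false, one_mul, lt_irrefl]

section Strings

variable {T : ℂ} {p : ∀ n : ℕ, Fin n → ℂ}

theorem one_sub_pow_ne_zero (hT : ∀ n : ℕ, 0 < n → T ^ n ≠ 1) {n : ℕ} (hn : 0 < n) :
    1 - T ^ n ≠ 0 := sub_ne_zero.mpr (hT n hn).symm

theorem isString_of_geometric (hT0 : T ≠ 0) (hT : ∀ n : ℕ, 0 < n → T ^ n ≠ 1)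
    (hp : ∀ n, ∃ s, s ≠ 0 ∧ ∀ i, p n i = s * T ^ (i : ℕ)) : IsString T p := by
  constructor
  · intro n i
    obtain ⟨s, hs, h⟩ := hp n
    rw [h]; exact mul_ne_zero hs (pow_ne_zero _ hT0)
  · intro n i j hij
    obtain ⟨s, hs, h⟩ := hp n
    have h1 : p n i - T * p n j = s * T ^ (i : ℕ) * (1 - T ^ ((j : ℕ) - i + 1)) := by
      obtain ⟨d, hd⟩ := Nat.exists_eq_add_of_lt hij
      rw [h, h, hd, show (i : ℕ) + d + 1 - i + 1 = d + 2 by omega]; ring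
    rw [h1]
    exact mul_ne_zero (mul_ne_zero hs (pow_ne_zero _ hT0)) (one_sub_pow_ne_zero hT (Nat.succ_pos _))

/-- In a string of n + 1 points, the pairs containing the first point contribute a telescoping
product equal to (1 - T)/(1 - T^(n+1)); the other pairs form a string of n points. -/
theorem strConst_of_geometric (hT0 : T ≠ 0) (hT : ∀ n : ℕ, 0 < n → T ^ n ≠ 1)
    (hp : ∀ n, ∃ s, s ≠ 0 ∧ ∀ i, p n i = s * T ^ (i : ℕ)) (n : ℕ) :
    strConst T p n = stringConst T n := by
  have h1 : strConst T p n = pairProd fun i j : Fin n =>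
      (1 - T ^ ((j : ℕ) - i)) / (1 - T ^ ((j : ℕ) - i + 1)) := by
    rw [strConst, pairProd, pairProd, ← Finset.prod_div_distrib]
    refine Finset.prod_congr rfl fun x hx => ?_
    obtain ⟨i, j⟩ := x
    have hij : i < j := mem_pairs.mp hx
    obtain ⟨s, hs, h⟩ := hp n
    dsimp only
    obtain ⟨d, hd⟩ := Nat.exists_eq_add_of_lt hij
    rw [h, h, hd, show (i : ℕ) + d + 1 - i = d + 1 by omega,
      show s * T ^ (i : ℕ) - s * T ^ ((i : ℕ) + d + 1) = s * T ^ (i : ℕ) * (1 - T ^ (d + 1)) by ring,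
      show s * T ^ (i : ℕ) - T * (s * T ^ ((i : ℕ) + d + 1)) =
        s * T ^ (i : ℕ) * (1 - T ^ (d + 1 + 1)) by ring,
      mul_div_mul_left _ _ (mul_ne_zero hs (pow_ne_zero _ hT0))]
  rw [h1]
  clear h1 hp
  induction n with
  | zero => rfl
  | succ n ih =>
    rw [pairProd_succ]
    simp only [Fin.val_succ, Nat.add_sub_add_right, Fin.val_zero, Nat.sub_zero]
    rw [ih, stringConst, stringConst, Finset.prod_range_succ, mul_comm]
    congr 1
    rw [Fin.prod_univ_eq_prod_range (fun j => (1 - T ^ (j + 1)) / (1 - T ^ (j + 1 + 1))) n]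
    clear ih
    induction n with
    | zero =>
      have := one_sub_pow_ne_zero hT Nat.one_pos
      rw [pow_one] at this
      simp [div_self this]
    | succ n ih =>
      rw [Finset.prod_range_succ, ih]
      have := one_sub_pow_ne_zero hT (Nat.succ_pos n)
      rw [Nat.succ_eq_add_one] at this
      field_simp

theorem fac_of_eval {n m a b : ℕ}
    (h : ∀ x y : ℂ, (∏ i, ∏ j, (p n i * x - p m j * y)) *
        ∏ l ∈ Finset.range b, (x - T ^ (l + 1) * y) =
      (∏ i, ∏ j, (p n i * x - T * (p m j * y))) *
        ∏ l ∈ Finset.range b, (x - T ^ ((l : ℤ) + 1 - a) * y)) :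
    numPoly p n m * polesPoly T b = denPoly T p n m * zerosPoly T a b := by
  refine MvPolynomial.funext fun z => ?_
  have := h (z 0) (z 1)
  simpa only [numPoly, polesPoly, denPoly, zerosPoly, map_mul, map_prod, map_sub, eval_C, eval_X,
    eval_lin] using this

variable (T) in
/-- The string `1, T, …, T ^ (n - 1)`. -/
def risingString (n : ℕ) (i : Fin n) : ℂ := T ^ (i : ℕ)

variable (T) in
/-- The string `T ^ (1 - n), …, T⁻¹, 1`. -/
def endingString (n : ℕ) (i : Fin n) : ℂ := T⁻¹ ^ (i.rev : ℕ)

theorem risingString_geometric (n : ℕ) :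
    ∃ s, s ≠ 0 ∧ ∀ i, risingString T n i = s * T ^ (i : ℕ) :=
  ⟨1, one_ne_zero, fun _ => (one_mul _).symm⟩

theorem endingString_geometric (hT0 : T ≠ 0) (n : ℕ) :
    ∃ s, s ≠ 0 ∧ ∀ i, endingString T n i = s * T ^ (i : ℕ) := by
  refine ⟨T⁻¹ ^ (n - 1), pow_ne_zero _ (inv_ne_zero hT0), fun i => ?_⟩
  have h : n - 1 = (i.rev : ℕ) + i := by have := i.2; rw [Fin.val_rev]; omega
  rw [endingString, h, pow_add, mul_assoc, ← mul_pow, inv_mul_cancel₀ hT0, one_pow, mul_one]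

/-- For a fixed point j of the second string the product over the first one telescopes, because
T^(i+1) x - T^(j+1) y = T (T^i x - T^j y). What remains is (x - T^(j+1-n) y)/(x - T^(j+1) y). -/
theorem isPair_risingString (hT0 : T ≠ 0) (hT : ∀ n : ℕ, 0 < n → T ^ n ≠ 1) (n m : ℕ) :
    IsPair T (risingString T) n m n m := by
  refine ⟨fac_of_eval fun x y => ?_, ?_⟩
  · rw [Finset.prod_comm (f := fun i j => risingString T n i * x - risingString T m j * y),
      Finset.prod_comm (f := fun i j => risingString T n i * x - T * (risingString T m j * y)),
      ← Fin.prod_univ_eq_prod_range (fun l => x - T ^ (l + 1) * y) m,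
      ← Fin.prod_univ_eq_prod_range (fun l : ℕ => x - T ^ ((l : ℤ) + 1 - n) * y) m,
      ← Finset.prod_mul_distrib, ← Finset.prod_mul_distrib]
    refine Finset.prod_congr rfl fun j _ => ?_
    simp only [risingString]
    rw [Fin.prod_univ_eq_prod_range (fun i => T ^ i * x - T ^ (j : ℕ) * y) n,
      Fin.prod_univ_eq_prod_range (fun i => T ^ i * x - T * (T ^ (j : ℕ) * y)) n]
    induction n with
    | zero => simp [zpow_add_one₀ hT0, pow_succ]
    | succ n ih =>
      rw [Finset.prod_range_succ, Finset.prod_range_succ]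
      have h1 : T ^ (((j : ℕ) : ℤ) + 1 - n) = T * T ^ (((j : ℕ) : ℤ) + 1 - (n + 1 : ℕ)) := by
        rw [← zpow_one_add₀ hT0]; congr 1; push_cast; ring
      have h2 : T ^ (j : ℕ) = T ^ n * T ^ (((j : ℕ) : ℤ) + 1 - (n + 1 : ℕ)) := by
        rw [← zpow_natCast, ← zpow_natCast, ← zpow_add₀ hT0]; congr 1; push_cast; ring
      rw [h1] at ih
      generalize T ^ (((j : ℕ) : ℤ) + 1 - (n + 1 : ℕ)) = w at *
      rw [pow_succ, h2] at ih
      rw [pow_succ, h2]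
      linear_combination (T ^ n * x - T ^ n * w * y) * ih
  · rw [strConst_of_geometric hT0 hT risingString_geometric,
      strConst_of_geometric hT0 hT risingString_geometric]

/-- Here the point of the first string is fixed and the product over the second telescopes, which
interchanges the roles of n and m. -/
theorem isPair_endingString (hT0 : T ≠ 0) (hT : ∀ n : ℕ, 0 < n → T ^ n ≠ 1) (n m : ℕ) :
    IsPair T (endingString T) n m m n := by
  refine ⟨fac_of_eval fun x y => ?_, ?_⟩
  · simp only [endingString]
    rw [← Equiv.prod_comp Fin.revPerm, ← Equiv.prod_comp Fin.revPerm (fun i : Fin n =>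
        ∏ j : Fin m, (T⁻¹ ^ (i.rev : ℕ) * x - T * (T⁻¹ ^ (j.rev : ℕ) * y))),
      ← Fin.prod_univ_eq_prod_range (fun l => x - T ^ (l + 1) * y) n,
      ← Fin.prod_univ_eq_prod_range (fun l : ℕ => x - T ^ ((l : ℤ) + 1 - m) * y) n,
      ← Finset.prod_mul_distrib, ← Finset.prod_mul_distrib]
    refine Finset.prod_congr rfl fun i _ => ?_
    rw [← Equiv.prod_comp Fin.revPerm, ← Equiv.prod_comp Fin.revPerm (fun j : Fin m =>
        (T⁻¹ ^ ((Fin.revPerm i).rev : ℕ) * x - T * (T⁻¹ ^ (j.rev : ℕ) * y)))]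
    simp only [Fin.revPerm_apply, Fin.rev_rev]
    rw [Fin.prod_univ_eq_prod_range (fun j => T⁻¹ ^ (i : ℕ) * x - T⁻¹ ^ j * y) m,
      Fin.prod_univ_eq_prod_range (fun j => T⁻¹ ^ (i : ℕ) * x - T * (T⁻¹ ^ j * y)) m]
    induction m with
    | zero => simp [zpow_add_one₀ hT0, pow_succ]
    | succ m ih =>
      rw [Finset.prod_range_succ, Finset.prod_range_succ]
      have h1 : T ^ (((i : ℕ) : ℤ) + 1 - m) = T * T ^ (((i : ℕ) : ℤ) + 1 - (m + 1 : ℕ)) := by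
        rw [← zpow_one_add₀ hT0]; congr 1; push_cast; ring
      have h2 : T⁻¹ ^ m = T⁻¹ ^ (i : ℕ) * T ^ (((i : ℕ) : ℤ) + 1 - (m + 1 : ℕ)) := by
        rw [inv_pow, inv_pow, ← zpow_natCast, ← zpow_natCast, ← zpow_neg, ← zpow_neg,
          ← zpow_add₀ hT0]
        congr 1; push_cast; ring
      rw [h1] at ih
      generalize T ^ (((i : ℕ) : ℤ) + 1 - (m + 1 : ℕ)) = w at *
      rw [h2]
      linear_combination (T⁻¹ ^ (i : ℕ) * x - T⁻¹ ^ (i : ℕ) * w * y) * ih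
  · rw [strConst_of_geometric hT0 hT (endingString_geometric hT0),
      strConst_of_geometric hT0 hT (endingString_geometric hT0), mul_comm]

end Strings

end DrinfeldSl2

end

noncomputable section

namespace DrinfeldSl2

open MvPolynomial

/-! ### Residues of the product of two composed currents -/

/-- The coefficient in the residue at `z_1 = T ^ k z_2`. -/
def resCoeff (T : ℂ) (a k : ℕ) : ℂ :=
  (∏ i ∈ Finset.range k, (1 - T ^ (a + i + 1)) * (1 - T⁻¹ ^ (a + i))) /
    ((1 - T) * ∏ i ∈ Finset.range (k - 1), (1 - T ^ (i + 2)) * (1 - T⁻¹ ^ (i + 1)))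

theorem inv_pow_ne_one {T : ℂ} (hT : ∀ n : ℕ, 0 < n → T ^ n ≠ 1) (n : ℕ) (hn : 0 < n) :
    T⁻¹ ^ n ≠ 1 := by
  rw [inv_pow, ne_eq, inv_eq_one]; exact hT n hn

theorem resCoeff_ne_zero {T : ℂ} (hT : ∀ n : ℕ, 0 < n → T ^ n ≠ 1) {a : ℕ} (ha : 1 ≤ a) (k : ℕ) :
    resCoeff T a k ≠ 0 := by
  have h1 := hT 1 Nat.one_pos
  rw [pow_one] at h1
  refine div_ne_zero (Finset.prod_ne_zero_iff.mpr fun i _ => mul_ne_zero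
    (one_sub_pow_ne_zero hT (by omega)) (one_sub_pow_ne_zero (inv_pow_ne_one hT) (by omega)))
    (mul_ne_zero (sub_ne_zero.mpr h1.symm) (Finset.prod_ne_zero_iff.mpr fun i _ => mul_ne_zero
    (one_sub_pow_ne_zero hT (by omega)) (one_sub_pow_ne_zero (inv_pow_ne_one hT) (by omega))))

theorem prod_one_sub_ne_zero {T : ℂ} (hT : ∀ n : ℕ, 0 < n → T ^ n ≠ 1) (a k : ℕ) :
    ∏ i ∈ Finset.range k, (1 - T ^ (a + i + 1)) ≠ 0 :=
  Finset.prod_ne_zero_iff.mpr fun _ _ => one_sub_pow_ne_zero hT (Nat.succ_pos _)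

theorem stringConst_eq (T : ℂ) (n : ℕ) :
    stringConst T n = (1 - T) ^ n / ∏ l ∈ Finset.range n, (1 - T ^ (l + 1)) := by
  rw [stringConst, Finset.prod_div_distrib, Finset.prod_const, Finset.card_range]

theorem prod_range_eq_pow_mul {R : Type*} [CommMonoid R] {n : ℕ} {F f : ℕ → R} {a : R}
    (h : ∀ l < n, F l = a * f l) :
    ∏ l ∈ Finset.range n, F l = a ^ n * ∏ l ∈ Finset.range n, f l := by
  rw [Finset.prod_congr rfl fun l hl => h l (Finset.mem_range.mp hl), Finset.prod_mul_distrib,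
    Finset.prod_const, Finset.card_range]

/-- The residue of the universal factor. -/
theorem factor_residue {T : ℂ} (hT0 : T ≠ 0) (hT : ∀ n : ℕ, 0 < n → T ^ n ≠ 1) (a k r : ℕ)
    {z : ℂ} (hz : z ≠ 0) :
    stringConst T a * stringConst T (k + 1 + r) *
      ((∏ l ∈ Finset.range (k + 1 + r), (T ^ (k + 1) * z - T ^ ((l : ℤ) + 1 - a) * z)) /
        ((∏ l ∈ Finset.range k, (T ^ (k + 1) * z - T ^ (l + 1) * z)) *
          ∏ l ∈ Finset.range r, (T ^ (k + 1) * z - T ^ (k + 1 + l + 1) * z))) =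
    T ^ (k + 1) * z * resCoeff T a (k + 1) * (stringConst T (a + (k + 1)) * stringConst T r *
      ((∏ l ∈ Finset.range r, (z - T ^ ((l : ℤ) + 1 - (a + (k + 1) : ℕ)) * (T ^ (k + 1) * z))) /
        ∏ l ∈ Finset.range r, (z - T ^ (l + 1) * (T ^ (k + 1) * z)))) := by
  have hk0 : T ^ (k + 1) ≠ 0 := pow_ne_zero _ hT0
  have h1T : 1 - T ≠ 0 := by simpa using one_sub_pow_ne_zero hT Nat.one_pos
  -- Every product in the identity is a power of z or of T^(k+1) z, times scalars built from the
  -- products named here; after that only algebra in nonzero quantities remains.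
  set U1 := ∏ i ∈ Finset.range (k + 1), (1 - T ^ (a + i + 1)) with hU1
  set U2 := ∏ i ∈ Finset.range (k + 1), (1 - T⁻¹ ^ (a + i)) with hU2
  set W1 := ∏ i ∈ Finset.range k, (1 - T ^ (i + 2)) with hW1
  set W2 := ∏ i ∈ Finset.range k, (1 - T⁻¹ ^ (i + 1)) with hW2
  set Q := ∏ l ∈ Finset.range r, (1 - T ^ (k + 1 + l + 1)) with hQ
  set N := ∏ l ∈ Finset.range r, (1 - T ^ ((l : ℤ) + 1 - a)) with hN
  set Pa := ∏ l ∈ Finset.range a, (1 - T ^ (l + 1)) with hPa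
  set Pr := ∏ l ∈ Finset.range r, (1 - T ^ (l + 1)) with hPr
  have e1 : ∏ l ∈ Finset.range (k + 1), (1 - T ^ (l + 1)) = (1 - T) * W1 := by
    rw [Finset.prod_range_succ']; simp [hW1, mul_comm, add_assoc]
  have e2 : ∏ l ∈ Finset.range (k + 1 + r), (1 - T ^ (l + 1)) = (1 - T) * W1 * Q := by
    rw [Finset.prod_range_add, e1]
  have e3 : ∏ l ∈ Finset.range (a + (k + 1)), (1 - T ^ (l + 1)) = Pa * U1 := by
    rw [Finset.prod_range_add]
  -- The numerator splits at l = k + 1. Its first k + 1 factors, read backwards, involve negative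
  -- powers of T and give U2; the last r are the factors N of the fused numerator.
  have e4 : ∏ l ∈ Finset.range (k + 1 + r), (T ^ (k + 1) * z - T ^ ((l : ℤ) + 1 - a) * z) =
      (T ^ (k + 1) * z) ^ (k + 1) * U2 * ((T ^ (k + 1) * z) ^ r * N) := by
    rw [Finset.prod_range_add]
    congr 1
    · rw [hU2, ← Finset.prod_range_reflect (fun i => (1 - T⁻¹ ^ (a + i)))]
      refine prod_range_eq_pow_mul fun l hl => ?_
      have : T ^ ((l : ℤ) + 1 - a) = T ^ (k + 1) * T⁻¹ ^ (a + (k + 1 - 1 - l)) := by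
        rw [inv_pow, ← zpow_natCast, ← zpow_natCast, ← zpow_neg, ← zpow_add₀ hT0]
        congr 1; omega
      rw [this]; ring
    · refine prod_range_eq_pow_mul fun l hl => ?_
      have : T ^ (((k + 1 + l : ℕ) : ℤ) + 1 - a) = T ^ (k + 1) * T ^ ((l : ℤ) + 1 - a) := by
        rw [← zpow_natCast, ← zpow_add₀ hT0]; congr 1; push_cast; ring
      rw [this]; ring
  have e5 : ∏ l ∈ Finset.range k, (T ^ (k + 1) * z - T ^ (l + 1) * z) =
      (T ^ (k + 1) * z) ^ k * W2 := by
    rw [hW2, ← Finset.prod_range_reflect (fun i => (1 - T⁻¹ ^ (i + 1)))]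
    refine prod_range_eq_pow_mul fun l hl => ?_
    have : T ^ (l + 1) = T ^ (k + 1) * T⁻¹ ^ (k - 1 - l + 1) := by
      rw [inv_pow, eq_mul_inv_iff_mul_eq₀ (pow_ne_zero _ hT0), ← pow_add]; congr 1; omega
    rw [this]; ring
  have e6 : ∏ l ∈ Finset.range r, (T ^ (k + 1) * z - T ^ (k + 1 + l + 1) * z) =
      (T ^ (k + 1) * z) ^ r * Pr := by
    exact prod_range_eq_pow_mul fun l hl => by ring
  have e7 : ∏ l ∈ Finset.range r, (z - T ^ ((l : ℤ) + 1 - (a + (k + 1) : ℕ)) * (T ^ (k + 1) * z)) =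
      z ^ r * N := by
    refine prod_range_eq_pow_mul fun l hl => ?_
    have : T ^ ((l : ℤ) + 1 - a) = T ^ ((l : ℤ) + 1 - (a + (k + 1) : ℕ)) * T ^ (k + 1) := by
      rw [← zpow_natCast, ← zpow_add₀ hT0]; congr 1; push_cast; ring
    rw [this]; ring
  have e8 : ∏ l ∈ Finset.range r, (z - T ^ (l + 1) * (T ^ (k + 1) * z)) = z ^ r * Q := by
    exact prod_range_eq_pow_mul fun l hl => by ring
  have n1 : U1 ≠ 0 := prod_one_sub_ne_zero hT a _
  have n2 : W1 ≠ 0 := by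
    have := prod_one_sub_ne_zero hT 0 (k + 1)
    simp only [zero_add] at this
    rw [e1] at this
    exact right_ne_zero_of_mul this
  have n3 : W2 ≠ 0 := by
    simpa only [zero_add] using prod_one_sub_ne_zero (inv_pow_ne_one hT) 0 k
  have n4 : Q ≠ 0 := prod_one_sub_ne_zero hT (k + 1) _
  have n5 : Pa ≠ 0 := by simpa using prod_one_sub_ne_zero hT 0 a
  have n6 : Pr ≠ 0 := by simpa using prod_one_sub_ne_zero hT 0 r
  rw [stringConst_eq, stringConst_eq, stringConst_eq, stringConst_eq, e2, e3, e4, e5, e6, e7, e8,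
    resCoeff, Finset.prod_mul_distrib, Finset.prod_mul_distrib, Nat.add_sub_cancel]
  rw [← hU1, ← hU2, ← hW1, ← hW2, ← hPa, ← hPr]
  clear_value U1 U2 W1 W2 Q N Pa Pr
  generalize T ^ (k + 1) = t at *
  generalize 1 - T = s at *
  field_simp
  ring

end DrinfeldSl2

end

noncomputable section

namespace DrinfeldSl2

open MvPolynomial

/-! ### The pole of the product of two composed currents -/

section Residue

variable {q : ℂ} {V : Type*} [AddCommGroup V] [Module ℂ V] {ρ : Uq q →ₐ[ℂ] Module.End ℂ V}
  {hV : IsHighestDegree ρ} {T : ℂ} {A : ℤ → Module.End ℂ V} {hA : IsCurrent ρ T A}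
  {p : ∀ n : ℕ, Fin n → ℂ} {ξ : Module.Dual ℂ V} {v : V}
  {S : ∀ N, MvPolynomial (Fin N) ℂ} {M : ℕ → ℕ} {n m n' m' a b k r : ℕ}

/-- The products of composed currents of orders `n`, `m` at `z_1 = T ^ (k + 1) z_2` and of orders
`n'`, `m'` at `z_2 = T ^ (k + 1) z_1` have the same arguments. -/
structure IsFusion (T : ℂ) (p : ∀ n : ℕ, Fin n → ℂ) (n m n' m' a k r : ℕ) : Prop where
  pair : IsPair T p n m a (k + 1 + r)
  pair' : IsPair T p n' m' (a + (k + 1)) r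
  add_eq : n + m = n' + m'
  pts_eq : ∀ z : ℂ, Multiset.map (pts p n m (T ^ (k + 1) * z) z) Finset.univ.val =
    Multiset.map (pts p n' m' z (T ^ (k + 1) * z)) Finset.univ.val

theorem pow_ne_pow {T : ℂ} (hT0 : T ≠ 0) (hT : ∀ n : ℕ, 0 < n → T ^ n ≠ 1) {i j : ℕ}
    (h : i ≠ j) : T ^ i ≠ T ^ j := by
  intro he
  rcases Nat.lt_or_gt_of_ne h with h | h
  · obtain ⟨d, rfl⟩ := Nat.exists_eq_add_of_lt h
    refine hT (d + 1) (Nat.succ_pos _) (mul_left_cancel₀ (pow_ne_zero i hT0) ?_)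
    rw [← pow_add, mul_one, ← add_assoc, he]
  · obtain ⟨d, rfl⟩ := Nat.exists_eq_add_of_lt h
    refine hT (d + 1) (Nat.succ_pos _) (mul_left_cancel₀ (pow_ne_zero j hT0) ?_)
    rw [← pow_add, mul_one, ← add_assoc, he]

variable (T p S M n m a k r) in
/-- The product of two composed currents times `z_1 - T ^ (k + 1) z_2`. -/
def pairReg (x y : ℂ) : ℂ :=
  strConst T p n * strConst T p m * (eval ![x, y] (zerosPoly T a (k + 1 + r)) /
    ∏ l ∈ (Finset.range (k + 1 + r)).erase k, (x - T ^ (l + 1) * y)) *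
      symVal S M (n + m) (pts p n m x y)

variable (T p S M n m a k r) in
/-- The product of the composed currents of orders `n'` and `m'` at `z_2 = T ^ (k + 1) z_1`. -/
def fusedVal (z : ℂ) : ℂ :=
  strConst T p n * strConst T p m * (eval ![z, T ^ (k + 1) * z] (zerosPoly T (a + (k + 1)) r) /
    ∏ l ∈ Finset.range r, (z - T ^ (l + 1) * (T ^ (k + 1) * z))) *
      symVal S M (n + m) (pts p n m z (T ^ (k + 1) * z))

/-- The poles lie at z_1 = T^(l+1) z_2, whereas here z_2 = T^(k+1) z_1. A coincidence would give
T^(l+k+2) = 1. -/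
theorem hasValueAt_fused (hT0 : T ≠ 0) (hT : ∀ n : ℕ, 0 < n → T ^ n ≠ 1) (hp : IsString T p)
    (hS : IsSymData T A ξ v S M) (hv : IsHomVec ρ v) (h : IsPair T p n' m' (a + (k + 1)) r)
    {z : ℂ} (hz : z ≠ 0) :
    HasValueAt (pairCoeff hV hA p n' m' ξ v) ![z, T ^ (k + 1) * z]
      (fusedVal T p S M n' m' a k r z) := by
  refine pair_hasValueAt (farFin_pairCoeff hv n' m') (act_polesPoly hp hS hv h) hz
    (mul_ne_zero (pow_ne_zero _ hT0) hz) fun l _ => ?_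
  rw [← mul_assoc, ← pow_add, ← one_sub_mul]
  exact mul_ne_zero (one_sub_pow_ne_zero hT (by omega)) hz

theorem hasValueAt_pair (hp : IsString T p)
    (hS : IsSymData T A ξ v S M) (hv : IsHomVec ρ v) (h : IsPair T p n m a (k + 1 + r))
    {x y : ℂ} (hx : x ≠ 0) (hy : y ≠ 0) (hk : x ≠ T ^ (k + 1) * y)
    (hl : ∀ l ∈ (Finset.range (k + 1 + r)).erase k, x - T ^ (l + 1) * y ≠ 0) :
    HasValueAt (pairCoeff hV hA p n m ξ v) ![x, y]
      ((x - T ^ (k + 1) * y)⁻¹ * pairReg T p S M n m a k r x y) := by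
  have h1 := pair_hasValueAt (farFin_pairCoeff (hV := hV) (hA := hA) hv n m)
    (act_polesPoly hp hS hv h) hx hy fun l hl' => by
      by_cases hlk : l = k
      · rw [hlk]; exact sub_ne_zero.mpr hk
      · exact hl l (Finset.mem_erase.mpr ⟨hlk, hl'⟩)
  rw [← Finset.mul_prod_erase _ _ (Finset.mem_range.mpr (show k < k + 1 + r by omega))] at h1
  convert h1 using 1
  rw [pairReg, div_mul_eq_div_div_swap]
  ring

/-- The symmetric parts agree because both pairs of strings have the same points, and the ratio of
the remaining rational factors is `factor_residue`. -/
theorem pairReg_eq (hT0 : T ≠ 0) (hT : ∀ n : ℕ, 0 < n → T ^ n ≠ 1) (hS : IsSymData T A ξ v S M)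
    (h : IsFusion T p n m n' m' a k r) {z : ℂ} (hz : z ≠ 0) :
    pairReg T p S M n m a k r (T ^ (k + 1) * z) z =
      T ^ (k + 1) * z * resCoeff T a (k + 1) * fusedVal T p S M n' m' a k r z := by
  have h1 := factor_residue hT0 hT a k r hz
  have h2 : (∏ l ∈ (Finset.range (k + 1 + r)).erase k, (T ^ (k + 1) * z - T ^ (l + 1) * z)) =
      (∏ l ∈ Finset.range k, (T ^ (k + 1) * z - T ^ (l + 1) * z)) *
          ∏ l ∈ Finset.range r, (T ^ (k + 1) * z - T ^ (k + 1 + l + 1) * z) := by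
    have h3 : (Finset.range (k + 1 + r)).erase k =
        Finset.range k ∪ (Finset.range r).map (addLeftEmbedding (k + 1)) := by
      ext l
      simp only [Finset.mem_erase, Finset.mem_range, Finset.mem_union, Finset.mem_map,
        addLeftEmbedding_apply]
      constructor
      · rintro ⟨h4, h5⟩
        by_cases hlk : l < k
        · exact Or.inl hlk
        · exact Or.inr ⟨l - (k + 1), by omega, by omega⟩
      · rintro (h4 | ⟨l', h4, rfl⟩) <;> omega
    rw [h3, Finset.prod_union, Finset.prod_map]
    · rfl
    · rw [Finset.disjoint_left]
      intro l hl hl'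
      simp only [Finset.mem_range, Finset.mem_map, addLeftEmbedding_apply] at hl hl'
      omega
  rw [pairReg, fusedVal, h2, h.pair.const, h.pair'.const, hS.symVal_congr h.add_eq (h.pts_eq z),
    zerosPoly, zerosPoly, map_prod, map_prod]
  simp only [eval_lin, Matrix.cons_val_zero, Matrix.cons_val_one]
  rw [h1]
  ring

theorem tendsto_pairReg {ι : Type*} {F : Filter ι} {x y : ι → ℂ} {x₀ y₀ : ℂ} (hp : IsString T p)
    (hx : Tendsto x F (𝓝 x₀)) (hy : Tendsto y F (𝓝 y₀)) (hx₀ : x₀ ≠ 0) (hy₀ : y₀ ≠ 0)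
    (hl : ∀ l ∈ (Finset.range (k + 1 + r)).erase k, x₀ - T ^ (l + 1) * y₀ ≠ 0) :
    Tendsto (fun i => pairReg T p S M n m a k r (x i) (y i)) F
      (𝓝 (pairReg T p S M n m a k r x₀ y₀)) := by
  have hxy : Tendsto (fun i => ![x i, y i]) F (𝓝 ![x₀, y₀]) := by
    rw [tendsto_pi_nhds]
    intro j
    fin_cases j <;> assumption
  have hpts : Tendsto (fun i => pts p n m (x i) (y i)) F (𝓝 (pts p n m x₀ y₀)) := by
    rw [tendsto_pi_nhds]
    intro j
    refine Fin.addCases (fun j => ?_) (fun j => ?_) j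
    · simpa only [pts, Fin.append_left] using hx.const_mul _
    · simpa only [pts, Fin.append_right] using hy.const_mul _
  have hpts0 : ∀ j, pts p n m x₀ y₀ j ≠ 0 := by
    intro j
    refine Fin.addCases (fun j => ?_) (fun j => ?_) j
    · simpa only [pts, Fin.append_left] using mul_ne_zero (hp.ne_zero _ _) hx₀
    · simpa only [pts, Fin.append_right] using mul_ne_zero (hp.ne_zero _ _) hy₀
  refine ((((MvPolynomial.continuous_eval _).tendsto _).comp hxy).div
    (tendsto_finsetProd _ fun l _ => hx.sub (hy.const_mul _))
    (Finset.prod_ne_zero_iff.mpr hl)).const_mul _ |>.mul ?_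
  refine (((MvPolynomial.continuous_eval _).tendsto _).comp hpts).mul ?_
  refine tendsto_finsetProd _ fun j _ => ?_
  exact (tendsto_pi_nhds.mp hpts j).zpow₀ _ (Or.inl (hpts0 j))

/-- The residue of the product of two composed currents. -/
theorem tendsto_pair_smul (α : ℂ) (hT0 : T ≠ 0) (hT : ∀ n : ℕ, 0 < n → T ^ n ≠ 1) (hp : IsString T p)
    (hS : IsSymData T A ξ v S M) (hv : IsHomVec ρ v) (h : IsFusion T p n m n' m' a k r)
    {ι : Type*} {F : Filter ι} {x y : ι → ℂ} {z : ℂ} (hz : z ≠ 0)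
    (hx : Tendsto x F (𝓝 (T ^ (k + 1) * z))) (hy : Tendsto y F (𝓝 z))
    (hxy : ∀ᶠ i in F, x i ≠ T ^ (k + 1) * y i) :
    Tendsto (fun i => (x i - T ^ (k + 1) * y i) *
      valueAt (fun l => α * pairCoeff hV hA p n m ξ v l) ![x i, y i]) F
      (𝓝 (α * (T ^ (k + 1) * z * resCoeff T a (k + 1) * fusedVal T p S M n' m' a k r z))) := by
  have hx0 : T ^ (k + 1) * z ≠ 0 := mul_ne_zero (pow_ne_zero _ hT0) hz
  have hl : ∀ l ∈ (Finset.range (k + 1 + r)).erase k, T ^ (k + 1) * z - T ^ (l + 1) * z ≠ 0 := by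
    intro l hl
    rw [← sub_mul]
    refine mul_ne_zero (sub_ne_zero.mpr (pow_ne_pow hT0 hT fun he => ?_)) hz
    exact (Finset.mem_erase.mp hl).1 (by omega)
  have h1 := tendsto_pairReg (S := S) (M := M) (n := n) (m := m) (a := a) hp hx hy hx0 hz hl
  rw [pairReg_eq hT0 hT hS h hz] at h1
  refine (h1.const_mul α).congr' ?_
  have h2 : ∀ᶠ i in F, ∀ l ∈ (Finset.range (k + 1 + r)).erase k, x i - T ^ (l + 1) * y i ≠ 0 := by
    rw [Filter.eventually_all_finset]
    exact fun l hl' => (hx.sub (hy.const_mul _)).eventually_ne (hl l hl')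
  filter_upwards [hxy, h2, hx.eventually_ne hx0, hy.eventually_ne hz] with i h3 h4 h5 h6
  rw [((hasValueAt_pair hp hS hv h.pair h5 h6 h3 h4).smul α).valueAt_eq, mul_left_comm,
    ← mul_assoc (x i - _), mul_inv_cancel₀ (sub_ne_zero.mpr h3), one_mul]

theorem tendsto_pair (hT0 : T ≠ 0) (hT : ∀ n : ℕ, 0 < n → T ^ n ≠ 1) (hp : IsString T p)
    (hS : IsSymData T A ξ v S M) (hv : IsHomVec ρ v) (h : IsFusion T p n m n' m' a k r)
    {ι : Type*} {F : Filter ι} {x y : ι → ℂ} {z : ℂ} (hz : z ≠ 0)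
    (hx : Tendsto x F (𝓝 (T ^ (k + 1) * z))) (hy : Tendsto y F (𝓝 z))
    (hxy : ∀ᶠ i in F, x i ≠ T ^ (k + 1) * y i) :
    Tendsto (fun i => (x i - T ^ (k + 1) * y i) * valueAt (pairCoeff hV hA p n m ξ v) ![x i, y i]) F
      (𝓝 (T ^ (k + 1) * z * resCoeff T a (k + 1) * fusedVal T p S M n' m' a k r z)) := by
  simpa only [one_mul] using
    tendsto_pair_smul (hV := hV) (hA := hA) 1 hT0 hT hp hS hv h hz hx hy hxy

theorem eval_smul_of_isHomogeneous {ι : Type*} {P : MvPolynomial ι ℂ} {d : ℕ}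
    (hP : P.IsHomogeneous d) (c : ℂ) (w : ι → ℂ) :
    eval (fun i => c * w i) P = c ^ d * eval w P := by
  rw [eval_eq, eval_eq, Finset.mul_sum]
  refine Finset.sum_congr rfl fun u hu => ?_
  have := hP (mem_support_iff.mp hu)
  rw [show (1 : ι → ℕ) = fun _ => 1 from rfl, ← Finsupp.degree_eq_weight_one] at this
  simp only [mul_pow, Finset.prod_mul_distrib, Finset.prod_pow_eq_pow_sum]
  rw [← Finsupp.degree_apply, this]
  ring

/-- The grading confines the matrix coefficient to a single total degree, and multiplication by the
homogeneous `polesPoly` preserves this property. -/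
theorem isHomogeneous_pairNum (hp : IsString T p) (hS : IsSymData T A ξ v S M)
    (hξ : IsHomDual ρ ξ) (hv : IsHomVec ρ v) (hV : IsHighestDegree ρ) (hA : IsCurrent ρ T A)
    (h : IsPair T p n m a b) :
    ∃ d, (pairNum T p S M n m (zerosPoly T a b)).IsHomogeneous d := by
  have h1 : (polesPoly T b).IsHomogeneous (∑ _l ∈ Finset.range b, 1) :=
    IsHomogeneous.prod _ _ _ fun _ _ => isHomogeneous_lin _ _ _
  have h2 := (homFam_word (homFields_pair hV hA (p := p) n m)).act h1
  obtain ⟨s, hs⟩ := h2.dual hξ hv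
  have h3 := act_polesPoly (hV := hV) (hA := hA) hp hS hv h
  refine ⟨(n * M (n + m) + m * M (n + m) - s).toNat, fun u hu => ?_⟩
  set k : Fin 2 → ℤ := fun i => ((![n * M (n + m), m * M (n + m)] i : ℕ) : ℤ) - u i with hk
  have h4 : act (pairNum T p S M n m (zerosPoly T a b)) (pairDelta M n m) k ≠ 0 := by
    rw [pairDelta, act_delta _ _ _ u fun i => by rw [hk]; ring]
    exact hu
  rw [← h3] at h4
  have h5 := hs k (by
    intro h0
    apply h4
    rw [pairCoeff, matrixCoeff_eq, ← h0, act_apply_vec, ← act_map])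
  rw [Fin.sum_univ_two] at h5
  rw [show (1 : Fin 2 → ℕ) = fun _ => 1 from rfl, ← Finsupp.degree_eq_weight_one,
    Finsupp.degree_eq_sum, Fin.sum_univ_two]
  simp only [hk, Matrix.cons_val_zero, Matrix.cons_val_one] at h5
  push_cast at h5
  omega

/-- The pole is genuine exactly when its residue does not vanish. -/
theorem not_isRegularAt_iff (hT0 : T ≠ 0) (hT : ∀ n : ℕ, 0 < n → T ^ n ≠ 1) (hp : IsString T p)
    (hS : IsSymData T A ξ v S M) (hξ : IsHomDual ρ ξ) (hv : IsHomVec ρ v)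
    (h : IsFusion T p n m n' m' a k r) (ha : 1 ≤ a) {z : ℂ} (hz : z ≠ 0) :
    ¬ IsRegularAt (pairCoeff hV hA p n m ξ v) ![T ^ (k + 1) * z, z] ↔
      fusedVal T p S M n' m' a k r z ≠ 0 := by
  have hx0 : T ^ (k + 1) * z ≠ 0 := mul_ne_zero (pow_ne_zero _ hT0) hz
  have hl : ∀ l ∈ (Finset.range (k + 1 + r)).erase k, T ^ (k + 1) * z - T ^ (l + 1) * z ≠ 0 := by
    intro l hl
    rw [← sub_mul]
    refine mul_ne_zero (sub_ne_zero.mpr (pow_ne_pow hT0 hT fun he => ?_)) hz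
    exact (Finset.mem_erase.mp hl).1 (by omega)
  constructor
  · intro hreg h0
    apply hreg
    have h1 := pairReg_eq hT0 hT hS h hz
    rw [h0, mul_zero, pairReg] at h1
    set N := pairNum T p S M n m (zerosPoly T a (k + 1 + r)) with hN
    -- Vanishing of the fused value means that the numerator vanishes at one point of the line z_1 =
    -- T^(k+1) z_2.
    have h2 : eval ![T ^ (k + 1) * z, z] N = 0 := by
      have h3 := eval_pairNum (T := T) (p := p) (S := S) (M := M) (n := n) (m := m)
        (zerosPoly T a (k + 1 + r)) (T ^ (k + 1) * z) z
      have h4 : strConst T p n * strConst T p m *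
          eval ![T ^ (k + 1) * z, z] (zerosPoly T a (k + 1 + r)) *
          symVal S M (n + m) (pts p n m (T ^ (k + 1) * z) z) = 0 := by
        have h5 := Finset.prod_ne_zero_iff.mpr hl
        rw [← mul_div_assoc, div_mul_eq_mul_div, div_eq_zero_iff] at h1
        exact h1.resolve_right h5
      rw [h4] at h3
      refine (mul_eq_zero.mp h3).resolve_right (mono_ne_zero (fun i => ?_) _)
      fin_cases i <;> assumption
    obtain ⟨d, hd⟩ := isHomogeneous_pairNum hp hS hξ hv hV hA h.pair
    -- By homogeneity the numerator vanishes along the whole line, so the linear factor divides it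
    -- and can be cancelled against the pole.
    obtain ⟨N', hN'⟩ := lin_dvd (t := T ^ (k + 1)) (P := N) fun y hy => by
      have h3 := eval_smul_of_isHomogeneous hd (y / z) ![T ^ (k + 1) * z, z]
      rw [← hN, h2, mul_zero] at h3
      rw [← h3]
      congr 1
      congr 1
      ext i
      fin_cases i <;> simp <;> field_simp
    have h3 := act_polesPoly (hV := hV) (hA := hA) hp hS hv h.pair
    rw [← hN, hN', polesPoly,
      ← Finset.mul_prod_erase _ _ (Finset.mem_range.mpr (show k < k + 1 + r by omega)),
      act_mul, act_mul] at h3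
    have h4 := act_prod_lin_cancel {()} (fun _ => T ^ (k + 1))
      ((farFin_pairCoeff (hV := hV) (hA := hA) hv n m).act _) ((farFin_pairDelta M n m).act _)
      (by rw [Finset.prod_singleton]; exact h3)
    have h5 := convergesTo_of_act _ (fun _ => 0) (fun _ => 1) _ (fun _ _ => Fin.zero_lt_one)
      (fun _ _ => farFin_pairCoeff (hV := hV) (hA := hA) hv n m) _ _ h4
    refine ⟨_, _, _, h5, ?_, rfl⟩
    rw [map_mul, eval_monoPoly, map_prod]
    refine mul_ne_zero (inv_ne_zero (mono_ne_zero (fun i => ?_) _))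
      (Finset.prod_ne_zero_iff.mpr fun l hl' => ?_)
    · fin_cases i <;> assumption
    · rw [eval_lin]; exact hl l hl'
  -- If the function were regular at the point, its product with z_1 - T^(k+1) z_2 would tend to
  -- zero, whereas the limit is a nonzero multiple of the fused value.
  · rintro h0 ⟨w, P, Q, hPQ, hQ, -⟩
    have hid : Tendsto (fun x : ℂ => x) (𝓝[≠] (T ^ (k + 1) * z)) (𝓝 (T ^ (k + 1) * z)) :=
      tendsto_id.mono_left nhdsWithin_le_nhds
    have h1 := tendsto_pair (hV := hV) (hA := hA) hT0 hT hp hS hv h hz hid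
      (tendsto_const_nhds (x := z)) self_mem_nhdsWithin
    have hxy : Tendsto (fun x : ℂ => ![x, z]) (𝓝[≠] (T ^ (k + 1) * z))
        (𝓝 ![T ^ (k + 1) * z, z]) := by
      rw [tendsto_pi_nhds]
      intro j
      fin_cases j
      · exact hid
      · exact tendsto_const_nhds
    have hP' := ((MvPolynomial.continuous_eval P).tendsto _).comp hxy
    have hQ' := ((MvPolynomial.continuous_eval Q).tendsto _).comp hxy
    have h2 := (hid.sub_const (T ^ (k + 1) * z)).mul (hP'.div hQ' hQ)
    rw [sub_self, zero_mul] at h2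
    have h3 := tendsto_nhds_unique (h2.congr' ?_) h1
    · have h4 := resCoeff_ne_zero hT ha (k + 1)
      exact mul_ne_zero (mul_ne_zero hx0 h4) h0 h3.symm
    · filter_upwards [hQ'.eventually_ne hQ] with x hx
      rw [(show HasValueAt (pairCoeff hV hA p n m ξ v) ![x, z] _ from
        ⟨P, Q, hPQ, hx, rfl⟩).valueAt_eq]
      rfl

end Residue

end DrinfeldSl2

end

noncomputable section

namespace DrinfeldSl2

open MvPolynomial

/-! ### Fusion of geometric strings -/

section Fusion

variable {T : ℂ}

theorem map_pts (p : ∀ n : ℕ, Fin n → ℂ) (n m : ℕ) (x y : ℂ) :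
    Multiset.map (pts p n m x y) Finset.univ.val =
      Multiset.map (fun i => p n i * x) Finset.univ.val +
        Multiset.map (fun i => p m i * y) Finset.univ.val := by
  simp only [Fin.univ_val_map, pts, List.ofFn_fin_append, Multiset.coe_add]

theorem map_univ_val (n : ℕ) (F : ℕ → ℂ) :
    Multiset.map (fun i : Fin n => F i) Finset.univ.val = Multiset.map F (Multiset.range n) := by
  rw [Fin.univ_val_map, Multiset.range, Multiset.map_coe]
  congr 1
  exact List.ext_getElem (by simp) fun i _ _ => by simp

theorem map_univ_val_rev (n : ℕ) (F : ℕ → ℂ) :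
    Multiset.map (fun i : Fin n => F i.rev) Finset.univ.val =
      Multiset.map F (Multiset.range n) := by
  rw [← map_univ_val]
  have h : Multiset.map (Fin.rev : Fin n → Fin n) Finset.univ.val = Finset.univ.val :=
    Multiset.map_univ_val_equiv Fin.revPerm
  conv_rhs => rw [← h, Multiset.map_map]
  rfl

/-- As multisets of exponents of T, [k+1, k+1+n) + [0, k+1+r) equals [0, n+k+1) + [k+1, k+1+r): the
piece [0, k+1) passes from one interval to the other. -/
theorem isFusion_risingString (hT0 : T ≠ 0) (hT : ∀ n : ℕ, 0 < n → T ^ n ≠ 1) (n k r : ℕ) :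
    IsFusion T (risingString T) n (k + 1 + r) (n + (k + 1)) r n k r := by
  refine ⟨isPair_risingString hT0 hT _ _, isPair_risingString hT0 hT _ _, by omega, fun z => ?_⟩
  simp only [map_pts, risingString]
  rw [map_univ_val n fun i => T ^ i * (T ^ (k + 1) * z), map_univ_val _ fun i => T ^ i * z,
    map_univ_val _ fun i => T ^ i * z, map_univ_val _ fun i => T ^ i * (T ^ (k + 1) * z),
    Multiset.range_add (k + 1) r, add_comm n (k + 1), Multiset.range_add (k + 1) n, Multiset.map_add, Multiset.map_add,
    Multiset.map_map, Multiset.map_map]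
  have h : ((fun i => T ^ i * z) ∘ fun x => k + 1 + x) = fun i => T ^ i * (T ^ (k + 1) * z) := by
    ext i; simp only [Function.comp_apply, pow_add]; ring
  rw [h]
  abel

/-- Here it is the first string that is cut: its exponents 1, ..., k+1 extend the second string, and
the r lower ones remain. -/
theorem isFusion_endingString (hT0 : T ≠ 0) (hT : ∀ n : ℕ, 0 < n → T ^ n ≠ 1) (m k r : ℕ) :
    IsFusion T (endingString T) (k + 1 + r) m r (m + (k + 1)) m k r := by
  refine ⟨isPair_endingString hT0 hT _ _, isPair_endingString hT0 hT _ _, by omega, fun z => ?_⟩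
  simp only [map_pts, endingString]
  rw [map_univ_val_rev _ fun i => T⁻¹ ^ i * (T ^ (k + 1) * z),
    map_univ_val_rev _ fun i => T⁻¹ ^ i * z, map_univ_val_rev _ fun i => T⁻¹ ^ i * z,
    map_univ_val_rev _ fun i => T⁻¹ ^ i * (T ^ (k + 1) * z),
    Multiset.range_add (k + 1) r, add_comm m (k + 1), Multiset.range_add (k + 1) m, Multiset.map_add, Multiset.map_add,
    Multiset.map_map, Multiset.map_map]
  have h : ((fun i => T⁻¹ ^ i * (T ^ (k + 1) * z)) ∘ fun x => k + 1 + x) =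
      fun i => T⁻¹ ^ i * z := by
    ext i
    have : T⁻¹ ^ (k + 1) * T ^ (k + 1) = 1 := by
      rw [← mul_pow, inv_mul_cancel₀ hT0, one_pow]
    simp only [Function.comp_apply, pow_add _ (k + 1)]
    linear_combination (T⁻¹ ^ i * z) * this
  rw [h]
  abel

end Fusion

/-! ### Sets of poles and zeros -/

section Cancelled

variable {q : ℂ} {V : Type*} [AddCommGroup V] [Module ℂ V] {ρ : Uq q →ₐ[ℂ] Module.End ℂ V}
  {hV : IsHighestDegree ρ} {T : ℂ} {A : ℤ → Module.End ℂ V} {hA : IsCurrent ρ T A}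
  {p : ∀ n : ℕ, Fin n → ℂ} {ξ : Module.Dual ℂ V} {v : V}
  {S : ∀ N, MvPolynomial (Fin N) ℂ} {M : ℕ → ℕ} {n m a b : ℕ}

/-- When a ≤ b, the zeros with exponents 1, ..., b - a coincide with the first b - a poles. Removing
this common factor leaves a poles and a zeros. -/
theorem act_polesPoly_of_le (hp : IsString T p) (hS : IsSymData T A ξ v S M)
    (hv : IsHomVec ρ v) (h : IsPair T p n m a b) (hab : a ≤ b) :
    act (∏ l ∈ Finset.range a, lin 0 1 (T ^ (l + 1 + (b - a)))) (pairCoeff hV hA p n m ξ v) =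
      act (pairNum T p S M n m (∏ l ∈ Finset.range a, lin 0 1 (T ^ ((l : ℤ) + 1 - a))))
        (pairDelta M n m) := by
  obtain ⟨d, rfl⟩ := Nat.exists_eq_add_of_le hab
  have h1 := act_polesPoly (hV := hV) (hA := hA) hp hS hv h
  have e1 : polesPoly T (a + d) = polesPoly T d *
      ∏ l ∈ Finset.range a, lin 0 1 (T ^ (l + 1 + (a + d - a))) := by
    rw [polesPoly, add_comm a d, Finset.prod_range_add, polesPoly]
    congr 1
    exact Finset.prod_congr rfl fun l _ => by congr 2; omega
  have e2 : zerosPoly T a (a + d) = polesPoly T d *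
      ∏ l ∈ Finset.range a, lin 0 1 (T ^ ((l : ℤ) + 1 - a)) := by
    rw [zerosPoly, Finset.prod_range_add, polesPoly, mul_comm]
    congr 1
    refine Finset.prod_congr rfl fun l _ => ?_
    rw [← zpow_natCast]; congr 2; push_cast; ring
  rw [e1, e2, pairNum_mul, act_mul, act_mul] at h1
  exact act_prod_lin_cancel _ _ ((farFin_pairCoeff hv n m).act _)
    ((farFin_pairDelta M n m).act _) h1

end Cancelled

theorem prod_Icc_eq {R : Type*} [CommMonoid R] (F : ℤ → R) (c : ℤ) (b : ℕ) :
    ∏ j ∈ Finset.Icc (c + 1) (c + b), F j = ∏ l ∈ Finset.range b, F (l + 1 + c) := by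
  refine (Finset.prod_bij (fun (l : ℕ) _ => (l : ℤ) + 1 + c) (fun l hl => ?_) (fun l _ l' _ h => ?_)
    (fun j hj => ?_) fun _ _ => rfl).symm
  · rw [Finset.mem_Icc]; have := Finset.mem_range.mp hl; omega
  · omega
  · rw [Finset.mem_Icc] at hj
    exact ⟨(j - 1 - c).toNat, Finset.mem_range.mpr (by omega), by omega⟩

theorem prod_Icc_eq_neg {R : Type*} [CommMonoid R] (F : ℤ → R) (c : ℤ) (b : ℕ) :
    ∏ j ∈ Finset.Icc (c - b) (c - 1), F j = ∏ l ∈ Finset.range b, F (-(l + 1 - c)) := by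
  refine (Finset.prod_bij (fun (l : ℕ) _ => -((l : ℤ) + 1 - c)) (fun l hl => ?_)
    (fun l _ l' _ h => ?_) (fun j hj => ?_) fun _ _ => rfl).symm
  · rw [Finset.mem_Icc]; have := Finset.mem_range.mp hl; omega
  · omega
  · rw [Finset.mem_Icc] at hj
    exact ⟨(c - 1 - j).toNat, Finset.mem_range.mpr (by omega), by omega⟩

/-! ### Constants -/

section Constants

variable {q : ℂ}

theorem qNum_inv (q : ℂ) (n : ℕ) : qNum q⁻¹ n = qNum q n := by
  rw [qNum, qNum, inv_inv, ← neg_sub (q ^ n), ← neg_sub q, neg_div_neg_eq]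

theorem resConst_inv (q : ℂ) (n k : ℕ) : resConst q⁻¹ n k = resConst q n k := by
  simp only [resConst, qNum_inv]

theorem sub_inv_ne_zero (hq0 : q ≠ 0) (hq : ∀ n : ℕ, 0 < n → q ^ n ≠ 1) : q - q⁻¹ ≠ 0 := by
  intro h
  apply hq 2 two_pos
  rw [sub_eq_zero] at h
  rw [pow_two]
  nth_rw 2 [h]
  exact mul_inv_cancel₀ hq0

theorem sq_pow_ne_one (hq : ∀ n : ℕ, 0 < n → q ^ n ≠ 1) (n : ℕ) (hn : 0 < n) :
    (q ^ 2) ^ n ≠ 1 := by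
  rw [← pow_mul]; exact hq _ (by omega)

theorem qNum_ne_zero (hq0 : q ≠ 0) (hq : ∀ n : ℕ, 0 < n → q ^ n ≠ 1) {n : ℕ} (hn : 0 < n) :
    qNum q n ≠ 0 := by
  refine div_ne_zero (fun h => ?_) (sub_inv_ne_zero hq0 hq)
  refine sub_inv_ne_zero (pow_ne_zero n hq0) (fun l hl => ?_) (by rwa [inv_pow] at h)
  rw [← pow_mul]; exact hq _ (Nat.mul_pos hn hl)

/-- With κ = q - q⁻¹ one has (1 - q^(2j+2))(1 - q^(-2j)) = -q κ² [j][j+1]. The numerator contains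
one more such product than the denominator, which has 1 - q² = -q κ instead; the quotient of these
two is the single factor κ. -/
theorem resCoeff_sq (hq0 : q ≠ 0) (hq : ∀ n : ℕ, 0 < n → q ^ n ≠ 1) (a k : ℕ) :
    resCoeff (q ^ 2) a (k + 1) = (q - q⁻¹) * resConst q a (k + 1) := by
  have hκ := sub_inv_ne_zero hq0 hq
  have h1 : ∀ j : ℕ, (1 - (q ^ 2) ^ (j + 1)) * (1 - (q ^ 2)⁻¹ ^ j) =
      (-q * (q - q⁻¹) ^ 2) * (qNum q j * qNum q (j + 1)) := by
    intro j
    have hu : q ^ j ≠ 0 := pow_ne_zero _ hq0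
    rw [qNum, qNum, div_mul_div_comm, ← pow_two, mul_div_assoc', mul_comm _ ((q - q⁻¹) ^ 2),
      mul_assoc, mul_div_cancel_left₀ _ (pow_ne_zero 2 hκ), inv_pow, inv_pow, inv_pow,
      pow_succ (q ^ 2) j, pow_succ q j, ← pow_mul, mul_comm 2 j, pow_mul]
    field_simp
    ring
  have h2 : 1 - q ^ 2 = -q * (q - q⁻¹) := by field_simp; ring
  have h3 : -q * (q - q⁻¹) ^ 2 ≠ 0 := mul_ne_zero (neg_ne_zero.mpr hq0) (pow_ne_zero 2 hκ)
  rw [resCoeff, resConst, Finset.prod_Ico_eq_prod_range, Nat.add_sub_cancel,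
    prod_range_eq_pow_mul fun i _ => h1 (a + i), prod_range_eq_pow_mul fun i _ => h1 (i + 1), h2]
  simp only [add_comm 1]
  set X := ∏ i ∈ Finset.range (k + 1), qNum q (a + i) * qNum q (a + i + 1)
  set Y := ∏ i ∈ Finset.range k, qNum q (i + 1) * qNum q (i + 1 + 1) with hY
  have h4 : Y ≠ 0 := Finset.prod_ne_zero_iff.mpr fun i _ =>
    mul_ne_zero (qNum_ne_zero hq0 hq (Nat.succ_pos _)) (qNum_ne_zero hq0 hq (Nat.succ_pos _))
  rw [pow_succ _ k]
  clear_value X Y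
  have h5 := pow_ne_zero k h3
  rw [div_eq_iff (mul_ne_zero (mul_ne_zero (neg_ne_zero.mpr hq0) hκ) (mul_ne_zero h5 h4))]
  generalize (-q * (q - q⁻¹) ^ 2) ^ k = w at *
  rw [mul_div_assoc', div_mul_eq_mul_div, eq_div_iff h4]
  ring

end Constants

end DrinfeldSl2

end

/-! ### Opposite expansions and the delta function terms -/

noncomputable section

namespace DrinfeldSl2

open MvPolynomial

/-! ### Multiplication of distributions by power series in `z_1 / z_2` -/

section PowerSeriesAction

variable {W : Type*} [AddCommGroup W] [Module ℂ W]

set_option linter.unusedSectionVars false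

theorem vec2_eta (k : Fin 2 → ℤ) : ![k 0, k 1] = k := by
  ext i; fin_cases i <;> rfl

theorem act_X_zero (c : (Fin 2 → ℤ) → W) (i j : ℤ) : act (X 0) c ![i, j] = c ![i + 1, j] := by
  rw [act_X]; congr 1; ext x; fin_cases x <;> simp

theorem act_X_one (c : (Fin 2 → ℤ) → W) (i j : ℤ) : act (X 1) c ![i, j] = c ![i, j + 1] := by
  rw [act_X]; congr 1; ext x; fin_cases x <;> simp

/-- The coefficients vanish when the first degree is large. -/
def TopBdd (c : (Fin 2 → ℤ) → W) : Prop := ∃ m : ℤ, ∀ i j, m < i → c ![i, j] = 0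

/-- Multiplication by the power series `R(z_1 / z_2)`. -/
def psAct (R : PowerSeries ℂ) (c : (Fin 2 → ℤ) → W) (k : Fin 2 → ℤ) : W :=
  ∑ᶠ p : ℕ, PowerSeries.coeff p R • c ![k 0 + p, k 1 - p]

theorem psAct_eq (R : PowerSeries ℂ) (c : (Fin 2 → ℤ) → W) {i j : ℤ} {N : ℕ}
    (h : ∀ p : ℕ, N ≤ p → c ![i + p, j - p] = 0) :
    psAct R c ![i, j] = ∑ p ∈ Finset.range N, PowerSeries.coeff p R • c ![i + p, j - p] := by
  refine finsum_eq_sum_of_support_subset _ fun p hp => ?_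
  rw [Finset.coe_range, Set.mem_Iio]
  by_contra hlt
  refine hp ?_
  change _ • c ![i + p, j - p] = 0
  rw [h p (not_lt.mp hlt), smul_zero]

theorem TopBdd.exists_bound {c : (Fin 2 → ℤ) → W} (hc : TopBdd c) (i : ℤ) :
    ∃ N : ℕ, ∀ p : ℕ, N ≤ p → ∀ j, c ![i + p, j] = 0 := by
  obtain ⟨m, hm⟩ := hc
  exact ⟨(m - i).toNat + 1, fun p hp j => hm _ _ (by omega)⟩

theorem TopBdd.psAct {c : (Fin 2 → ℤ) → W} (hc : TopBdd c) (R : PowerSeries ℂ) :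
    TopBdd (psAct R c) := by
  obtain ⟨m, hm⟩ := hc
  refine ⟨m, fun i j hi => ?_⟩
  rw [psAct_eq R c (N := 0) fun p _ => hm _ _ (by omega), Finset.range_zero, Finset.sum_empty]

theorem TopBdd.act {c : (Fin 2 → ℤ) → W} (hc : TopBdd c) (P : MvPolynomial (Fin 2) ℂ) :
    TopBdd (act P c) := by
  obtain ⟨m, hm⟩ := hc
  refine ⟨m, fun i j hi => act_eq_zero _ _ _ fun u => ?_⟩
  rw [← vec2_eta fun _ => _]
  exact hm _ _ (by simp; omega)

theorem TopBdd.farFin {c : (Fin 2 → ℤ) → W} (hc : TopBdd c) : FarFin c 1 0 := by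
  obtain ⟨m, hm⟩ := hc
  intro k
  refine ⟨(m - k 0).toNat + 1, fun p hp => ?_⟩
  rw [← vec2_eta (k + _)]
  exact hm _ _ (by simp; omega)

theorem psAct_one {c : (Fin 2 → ℤ) → W} : psAct 1 c = c := by
  ext k
  rw [psAct, finsum_eq_single _ 0 fun p hp => by rw [PowerSeries.coeff_one, if_neg hp, zero_smul]]
  simp [vec2_eta]

/-- Multiplication by z_2 clears the denominator of a + b z_1/z_2, so linear factors pass between
the power series and the polynomial action. -/
theorem psAct_linear_mul {c : (Fin 2 → ℤ) → W} (hc : TopBdd c) (R : PowerSeries ℂ) (a b : ℂ) :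
    act (X 1) (psAct ((PowerSeries.C a + PowerSeries.C b * PowerSeries.X) * R) c) =
      act (C a * X 1 + C b * X 0) (psAct R c) := by
  ext k
  rw [← vec2_eta k]
  generalize k 0 = i
  generalize k 1 = j
  obtain ⟨N, hN⟩ := hc.exists_bound i
  rw [act_add, Pi.add_apply, act_C_mul, act_C_mul, Pi.smul_apply, Pi.smul_apply, act_X_one,
    act_X_one, act_X_zero,
    psAct_eq _ c (N := N + 1) fun p hp => hN p (by omega) _,
    psAct_eq _ c (N := N + 1) fun p hp => hN p (by omega) _,
    psAct_eq _ c (i := i + 1) (N := N) fun p hp => by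
      have := hN (p + 1) (by omega) (j - p)
      rwa [Nat.cast_succ, add_comm (p : ℤ), ← add_assoc] at this]
  rw [Finset.sum_range_succ', Finset.sum_range_succ' _ N, smul_add, Finset.smul_sum,
    Finset.smul_sum, add_right_comm, ← Finset.sum_add_distrib]
  congr 1
  · refine Finset.sum_congr rfl fun p _ => ?_
    rw [add_mul, map_add, PowerSeries.coeff_C_mul, mul_assoc, PowerSeries.coeff_C_mul, mul_comm PowerSeries.X,
      PowerSeries.coeff_succ_mul_X, add_smul, mul_smul, mul_smul]
    congr 4 <;> push_cast <;> congr 1 <;> ring_nf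
  · rw [add_mul, map_add, PowerSeries.coeff_C_mul, mul_assoc, PowerSeries.coeff_C_mul, mul_comm PowerSeries.X,
      PowerSeries.coeff_zero_mul_X, mul_zero, add_zero, mul_smul]

theorem psAct_prod_mul {α : Type*} (s : Finset α) (a b : α → ℂ) {c : (Fin 2 → ℤ) → W}
    (hc : TopBdd c) (R : PowerSeries ℂ) :
    act (X 1 ^ s.card)
        (psAct ((∏ x ∈ s, (PowerSeries.C (a x) + PowerSeries.C (b x) * PowerSeries.X)) * R) c) =
      act (∏ x ∈ s, (C (a x) * X 1 + C (b x) * X 0)) (psAct R c) := by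
  classical
  induction s using Finset.induction_on with
  | empty => simp
  | insert x s hx ih =>
    rw [Finset.card_insert_of_notMem hx, Finset.prod_insert hx, Finset.prod_insert hx, mul_assoc,
      pow_succ, act_mul, psAct_linear_mul hc, act_comm, ih, ← act_mul]

theorem map_psAct {W' : Type*} [AddCommGroup W'] [Module ℂ W'] (φ : W →ₗ[ℂ] W')
    {c : (Fin 2 → ℤ) → W} (hc : TopBdd c) (R : PowerSeries ℂ) (k : Fin 2 → ℤ) :
    φ (psAct R c k) = psAct R (fun k => φ (c k)) k := by
  rw [← vec2_eta k]
  obtain ⟨N, hN⟩ := hc.exists_bound (k 0)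
  rw [psAct_eq R c fun p hp => hN p hp _,
    psAct_eq R (fun k => φ (c k)) fun p hp => by rw [hN p hp, map_zero], map_sum]
  exact Finset.sum_congr rfl fun p _ => map_smul _ _ _

end PowerSeriesAction

/-! ### The difference of two expansions of a rational function -/

section Expansions

variable {W : Type*} [AddCommGroup W] [Module ℂ W]

/-- The difference of the two expansions of `g / (z_1 - t z_2)`. -/
theorem sub_eq_sp_of_act_lin {t : ℂ} (ht : t ≠ 0) {c c' g : (Fin 2 → ℤ) → W}
    (hc : FarFin c 0 1) (hc' : FarFin c' 1 0) (h : act (lin 0 1 t) c = g)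
    (h' : act (lin 0 1 t) c' = g) (hg : LocFin (fun _ : Fin 2 => (0 : Fin 1)) g) (i j : ℤ) :
    c ![i, j] - c' ![i, j] =
      t ^ (i - 1) • sp (fun _ => (0 : Fin 1)) ![t, 1] g fun _ => i + j - 1 := by
  set s := i + j - 1 with hs
  -- one step of the recursion
  have step : ∀ {d : (Fin 2 → ℤ) → W}, act (lin 0 1 t) d = g → ∀ l : ℤ,
      t ^ (-(l + 1)) • d ![l + 1, s + 1 - (l + 1)] =
        t ^ (-l) • d ![l, s + 1 - l] + t ^ (-(l + 1)) • g ![l, s - l] := by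
    intro d hd l
    have h1 := congrFun hd ![l, s - l]
    rw [lin, act_sub, Pi.sub_apply, act_C_mul, Pi.smul_apply, act_X_zero, act_X_one] at h1
    rw [← h1, smul_sub, smul_smul, ← zpow_add_one₀ ht, show -(l + 1) + 1 = -l by ring,
      show s + 1 - (l + 1) = s - l by ring, show s + 1 - l = s - l + 1 by ring]
    abel
  have iter : ∀ {d : (Fin 2 → ℤ) → W}, act (lin 0 1 t) d = g → ∀ (l : ℤ) (N : ℕ),
      t ^ (-(l + N)) • d ![l + N, s + 1 - (l + N)] = t ^ (-l) • d ![l, s + 1 - l] +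
        ∑ x ∈ Finset.range N, t ^ (-(l + x + 1)) • g ![l + x, s - (l + x)] := by
    intro d hd l N
    induction N with
    | zero => simp
    | succ N ih =>
      rw [Finset.sum_range_succ, ← add_assoc, ← ih, Nat.cast_succ, ← add_assoc, step hd]
  obtain ⟨N₁, hN₁⟩ := hc ![i, j]
  obtain ⟨N₂, hN₂⟩ := hc' ![i, j]
  -- On the antidiagonal through (i, j), c vanishes far to the left and c' far to the right, so the
  -- same recursion can be started from zero at opposite ends.
  have z1 : ∀ p : ℕ, N₁ ≤ p → c ![i - p, s + 1 - (i - p)] = 0 := by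
    intro p hp
    rw [← hN₁ p hp]
    congr 1; ext x; fin_cases x <;> simp [hs] <;> ring
  have z2 : ∀ p : ℕ, N₂ ≤ p → c' ![i + p, s + 1 - (i + p)] = 0 := by
    intro p hp
    rw [← hN₂ p hp]
    congr 1; ext x; fin_cases x <;> simp [hs] <;> ring
  -- the support of `g` on the antidiagonal
  have hfin := hg fun _ => s
  obtain ⟨B, hB⟩ : ∃ B : ℕ, ∀ l : ℤ, g ![l, s - l] ≠ 0 → i - B ≤ l ∧ l < i + B := by
    have h1 : {l : ℤ | g ![l, s - l] ≠ 0}.Finite := by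
      have hinj : Function.Injective fun l : ℤ => ![l, s - l] :=
        fun l l' h => by simpa using congrFun h 0
      refine (hfin.preimage hinj.injOn).subset fun l hl => ⟨?_, hl⟩
      ext x; fin_cases x; simp [push]
    obtain ⟨u, hu⟩ := h1.bddAbove
    obtain ⟨w, hw⟩ := h1.bddBelow
    refine ⟨(u - i).toNat + (i - w).toNat + 1, fun l hl => ?_⟩
    have h2 := hu hl
    have h3 := hw hl
    omega
  set L := max (max N₁ N₂) B with hL
  have hL1 : N₁ ≤ L := (le_max_left _ _).trans (le_max_left _ _)
  have hL2 : N₂ ≤ L := (le_max_right _ _).trans (le_max_left _ _)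
  have hL3 : B ≤ L := le_max_right _ _
  have e1 := iter h (i - L) L
  rw [z1 L hL1, smul_zero, zero_add, sub_add_cancel] at e1
  have e2 := iter h' i L
  rw [z2 L hL2, smul_zero] at e2
  have hsp : sp (fun _ => (0 : Fin 1)) ![t, 1] g (fun _ => s) =
      ∑ x ∈ Finset.range (L + L), t ^ (-(i - L + x)) • g ![i - L + x, s - (i - L + x)] := by
    rw [sp]
    let f : ℕ ↪ (Fin 2 → ℤ) := ⟨fun x => ![i - L + x, s - (i - L + x)], fun x x' hx => by
      have := congrFun hx 0
      simp only [Matrix.cons_val_zero] at this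
      omega⟩
    rw [finsum_eq_sum_of_support_subset (s := (Finset.range (L + L)).map f), Finset.sum_map]
    · refine Finset.sum_congr rfl fun x _ => ?_
      have hf : f x = ![i - L + x, s - (i - L + x)] := rfl
      rw [hf, if_pos (by ext y; fin_cases y; simp [push])]
      rw [mono, Fin.prod_univ_two]
      simp only [Matrix.cons_val_zero, Matrix.cons_val_one, one_zpow, mul_one]
    · intro k hk
      rw [Function.mem_support] at hk
      have hk1 : push (fun _ => (0 : Fin 1)) k = fun _ => s := by
        by_contra hne; rw [if_neg hne] at hk; exact hk rfl
      rw [if_pos hk1] at hk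
      have hk2 : k 0 + k 1 = s := by
        have := congrFun hk1 0
        simpa [push] using this
      have hk3 : k = ![k 0, s - k 0] := by
        rw [← hk2]; ext x; fin_cases x <;> simp
      have hk4 : g ![k 0, s - k 0] ≠ 0 := by
        rw [← hk3]; exact right_ne_zero_of_smul hk
      have := hB _ hk4
      rw [Finset.coe_map]
      refine ⟨(k 0 - (i - L)).toNat, ?_, ?_⟩
      · rw [Finset.coe_range, Set.mem_Iio]; omega
      · rw [hk3]
        have h5 : i - (L : ℤ) + ((k 0 - (i - L)).toNat : ℤ) = k 0 := by omega
        change ![i - (L : ℤ) + ((k 0 - (i - L)).toNat : ℤ),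
          s - (i - (L : ℤ) + ((k 0 - (i - L)).toNat : ℤ))] = _
        rw [h5]
  -- Up to powers of t, c is the sum of the terms of g to the left of i, and c' is minus the sum of
  -- those from i onwards. Their difference sums g over the whole antidiagonal, which is its
  -- specialization at z_1 = t z_2.
  have e3 : t ^ (-i) • (c ![i, j] - c' ![i, j]) =
      t ^ (-1 : ℤ) • sp (fun _ => (0 : Fin 1)) ![t, 1] g fun _ => s := by
    have hj : s + 1 - i = j := by omega
    rw [hj] at e1 e2
    rw [smul_sub, e1, hsp, Finset.sum_range_add, smul_add, Finset.smul_sum, Finset.smul_sum,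
      eq_neg_of_add_eq_zero_left e2.symm, sub_neg_eq_add]
    congr 1
    · refine Finset.sum_congr rfl fun x _ => ?_
      rw [smul_smul, ← zpow_add₀ ht]; congr 2; ring
    · refine Finset.sum_congr rfl fun x _ => ?_
      rw [smul_smul, ← zpow_add₀ ht, Nat.cast_add,
        show i - (L : ℤ) + ((L : ℤ) + (x : ℤ)) = i + x by ring]
      congr 2; ring
  have e4 := congrArg (fun w => t ^ i • w) e3
  simp only [smul_smul, ← zpow_add₀ ht, add_neg_cancel, zpow_zero, one_smul] at e4
  rw [e4, sub_eq_add_neg]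

/-- Partial fractions. -/
theorem sum_nodalWeight {b : ℕ} (hb : 1 ≤ b) {a : ℕ → ℂ}
    (ha : Set.InjOn a (Finset.range b : Set ℕ)) :
    ∑ l ∈ Finset.range b, C (∏ x ∈ (Finset.range b).erase l, (a l - a x))⁻¹ *
      ∏ x ∈ (Finset.range b).erase l, lin 0 1 (a x) = (X 1 ^ (b - 1) : MvPolynomial (Fin 2) ℂ) := by
  refine funext_set (fun _ => {0}ᶜ) (fun _ => (Set.finite_singleton (0 : ℂ)).infinite_compl)
    fun z hz => ?_
  have hz1 : z 1 ≠ 0 := hz 1 (Set.mem_univ _)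
  -- The identity is the homogenized form of the fact that the Lagrange basis polynomials at the
  -- nodes a_l add up to 1.
  have h1 := congrArg (Polynomial.eval (z 0 / z 1))
    (Lagrange.sum_basis ha ⟨0, Finset.mem_range.mpr hb⟩)
  rw [Polynomial.eval_finsetSum, Polynomial.eval_one] at h1
  simp only [map_sum, map_mul, map_prod, eval_C, eval_lin, map_pow, eval_X]
  rw [← mul_one (z 1 ^ (b - 1)), ← h1, Finset.mul_sum]
  refine Finset.sum_congr rfl fun l hl => ?_
  rw [Lagrange.basis, Polynomial.eval_prod, ← Finset.prod_inv_distrib, ← Finset.prod_mul_distrib]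
  have h2 : b - 1 = ((Finset.range b).erase l).card := by
    rw [Finset.card_erase_of_mem hl, Finset.card_range]
  rw [h2, ← Finset.prod_const, ← Finset.prod_mul_distrib]
  refine Finset.prod_congr rfl fun x hx => ?_
  rw [Lagrange.basisDivisor]
  simp only [Polynomial.eval_mul, Polynomial.eval_C, Polynomial.eval_sub, Polynomial.eval_X]
  field_simp

end Expansions

end DrinfeldSl2

end

noncomputable section

namespace DrinfeldSl2

open MvPolynomial

/-! ### Exchange relations -/

section Exchange

variable {q : ℂ} {V : Type*} [AddCommGroup V] [Module ℂ V] {ρ : Uq q →ₐ[ℂ] Module.End ℂ V}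
  {hV : IsHighestDegree ρ} {T : ℂ} {A : ℤ → Module.End ℂ V} {hA : IsCurrent ρ T A}
  {p : ∀ n : ℕ, Fin n → ℂ} {ξ : Module.Dual ℂ V} {v : V}
  {S : ∀ N, MvPolynomial (Fin N) ℂ} {M : ℕ → ℕ} {n m n' m' a b k r : ℕ}

theorem IsSymData.rename_eq (h : IsSymData T A ξ v S M) {N N' : ℕ} (hN : N = N')
    (e : Fin N ≃ Fin N') : rename e (S N) = S N' := by
  subst hN; exact h.symm N e

/-- `∏ (T p_a z_1 - p_b z_2)`. -/
def revPoly (T : ℂ) (p : ∀ n : ℕ, Fin n → ℂ) (n m : ℕ) : MvPolynomial (Fin 2) ℂ :=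
  ∏ i, ∏ j, (C T * (C (p n i) * X 0) - C (p m j) * X 1)

/-- The coefficients of the product of two composed currents in the opposite order. -/
def oppFam (hV : IsHighestDegree ρ) (hA : IsCurrent ρ T A) (p : ∀ n : ℕ, Fin n → ℂ) (n m : ℕ)
    (k : Fin 2 → ℤ) : Module.End ℂ V :=
  pairFam hV hA p m n ![k 1, k 0]

theorem prod_prod_neg {n m : ℕ} (F : Fin n → Fin m → MvPolynomial (Fin 2) ℂ) :
    ∏ i, ∏ j, -F i j = (-1) ^ (n * m) * ∏ i, ∏ j, F i j := by
  simp only [Finset.prod_neg, Finset.prod_mul_distrib, Finset.prod_const, Finset.card_univ,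
    Fintype.card_fin]
  rw [← pow_mul, mul_comm m]

theorem rename_swap_numPoly (n m : ℕ) : rename (Equiv.swap 0 1) (numPoly p m n) =
    (-1) ^ (n * m) * numPoly p n m := by
  rw [numPoly, numPoly, ← prod_prod_neg, map_prod, Finset.prod_comm]
  simp only [map_prod, map_sub, map_mul, rename_C, rename_X, Equiv.swap_apply_left,
    Equiv.swap_apply_right, neg_sub]

theorem rename_swap_denPoly (n m : ℕ) : rename (Equiv.swap 0 1) (denPoly T p m n) =
    (-1) ^ (n * m) * revPoly T p n m := by
  rw [denPoly, revPoly, ← prod_prod_neg]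
  simp only [map_prod, map_sub, map_mul, rename_C, rename_X, Equiv.swap_apply_left,
    Equiv.swap_apply_right, neg_sub]
  rw [Finset.prod_comm]

theorem delta_comp {ι κ : Type*} (e : ι ≃ κ) (u : κ → ℤ) :
    (fun l : ι → ℤ => delta u (l ∘ e.symm)) = delta (u ∘ e) := by
  ext l
  have h := Equiv.comp_symm_eq e u l
  unfold delta
  by_cases hl : l = u ∘ e
  · rw [if_pos hl, if_pos (h.mpr hl)]
  · rw [if_neg hl, if_neg (mt h.mp hl)]

theorem rename_swap_aeval (hS : IsSymData T A ξ v S M) (n m : ℕ) :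
    rename (Equiv.swap 0 1) (aeval (ptsPoly p m n) (S (m + n))) =
      aeval (ptsPoly p n m) (S (n + m)) := by
  set e : Fin (n + m) ≃ Fin (m + n) :=
    finSumFinEquiv.symm.trans ((Equiv.sumComm _ _).trans finSumFinEquiv)
  rw [← hS.rename_eq (add_comm n m) e, aeval_rename, comp_aeval_apply]
  congr 1
  congr 1
  ext1 i
  refine Fin.addCases (fun i => ?_) (fun i => ?_) i <;> simp [ptsPoly, e]

/-- Exchanging the two variables exchanges the two orders of the product and preserves the symmetric
part. The numerator and the denominator of the rational factor acquire the same sign (-1)^(nm). -/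
theorem act_denPoly_eq_dual (hp : IsString T p) (hS : IsSymData T A ξ v S M) (n m : ℕ) :
    act (denPoly T p n m) (fun k => ξ (pairFam hV hA p n m k v)) =
      act (revPoly T p n m) (fun k => ξ (oppFam hV hA p n m k v)) := by
  have h1 := act_denPoly_pairFam hV hA hp hS n m
  have h2 := act_denPoly_pairFam hV hA hp hS m n
  have h3 : act (rename (Equiv.swap 0 1) (denPoly T p m n))
      (fun k => ξ (oppFam hV hA p n m k v)) = (-1 : ℂ) ^ (n * m) •
        act (denPoly T p n m) (fun k => ξ (pairFam hV hA p n m k v)) := by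
    ext k
    have e1 : ∀ l : Fin 2 → ℤ, ![(l ∘ (Equiv.swap (0 : Fin 2) 1).symm) 1,
        (l ∘ (Equiv.swap (0 : Fin 2) 1).symm) 0] = l := by
      intro l; ext x; fin_cases x <;> simp
    rw [act_rename]
    simp only [oppFam, e1]
    have e2 : (fun x => ((![m * M (m + n), n * M (m + n)] x : ℕ) : ℤ)) =
        (fun x => ((![n * M (n + m), m * M (n + m)] x : ℕ) : ℤ)) ∘ Equiv.swap (0 : Fin 2) 1 := by
      ext x; fin_cases x <;> simp [add_comm m n]
    have e3 : mono (Sum.elim (p m) (p n)) (fun _ => (M (m + n) : ℤ)) =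
        mono (Sum.elim (p n) (p m)) fun _ => (M (n + m) : ℤ) := by
      simp only [mono, Fintype.prod_sum_type, Sum.elim_inl, Sum.elim_inr, add_comm m n]
      exact mul_comm _ _
    rw [h2, h1, e2, ← delta_comp, ← act_rename, e3, map_mul (rename (Equiv.swap (0 : Fin 2) 1)),
      map_mul (rename (Equiv.swap (0 : Fin 2) 1)), rename_swap_numPoly,
      rename_swap_aeval hS, rename_C, ← act_C_mul, map_pow, map_neg, map_one,
      mul_comm (strConst T p m)]
    exact congrArg (fun P => act P _ k) (by ring)
  rw [rename_swap_denPoly] at h3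
  have h4 : ((-1) ^ (n * m) : MvPolynomial (Fin 2) ℂ) = C ((-1) ^ (n * m)) := by
    rw [map_pow, map_neg, map_one]
  rw [h4, act_C_mul] at h3
  exact (smul_right_injective _ (pow_ne_zero _ (neg_ne_zero.mpr one_ne_zero)) h3).symm


theorem topBdd_oppFam (hV : IsHighestDegree ρ) (hA : IsCurrent ρ T A) (n m : ℕ) (v : V) :
    TopBdd fun k => oppFam hV hA p n m k v := by
  refine hom_induction hV (p := fun v => TopBdd fun k => oppFam hV hA p n m k v) (fun v hv => ?_)
    (fun v w h1 h2 => ?_) v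
  · obtain ⟨N, hN⟩ := (homField_compCur hV hA (p := p) n).eq_zero hV hv
    refine ⟨N, fun i j hi => ?_⟩
    change compCur hV hA p m j (compCur hV hA p n i v) = 0
    rw [hN i hi, map_zero]
  · obtain ⟨N, hN⟩ := h1
    obtain ⟨N', hN'⟩ := h2
    refine ⟨max N N', fun i j hi => ?_⟩
    have e1 := hN i j ((le_max_left _ _).trans_lt hi)
    have e2 := hN' i j ((le_max_right _ _).trans_lt hi)
    dsimp only at e1 e2 ⊢
    rw [map_add, e1, e2, add_zero]

/-- The expansion of `∏ (T p_a z_1 - p_b z_2) / (p_a z_1 - T p_b z_2)` in powers of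
`z_1 / z_2`. -/
def IsExchSeries (T : ℂ) (p : ∀ n : ℕ, Fin n → ℂ) (n m : ℕ) (R : PowerSeries ℂ) : Prop :=
  (∏ x : Fin n × Fin m, (PowerSeries.C (-(T * p m x.2)) +
      PowerSeries.C (p n x.1) * PowerSeries.X)) * R =
    ∏ x : Fin n × Fin m, (PowerSeries.C (-p m x.2) + PowerSeries.C (T * p n x.1) * PowerSeries.X)

theorem act_denPoly_psAct {R : PowerSeries ℂ} (hR : IsExchSeries T p n m R) {W : Type*}
    [AddCommGroup W] [Module ℂ W] {c : (Fin 2 → ℤ) → W} (hc : TopBdd c) :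
    act (denPoly T p n m) (psAct R c) = act (revPoly T p n m) c := by
  have h1 := psAct_prod_mul Finset.univ (fun x : Fin n × Fin m => -(T * p m x.2))
    (fun x => p n x.1) hc R
  have h2 := psAct_prod_mul Finset.univ (fun x : Fin n × Fin m => -p m x.2)
    (fun x => T * p n x.1) hc 1
  rw [hR] at h1
  rw [mul_one, psAct_one, h1] at h2
  have e1 : denPoly T p n m = ∏ x : Fin n × Fin m,
      (C (-(T * p m x.2)) * X 1 + C (p n x.1) * X 0) := by
    rw [denPoly, ← Finset.prod_product', Finset.univ_product_univ]
    exact Finset.prod_congr rfl fun x _ => by rw [map_neg, map_mul]; ring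
  have e2 : revPoly T p n m = ∏ x : Fin n × Fin m,
      (C (-p m x.2) * X 1 + C (T * p n x.1) * X 0) := by
    rw [revPoly, ← Finset.prod_product', Finset.univ_product_univ]
    exact Finset.prod_congr rfl fun x _ => by rw [map_neg, map_mul]; ring
  rw [e1, e2, h2]

/-- The factors are the same as in `denPoly_cancel`, but read as multiples of z_2 - t z_1, so that
they cancel on series bounded in the opposite direction. -/
theorem denPoly_cancel_swap {W : Type*} [AddCommGroup W] [Module ℂ W] (hT0 : T ≠ 0)
    (hp : IsString T p) {c : (Fin 2 → ℤ) → W} (hc : FarFin c 1 0)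
    (h : act (denPoly T p n m) c = 0) : c = 0 := by
  rw [denPoly, ← Finset.prod_product'] at h
  refine act_prod_cancel _ _ (fun x _ => ?_) h
  have h0 := hp.ne_zero n x.1
  have h1 := hp.ne_zero m x.2
  refine ⟨1, 0, p n x.1 / (T * p m x.2), -(T * p m x.2), hc, ?_,
    neg_ne_zero.mpr (mul_ne_zero hT0 h1)⟩
  have h2 : (C (T * p m x.2) * C (p n x.1 / (T * p m x.2)) : MvPolynomial (Fin 2) ℂ) =
      C (p n x.1) := by
    rw [← C_mul, mul_div_cancel₀ _ (mul_ne_zero hT0 h1)]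
  have h3 : (C (T * p m x.2) : MvPolynomial (Fin 2) ℂ) = C T * C (p m x.2) := map_mul _ _ _
  rw [lin, map_neg]
  linear_combination (-(X 0 : MvPolynomial (Fin 2) ℂ)) * h2 + (X 1 : MvPolynomial (Fin 2) ℂ) * h3

/-- Both expansions agree after multiplication by the denominator. -/
theorem act_polesPoly_psAct_dual (hT0 : T ≠ 0) (hp : IsString T p) (hS : IsSymData T A ξ v S M)
    (hv : IsHomVec ρ v) (h : IsPair T p n m a b) {R : PowerSeries ℂ}
    (hR : IsExchSeries T p n m R) :
    act (polesPoly T b) (psAct R fun k => ξ (oppFam hV hA p n m k v)) =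
      act (pairNum T p S M n m (zerosPoly T a b)) (pairDelta M n m) := by
  have hopp : TopBdd fun k => ξ (oppFam hV hA p n m k v) := by
    obtain ⟨N, hN⟩ := topBdd_oppFam (p := p) hV hA n m v
    exact ⟨N, fun i j hi => by have := hN i j hi; dsimp only at this ⊢; rw [this, map_zero]⟩
  rw [← sub_eq_zero]
  refine denPoly_cancel_swap (n := n) (m := m) hT0 hp
    (FarFin.sub ((hopp.psAct R).act _).farFin ((farFin_delta Fin.zero_ne_one.symm _).act _)) ?_
  rw [map_sub, ← act_polesPoly (hV := hV) (hA := hA) hp hS hv h, act_comm,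
    act_denPoly_psAct hR hopp, act_comm (denPoly T p n m), pairCoeff_eq,
    act_denPoly_eq_dual hp hS, sub_self]

theorem act_polesPoly_psAct (hV : IsHighestDegree ρ) (hA : IsCurrent ρ T A) (hT0 : T ≠ 0)
    (hp : IsString T p) (h : IsPair T p n m a b) {R : PowerSeries ℂ}
    (hR : IsExchSeries T p n m R) {v : V} (hv : IsHomVec ρ v) :
    act (polesPoly T b) (psAct R fun k => oppFam hV hA p n m k v) =
      act (polesPoly T b) fun k => pairFam hV hA p n m k v := by
  ext k
  refine eq_of_homDual hV fun ξ hξ => ?_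
  obtain ⟨S, M, hS⟩ := exists_symData hV hA hξ hv
  have h1 := act_polesPoly_psAct_dual (hV := hV) (hA := hA) hT0 hp hS hv h hR
  rw [← act_polesPoly (hV := hV) (hA := hA) hp hS hv h, pairCoeff_eq] at h1
  have h2 := congrFun h1 k
  rw [← act_map, ← act_map, ← h2]
  exact congrArg (fun c => act (polesPoly T b) c k)
    (funext fun l => map_psAct ξ (topBdd_oppFam hV hA n m v) R l)

/-- The second index is bounded because the right-hand current kills v. For the first index, the
expression is rewritten with the currents in the opposite order, where the current in z_1 acts
first. Boundedness allows specialization as operators, before matrix coefficients are taken. -/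
theorem ub_act_polesPoly (hV : IsHighestDegree ρ) (hA : IsCurrent ρ T A) (hT0 : T ≠ 0)
    (hp : IsString T p) (h : IsPair T p n m a b) {R : PowerSeries ℂ}
    (hR : IsExchSeries T p n m R) : UB (act (polesPoly T b) (pairFam hV hA p n m)) := by
  refine UB.of_hom hV fun v hv => ?_
  obtain ⟨N, hN⟩ := ((topBdd_oppFam (p := p) hV hA n m v).psAct R).act (polesPoly T b)
  obtain ⟨N', hN'⟩ := (homField_compCur hV hA (p := p) m).eq_zero hV hv
  refine ⟨max N N', fun k i hk => ?_⟩
  rw [act_apply_vec]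
  fin_cases i
  · rw [← act_polesPoly_psAct hV hA hT0 hp h hR hv, ← vec2_eta k]
    exact hN _ _ ((le_max_left _ _).trans_lt hk)
  · refine act_eq_zero _ _ _ fun u => ?_
    rw [pairFam, Module.End.mul_apply, hN' _ ?_, map_zero]
    have h1 := (le_max_right N N').trans_lt hk
    simp only [Fin.mk_one] at h1
    omega

end Exchange

end DrinfeldSl2

end

noncomputable section

namespace DrinfeldSl2

open MvPolynomial

/-! ### The residue fields in the exchange relations -/

section ResidueField

variable {q : ℂ} {V : Type*} [AddCommGroup V] [Module ℂ V] {ρ : Uq q →ₐ[ℂ] Module.End ℂ V}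
  {hV : IsHighestDegree ρ} {T : ℂ} {A : ℤ → Module.End ℂ V} {hA : IsCurrent ρ T A}
  {p : ∀ n : ℕ, Fin n → ℂ} {ξ : Module.Dual ℂ V} {v : V}
  {S : ∀ N, MvPolynomial (Fin N) ℂ} {M : ℕ → ℕ} {n m n' m' a b k r : ℕ}

/-- The residue at `z_1 = T ^ (k + 1) z_2` of the product of two composed currents, divided by
`z_1`. -/
def resField (T : ℂ) (b : ℕ) {G : (Fin 2 → ℤ) → Module.End ℂ V} (hG : UB G) (k : ℕ) (s : ℤ) :
    Module.End ℂ V :=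
  ((∏ x ∈ (Finset.range b).erase k, (T ^ (k + 1) - T ^ (x + 1)))⁻¹ * (T ^ (k + 1))⁻¹) •
    fuse ![T ^ (k + 1), 1] hG (s - b)

theorem dual_act_polesPoly (hp : IsString T p) (hS : IsSymData T A ξ v S M) (hv : IsHomVec ρ v)
    (h : IsPair T p n m a b) :
    (fun k => ξ (act (polesPoly T b) (pairFam hV hA p n m) k v)) =
      act (pairNum T p S M n m (zerosPoly T a b)) (pairDelta M n m) := by
  rw [← act_polesPoly (hV := hV) (hA := hA) hp hS hv h, pairCoeff_eq]
  ext k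
  rw [act_apply_vec, ← act_map]

theorem hasSum_resField (hT0 : T ≠ 0) (hT : ∀ n : ℕ, 0 < n → T ^ n ≠ 1) (hp : IsString T p)
    (hS : IsSymData T A ξ v S M) (hv : IsHomVec ρ v) (h : IsFusion T p n m n' m' a k r)
    (hG : UB (act (polesPoly T (k + 1 + r)) (pairFam hV hA p n m))) {z : ℂ} (hz : z ≠ 0) :
    HasSum (fun s : ℤ => ξ (resField T (k + 1 + r) hG k s v) * z ^ (-s))
      (resCoeff T a (k + 1) * fusedVal T p S M n' m' a k r z) := by
  set t := T ^ (k + 1) with ht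
  have ht0 : t ≠ 0 := pow_ne_zero _ hT0
  have hp0 : ∀ i, ![t, 1] i ≠ 0 := by
    intro i; fin_cases i
    · exact ht0
    · exact one_ne_zero
  have h1 := hasSum_sp hp0 (pairNum T p S M n m (zerosPoly T a (k + 1 + r)))
    (fun x => ((![n * M (n + m), m * M (n + m)] x : ℕ) : ℤ)) hz
  have hpz : (fun i => ![t, 1] i * z) = ![t * z, z] := by
    ext i; fin_cases i <;> simp
  change HasSum (fun j : ℤ => sp _ _ (act _ (pairDelta M n m)) _ * _) _ at h1
  rw [hpz, eval_pairNum, ← dual_act_polesPoly (hV := hV) (hA := hA) hp hS hv h.pair] at h1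
  have h2 := ((Equiv.subRight ((k + 1 + r : ℕ) : ℤ)).hasSum_iff.mpr h1).mul_left
    (((∏ x ∈ (Finset.range (k + 1 + r)).erase k, (t - T ^ (x + 1)))⁻¹ * t⁻¹) *
      z ^ (-((k + 1 + r : ℕ) : ℤ)))
  have h3 : (∏ l ∈ (Finset.range (k + 1 + r)).erase k, (t * z - T ^ (l + 1) * z)) =
      (∏ x ∈ (Finset.range (k + 1 + r)).erase k, (t - T ^ (x + 1))) * z ^ (k + r) := by
    have hcard : ((Finset.range (k + 1 + r)).erase k).card = k + r := by
      rw [Finset.card_erase_of_mem (Finset.mem_range.mpr (by omega)), Finset.card_range]; omega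
    rw [← hcard, ← Finset.prod_const, ← Finset.prod_mul_distrib]
    exact Finset.prod_congr rfl fun x _ => (sub_mul _ _ _).symm
  have h4 := pairReg_eq hT0 hT hS h hz
  rw [← ht, pairReg, h3] at h4
  have h5 : resCoeff T a (k + 1) * fusedVal T p S M n' m' a k r z =
      (∏ x ∈ (Finset.range (k + 1 + r)).erase k, (t - T ^ (x + 1)))⁻¹ * t⁻¹ *
        z ^ (-((k + 1 + r : ℕ) : ℤ)) * (strConst T p n * strConst T p m *
          eval ![t * z, z] (zerosPoly T a (k + 1 + r)) *
            symVal S M (n + m) (pts p n m (t * z) z)) := by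
    refine mul_left_cancel₀ (mul_ne_zero ht0 hz) ((mul_assoc _ _ _).symm.trans (h4.symm.trans ?_))
    have h6 : z ^ (-((k + 1 + r : ℕ) : ℤ)) = (z ^ (k + r))⁻¹ * z⁻¹ := by
      rw [zpow_neg, zpow_natCast, show k + 1 + r = k + r + 1 by ring, pow_succ, mul_inv]
    have h7 : t * t⁻¹ = 1 := mul_inv_cancel₀ ht0
    have h8 : z * z⁻¹ = 1 := mul_inv_cancel₀ hz
    rw [div_eq_mul_inv, mul_inv]
    set w := (∏ x ∈ (Finset.range (k + 1 + r)).erase k, (t - T ^ (x + 1)))⁻¹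
    set Z := eval ![t * z, z] (zerosPoly T a (k + 1 + r))
    set σ := symVal S M (n + m) (pts p n m (t * z) z)
    refine Eq.trans ?_ (congrArg (fun y => t * z * (w * t⁻¹ * y *
      (strConst T p n * strConst T p m * Z * σ))) h6.symm)
    linear_combination (-(strConst T p n * strConst T p m * Z * w * (z ^ (k + r))⁻¹ * σ)) *
      (h7 * (z * z⁻¹) + h8)
  rw [h5]
  refine h2.congr_fun fun s => ?_
  simp only [resField, Function.comp_apply, Equiv.subRight_apply, LinearMap.smul_apply, map_smul,
    smul_eq_mul, fuse_dual]
  rw [← ht, show -s = -((k + 1 + r : ℕ) : ℤ) + -(s - ((k + 1 + r : ℕ) : ℤ)) by ring,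
    zpow_add₀ hz]
  ring

theorem exchange_hom (hT0 : T ≠ 0) (hT : ∀ n : ℕ, 0 < n → T ^ n ≠ 1) (hp : IsString T p)
    (hv : IsHomVec ρ v) (h : IsPair T p n m a b) (hb : 1 ≤ b) {R : PowerSeries ℂ}
    (hR : IsExchSeries T p n m R) (hG : UB (act (polesPoly T b) (pairFam hV hA p n m)))
    (i j : ℤ) :
    pairFam hV hA p n m ![i, j] v = psAct R (fun k => oppFam hV hA p n m k v) ![i, j] +
      ∑ l ∈ Finset.range b, (T ^ (l + 1)) ^ i • resField T b hG l (i + j) v := by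
  refine eq_of_homDual hV fun ξ hξ => ?_
  obtain ⟨S, M, hS⟩ := exists_symData hV hA hξ hv
  rw [map_add, map_sum, map_psAct ξ (topBdd_oppFam hV hA n m v), ← sub_eq_iff_eq_add']
  set c := pairCoeff hV hA p n m ξ v with hc
  set c' := psAct R (fun k => ξ (oppFam hV hA p n m k v)) with hc'
  have hopp : TopBdd fun k => ξ (oppFam hV hA p n m k v) := by
    obtain ⟨N, hN⟩ := topBdd_oppFam (p := p) hV hA n m v
    exact ⟨N, fun i j hi => by have := hN i j hi; dsimp only at this ⊢; rw [this, map_zero]⟩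
  have h1 := act_polesPoly (hV := hV) (hA := hA) hp hS hv h
  have h2 := act_polesPoly_psAct_dual (hV := hV) (hA := hA) hT0 hp hS hv h hR
  -- The factor z_2^(b-1) is the right-hand side of the partial fraction identity; lowering the
  -- second index by b - 1 compensates for it.
  have h3 : act (X 1 ^ (b - 1)) (c - c') ![i, j - (b - 1 : ℕ)] = c ![i, j] - c' ![i, j] := by
    rw [act_X_pow, Pi.sub_apply]
    have : (![i, j - (b - 1 : ℕ)] : Fin 2 → ℤ) + Pi.single 1 ((b - 1 : ℕ) : ℤ) = ![i, j] := by
      ext x; fin_cases x <;> simp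
    rw [this]
  have h4 : c ![i, j] = ξ (pairFam hV hA p n m ![i, j] v) := by rw [hc, pairCoeff_eq]
  rw [← h4, ← h3, ← sum_nodalWeight hb (a := fun l => T ^ (l + 1)) fun x _ y _ hxy => by
      by_contra hne
      exact pow_ne_pow hT0 hT (show x + 1 ≠ y + 1 by omega) hxy,
    act_sum, Finset.sum_apply]
  refine Finset.sum_congr rfl fun l hl => ?_
  have h5 : ∀ d : (Fin 2 → ℤ) → ℂ, act (lin 0 1 (T ^ (l + 1)))
      (act (∏ x ∈ (Finset.range b).erase l, lin 0 1 (T ^ (x + 1))) d) = act (polesPoly T b) d := by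
    intro d
    rw [← act_mul, Finset.mul_prod_erase _ (fun x => lin 0 1 (T ^ (x + 1))) hl, polesPoly]
  -- Multiplied by the other linear factors, both expansions have a single pole, with the same
  -- Laurent polynomial as numerator. They differ by its value on z_1 = T^(l+1) z_2 times a delta
  -- function.
  have h6 := sub_eq_sp_of_act_lin (pow_ne_zero (l + 1) hT0)
    ((farFin_pairCoeff hv n m).act _) ((hopp.psAct R).act _).farFin ((h5 c).trans h1)
    ((h5 c').trans h2) ((locFin_delta _ _).act _) i (j - (b - 1 : ℕ))
  rw [act_C_mul, map_sub, Pi.smul_apply, Pi.sub_apply, h6, resField, LinearMap.smul_apply, map_smul,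
    map_smul, fuse_dual, dual_act_polesPoly hp hS hv h, smul_smul, smul_smul,
    show i + (j - ((b - 1 : ℕ) : ℤ)) - 1 = i + j - b by omega]
  congr 1
  rw [zpow_sub_one₀ (pow_ne_zero _ hT0)]
  ring

theorem psAct_add {W : Type*} [AddCommGroup W] [Module ℂ W] {c c' : (Fin 2 → ℤ) → W}
    (hc : TopBdd c) (hc' : TopBdd c') (R : PowerSeries ℂ) :
    psAct R (fun k => c k + c' k) = fun k => psAct R c k + psAct R c' k := by
  ext k
  rw [← vec2_eta k]
  obtain ⟨N, hN⟩ := hc.exists_bound (k 0)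
  obtain ⟨N', hN'⟩ := hc'.exists_bound (k 0)
  have e1 : ∀ x : ℕ, max N N' ≤ x → c ![k 0 + x, k 1 - x] = 0 :=
    fun x hx => hN x ((le_max_left _ _).trans hx) _
  have e2 : ∀ x : ℕ, max N N' ≤ x → c' ![k 0 + x, k 1 - x] = 0 :=
    fun x hx => hN' x ((le_max_right _ _).trans hx) _
  rw [psAct_eq R c e1, psAct_eq R c' e2, psAct_eq R _ (N := max N N')
    fun x hx => by rw [e1 x hx, e2 x hx, add_zero], ← Finset.sum_add_distrib]
  exact Finset.sum_congr rfl fun x _ => smul_add _ _ _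

theorem exists_forall_ge_eq_zero (hV : IsHighestDegree ρ) {B : ℤ → Module.End ℂ V}
    (hB : HomField ρ B) (i : ℤ) (v : V) : ∃ N : ℕ, ∀ x : ℕ, N ≤ x → B (i + x) v = 0 := by
  refine hom_induction hV (p := fun v => ∃ N : ℕ, ∀ x : ℕ, N ≤ x → B (i + x) v = 0)
    (fun v hv => ?_) (fun v w => ?_) v
  · obtain ⟨l, hl⟩ := hB.eq_zero hV hv
    exact ⟨(l - i).toNat + 1, fun x hx => hl _ (by omega)⟩
  · rintro ⟨N, hN⟩ ⟨N', hN'⟩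
    exact ⟨max N N', fun x hx => by
      rw [map_add, hN x ((le_max_left _ _).trans hx), hN' x ((le_max_right _ _).trans hx),
        add_zero]⟩

/-- The exchange relation for two composed currents. -/
theorem exchange (hT0 : T ≠ 0) (hT : ∀ n : ℕ, 0 < n → T ^ n ≠ 1) (hp : IsString T p)
    (h : IsPair T p n m a b) (hb : 1 ≤ b) {R : PowerSeries ℂ}
    (hR : IsExchSeries T p n m R) (hG : UB (act (polesPoly T b) (pairFam hV hA p n m)))
    (i j : ℤ) (v : V) :
    ∃ N : ℕ, (∀ x : ℕ, N ≤ x → compCur hV hA p n (i + x) v = 0) ∧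
      compCur hV hA p n i (compCur hV hA p m j v) =
        ∑ x ∈ Finset.range N, PowerSeries.coeff x R •
          compCur hV hA p m (j - x) (compCur hV hA p n (i + x) v) +
        ∑ l ∈ Finset.range b, (T ^ (l + 1)) ^ i • resField T b hG l (i + j) v := by
  obtain ⟨N, hN⟩ := exists_forall_ge_eq_zero hV (homField_compCur hV hA (p := p) n) i v
  refine ⟨N, hN, ?_⟩
  have h1 : ∀ v, pairFam hV hA p n m ![i, j] v =
      psAct R (fun k => oppFam hV hA p n m k v) ![i, j] +
        ∑ l ∈ Finset.range b, (T ^ (l + 1)) ^ i • resField T b hG l (i + j) v := by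
    intro v
    refine hom_induction hV (p := fun v => pairFam hV hA p n m ![i, j] v =
      psAct R (fun k => oppFam hV hA p n m k v) ![i, j] +
        ∑ l ∈ Finset.range b, (T ^ (l + 1)) ^ i • resField T b hG l (i + j) v)
      (fun v hv => exchange_hom hT0 hT hp hv h hb hR hG i j) (fun v w h1 h2 => ?_) v
    simp only [map_add, smul_add, Finset.sum_add_distrib]
    rw [h1, h2, psAct_add (topBdd_oppFam hV hA n m v) (topBdd_oppFam hV hA n m w)]
    exact add_add_add_comm _ _ _ _
  have h2 := h1 v
  rw [psAct_eq R _ (N := N) fun x hx => by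
    change compCur hV hA p m (j - x) (compCur hV hA p n (i + x) v) = 0
    rw [hN x hx, map_zero]] at h2
  exact h2

end ResidueField

end DrinfeldSl2

end

/-! ### Specialization to e(z) and f(z), with their constants -/

noncomputable section

namespace DrinfeldSl2

open MvPolynomial

/-! ### Constants of the normalized composed currents -/

section NormConstants

variable {q : ℂ}

theorem qFact_succ (q : ℂ) (n : ℕ) : qFact q (n + 1) = qFact q n * qNum q (n + 1) := by
  rw [qFact, Finset.prod_Icc_succ_top (by omega)]; rfl

theorem qFact_ne_zero (hq0 : q ≠ 0) (hq : ∀ n : ℕ, 0 < n → q ^ n ≠ 1) (n : ℕ) :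
    qFact q n ≠ 0 :=
  Finset.prod_ne_zero_iff.mpr fun _ hj => qNum_ne_zero hq0 hq (Finset.mem_Icc.mp hj).1

theorem compNorm_zero (q : ℂ) : compNorm q 0 = 1 := by simp [compNorm, qFact]

theorem resConst_eq (hq0 : q ≠ 0) (hq : ∀ n : ℕ, 0 < n → q ^ n ≠ 1) (a k : ℕ) :
    resConst q (a + 1) (k + 1) = qFact q (a + k + 1) * qFact q (a + k + 2) /
      (qFact q a * qFact q (a + 1) * (qFact q k * qFact q (k + 1))) := by
  have hF := qFact_ne_zero hq0 hq
  have h1 : ∀ k, ∏ j ∈ Finset.range k, qNum q (a + 1 + j) * qNum q (a + 1 + j + 1) =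
      qFact q (a + k) * qFact q (a + k + 1) / (qFact q a * qFact q (a + 1)) := by
    intro k
    have h2 := hF a
    have h3 := hF (a + 1)
    induction k with
    | zero => simp [h2, h3]
    | succ k ih =>
      rw [Finset.prod_range_succ, ih, ← add_assoc, qFact_succ q (a + k + 1), qFact_succ q (a + k),
        add_right_comm a 1 k]
      ring
  have h4 : ∏ j ∈ Finset.Ico 1 (k + 1), qNum q j * qNum q (j + 1) =
      qFact q k * qFact q (k + 1) := by
    induction k with
    | zero => simp [qFact, qNum, div_self (sub_inv_ne_zero hq0 hq)]
    | succ k ih =>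
      rw [Finset.prod_Ico_succ_top (by omega), ih, qFact_succ q (k + 1), qFact_succ q k]
      ring
  rw [resConst, h1, h4, div_div]
  rfl

/-- This identity explains the form of a_{m,k}: it is the residue constant corrected by the
normalizations of the four currents. For r = 0 the second fused current is trivial, with norm 1, and
a_{m,m} = 1 results. -/
theorem compNorm_mul (hq0 : q ≠ 0) (hq : ∀ n : ℕ, 0 < n → q ^ n ≠ 1) (a k r : ℕ) :
    exchConst q (k + 1 + r) (k + 1) * (compNorm q (a + 1 + (k + 1)) * compNorm q r) =
      compNorm q (a + 1) * compNorm q (k + 1 + r) *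
        ((q - q⁻¹) * resConst q (a + 1) (k + 1)) := by
  have hF := qFact_ne_zero hq0 hq
  have f1 := hF a
  have f2 := hF (a + 1)
  have f3 := hF k
  have f4 := hF (k + 1)
  rw [resConst_eq hq0 hq]
  rw [exchConst, compNorm, compNorm, compNorm, compNorm]
  generalize q - q⁻¹ = κ
  rcases r with _ | r
  · rw [if_pos (by rfl), add_zero, show qFact q 0 = 1 by simp [qFact],
      show a + 1 + (k + 1) - 1 = a + k + 1 by omega, show a + 1 + (k + 1) = a + k + 2 by omega,
      Nat.add_sub_cancel, Nat.add_sub_cancel]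
    field_simp
    ring
  · have f5 := hF r
    have f6 := hF (r + 1)
    have f7 := hF (k + 1 + r)
    rw [if_neg (by omega), qBinom, qBinom,
      show a + 1 + (k + 1) - 1 = a + k + 1 by omega, show a + 1 + (k + 1) = a + k + 2 by omega,
      show k + 1 + (r + 1) - 1 - (k + 1) = r by omega, show k + 1 + (r + 1) - 1 = k + 1 + r by omega,
      show k + 1 + r - (k + 1 - 1) = r + 1 by omega, Nat.add_sub_cancel, Nat.add_sub_cancel,
      Nat.add_sub_cancel, show k + 1 + (r + 1) = k + 1 + r + 1 by omega, qFact_succ q (k + 1 + r)]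
    field_simp
    ring

end NormConstants

/-! ### The exchange series -/

section Series

variable {q T : ℂ} {p : ∀ n : ℕ, Fin n → ℂ}

theorem isExchSeries_prod (hT0 : T ≠ 0) (hp0 : ∀ n i, p n i ≠ 0) (n m : ℕ) :
    IsExchSeries T p n m (∏ x : Fin n × Fin m,
      ((PowerSeries.C T⁻¹ - PowerSeries.C (p n x.1 / p m x.2) * PowerSeries.X) *
        (1 - PowerSeries.C (T⁻¹ * (p n x.1 / p m x.2)) * PowerSeries.X)⁻¹)) := by
  rw [IsExchSeries, ← Finset.prod_mul_distrib]
  refine Finset.prod_congr rfl fun x _ => ?_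
  have h0 := hp0 m x.2
  set w := p n x.1 / p m x.2 with hw
  obtain ⟨d, hd⟩ : ∃ d, d = -(T * p m x.2) := ⟨_, rfl⟩
  have hn : p n x.1 = -(d * (T⁻¹ * w)) := by rw [hd, hw]; field_simp
  have e1 : PowerSeries.C d + PowerSeries.C (p n x.1) * PowerSeries.X =
      PowerSeries.C d * (1 - PowerSeries.C (T⁻¹ * w) * PowerSeries.X) := by
    rw [hn, map_neg, map_mul PowerSeries.C d]; ring
  have e2 : PowerSeries.C (-p m x.2) + PowerSeries.C (T * p n x.1) * PowerSeries.X =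
      PowerSeries.C d * (PowerSeries.C T⁻¹ - PowerSeries.C w * PowerSeries.X) := by
    have h2 : -p m x.2 = d * T⁻¹ := by rw [hd]; field_simp
    have h3 : T * p n x.1 = -(d * w) := by rw [hn]; field_simp
    rw [h2, h3, map_neg, map_mul PowerSeries.C d, map_mul PowerSeries.C d]; ring
  have e3 : (1 - PowerSeries.C (T⁻¹ * w) * PowerSeries.X) *
      (1 - PowerSeries.C (T⁻¹ * w) * PowerSeries.X)⁻¹ = 1 :=
    PowerSeries.mul_inv_cancel _ (by simp)
  rw [← hd, e1, e2]
  linear_combination (PowerSeries.C d * (PowerSeries.C T⁻¹ - PowerSeries.C w * PowerSeries.X)) * e3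

theorem exchSeries_eq (q t : ℂ) (n m : ℕ) : exchSeries q t n m = ∏ x : Fin n × Fin m,
    ((PowerSeries.C t - PowerSeries.C (q ^ (2 * (((x.1 : ℕ) : ℤ) - ((x.2 : ℕ) : ℤ)))) *
      PowerSeries.X) * (1 - PowerSeries.C (t * q ^ (2 * (((x.1 : ℕ) : ℤ) - ((x.2 : ℕ) : ℤ)))) *
        PowerSeries.X)⁻¹) := by
  rw [exchSeries, Finset.prod_comm, Fintype.prod_prod_type]
  simp only [Finset.prod_range]

theorem isExchSeries_risingString (hq0 : q ≠ 0) (n m : ℕ) :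
    IsExchSeries (q ^ 2) (risingString (q ^ 2)) n m (exchSeries q (q ^ (-2 : ℤ)) n m) := by
  have hT0 : q ^ 2 ≠ 0 := pow_ne_zero 2 hq0
  have h := isExchSeries_prod (p := risingString (q ^ 2)) hT0 (fun n i => pow_ne_zero _ hT0) n m
  rw [exchSeries_eq, show q ^ (-2 : ℤ) = (q ^ 2)⁻¹ by rw [zpow_neg]; norm_cast]
  have e : ∀ x : Fin n × Fin m, risingString (q ^ 2) n x.1 / risingString (q ^ 2) m x.2 =
      q ^ (2 * (((x.1 : ℕ) : ℤ) - ((x.2 : ℕ) : ℤ))) := by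
    intro x
    rw [risingString, risingString, zpow_mul, zpow_sub₀ (zpow_ne_zero _ hq0)]
    norm_cast
  simpa only [e] using h

theorem isExchSeries_endingString (hq0 : q ≠ 0) (n m : ℕ) :
    IsExchSeries (q⁻¹ ^ 2) (endingString (q⁻¹ ^ 2)) n m (exchSeries q (q ^ (2 : ℤ)) n m) := by
  have hT0 : q⁻¹ ^ 2 ≠ 0 := pow_ne_zero 2 (inv_ne_zero hq0)
  have h := isExchSeries_prod (p := endingString (q⁻¹ ^ 2)) hT0
    (fun n i => pow_ne_zero _ (inv_ne_zero hT0)) n m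
  have hT : (q⁻¹ ^ 2)⁻¹ = q ^ (2 : ℤ) := by rw [inv_pow, inv_inv]; norm_cast
  have e : ∀ x : Fin n × Fin m, endingString (q⁻¹ ^ 2) n x.1 / endingString (q⁻¹ ^ 2) m x.2 =
      q ^ (2 * (((x.1.rev : ℕ) : ℤ) - ((x.2.rev : ℕ) : ℤ))) := by
    intro x
    rw [endingString, endingString, hT, zpow_mul, zpow_sub₀ (zpow_ne_zero _ hq0), zpow_natCast,
      zpow_natCast]
  -- The exponents in `endingString` are counted from the end; reversing both index sets matches
  -- those in `exchSeries`.
  rw [exchSeries_eq, ← Equiv.prod_comp (Fin.revPerm.prodCongr Fin.revPerm)]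
  simpa only [e, hT, Equiv.prodCongr_apply, Prod.map_fst, Prod.map_snd, Fin.revPerm_apply] using h

end Series

/-! ### The currents `e(z)` and `f(z)` -/

section Currents

variable {q : ℂ} {V : Type*} [AddCommGroup V] [Module ℂ V] (ρ : Uq q →ₐ[ℂ] Module.End ℂ V)

theorem rel_image {x y : Gen.Free} (h : Rel q x y) :
    (ρ.comp (RingQuot.mkAlgHom ℂ (Rel q))) x = (ρ.comp (RingQuot.mkAlgHom ℂ (Rel q))) y := by
  rw [AlgHom.comp_apply, AlgHom.comp_apply, RingQuot.mkAlgHom_rel ℂ h]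

theorem homField_of_comm {B : ℤ → Module.End ℂ V}
    (h : ∀ k : ℤ, ρ (Uq.gen q Gen.d) * B k - B k * ρ (Uq.gen q Gen.d) = (k : ℂ) • B k) :
    HomField ρ B := by
  intro k μ v hv
  have h1 := LinearMap.congr_fun (h k) v
  rw [degSpace, Module.End.mem_eigenspace_iff] at hv ⊢
  simp only [LinearMap.sub_apply, Module.End.mul_apply, LinearMap.smul_apply, hv, map_smul] at h1
  rw [sub_eq_iff_eq_add] at h1
  rw [h1, add_smul, add_comm]

theorem isCurrent_eCur : IsCurrent ρ (q ^ 2) (eCur ρ) := by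
  refine ⟨homField_of_comm ρ fun k => ?_, fun k l => ?_⟩
  · have h := rel_image ρ (Rel.d_e k)
    simp only [map_sub, map_mul, map_smul] at h
    exact h
  · have h := rel_image ρ (Rel.e_e k l)
    rw [show q ^ (2 : ℤ) = q ^ 2 by norm_cast] at h
    simp only [map_sub, map_mul, map_smul] at h
    exact h

theorem isCurrent_fCur : IsCurrent ρ (q⁻¹ ^ 2) (fCur ρ) := by
  refine ⟨homField_of_comm ρ fun k => ?_, fun k l => ?_⟩
  · have h := rel_image ρ (Rel.d_f k)
    simp only [map_sub, map_mul, map_smul] at h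
    exact h
  · have h := rel_image ρ (Rel.f_f k l)
    rw [show q ^ (-2 : ℤ) = q⁻¹ ^ 2 by rw [zpow_neg, inv_pow]; norm_cast] at h
    simp only [map_sub, map_mul, map_smul] at h
    exact h

end Currents

end DrinfeldSl2

end

noncomputable section

namespace DrinfeldSl2

open MvPolynomial

/-! ### Residues and exchange relations in terms of regular values -/

section Values

variable {q : ℂ} {V : Type*} [AddCommGroup V] [Module ℂ V] {ρ : Uq q →ₐ[ℂ] Module.End ℂ V}
  {hV : IsHighestDegree ρ} {T : ℂ} {A : ℤ → Module.End ℂ V} {hA : IsCurrent ρ T A}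
  {p : ∀ n : ℕ, Fin n → ℂ} {ξ : Module.Dual ℂ V} {v : V} {n m n' m' a b k r : ℕ}

theorem tendsto_residue_left (α : ℂ) (hT0 : T ≠ 0) (hT : ∀ n : ℕ, 0 < n → T ^ n ≠ 1)
    (hp : IsString T p) (hξ : IsHomDual ρ ξ) (hv : IsHomVec ρ v)
    (h : IsFusion T p n m n' m' a k r) {z : ℂ} (hz : z ≠ 0) :
    Tendsto (fun y : ℂ => (1 - T ^ (k + 1) * z / y) *
        valueAt (fun l => α * pairCoeff hV hA p n m ξ v l) ![y, z])
      (𝓝[≠] (T ^ (k + 1) * z))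
      (𝓝 (α * resCoeff T a (k + 1) *
        valueAt (pairCoeff hV hA p n' m' ξ v) ![z, T ^ (k + 1) * z])) := by
  obtain ⟨S, M, hS⟩ := exists_symData hV hA hξ hv
  have hx0 : T ^ (k + 1) * z ≠ 0 := mul_ne_zero (pow_ne_zero _ hT0) hz
  have hid : Tendsto (fun x : ℂ => x) (𝓝[≠] (T ^ (k + 1) * z)) (𝓝 (T ^ (k + 1) * z)) :=
    tendsto_id.mono_left nhdsWithin_le_nhds
  have h1 := tendsto_pair_smul (hV := hV) (hA := hA) α hT0 hT hp hS hv h hz hid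
    (tendsto_const_nhds (x := z)) self_mem_nhdsWithin
  have h2 := (hid.inv₀ hx0).mul h1
  rw [(hasValueAt_fused hT0 hT hp hS hv h.pair' hz).valueAt_eq]
  have h3 : (T ^ (k + 1) * z)⁻¹ *
      (α * (T ^ (k + 1) * z * resCoeff T a (k + 1) * fusedVal T p S M n' m' a k r z)) =
      α * resCoeff T a (k + 1) * fusedVal T p S M n' m' a k r z := by
    field_simp
  rw [h3] at h2
  refine h2.congr' ?_
  filter_upwards [hid.eventually_ne hx0] with y hy
  rw [← mul_assoc, mul_sub, inv_mul_cancel₀ hy, div_eq_inv_mul]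

theorem tendsto_residue_right (α : ℂ) (hT0 : T ≠ 0) (hT : ∀ n : ℕ, 0 < n → T ^ n ≠ 1)
    (hp : IsString T p) (hξ : IsHomDual ρ ξ) (hv : IsHomVec ρ v)
    (h : IsFusion T p n m n' m' a k r) {z : ℂ} (hz : z ≠ 0) :
    Tendsto (fun y : ℂ => (1 - z / y) *
        valueAt (fun l => α * pairCoeff hV hA p n m ξ v l) ![T ^ (k + 1) * z, y])
      (𝓝[≠] z)
      (𝓝 (-(α * resCoeff T a (k + 1)) *
        valueAt (pairCoeff hV hA p n' m' ξ v) ![z, T ^ (k + 1) * z])) := by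
  obtain ⟨S, M, hS⟩ := exists_symData hV hA hξ hv
  have hT1 : T ^ (k + 1) ≠ 0 := pow_ne_zero _ hT0
  have hid : Tendsto (fun x : ℂ => x) (𝓝[≠] z) (𝓝 z) := tendsto_id.mono_left nhdsWithin_le_nhds
  have h1 := tendsto_pair_smul (hV := hV) (hA := hA) α hT0 hT hp hS hv h hz
    (tendsto_const_nhds (x := T ^ (k + 1) * z)) hid (by
      filter_upwards [self_mem_nhdsWithin] with y hy he
      exact hy (mul_left_cancel₀ hT1 he).symm)
  -- With the first argument x = T^(k+1) z fixed, x - T^(k+1) y = -T^(k+1) y (1 - z/y); this is the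
  -- origin of the sign in the residue with respect to the second variable.
  have h2 := ((hid.const_mul (T ^ (k + 1))).inv₀ (mul_ne_zero hT1 hz)).neg.mul h1
  rw [(hasValueAt_fused hT0 hT hp hS hv h.pair' hz).valueAt_eq]
  have h3 : -(T ^ (k + 1) * z)⁻¹ *
      (α * (T ^ (k + 1) * z * resCoeff T a (k + 1) * fusedVal T p S M n' m' a k r z)) =
      -(α * resCoeff T a (k + 1)) * fusedVal T p S M n' m' a k r z := by
    field_simp
  rw [h3] at h2
  refine h2.congr' ?_
  filter_upwards [hid.eventually_ne hz] with y hy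
  rw [← mul_assoc]
  congr 1
  field_simp
  ring

theorem isRegularAt_fused (hT0 : T ≠ 0) (hT : ∀ n : ℕ, 0 < n → T ^ n ≠ 1)
    (hp : IsString T p) (hξ : IsHomDual ρ ξ) (hv : IsHomVec ρ v)
    (h : IsPair T p n' m' (a + (k + 1)) r) {z : ℂ} (hz : z ≠ 0) :
    HasValueAt (pairCoeff hV hA p n' m' ξ v) ![z, T ^ (k + 1) * z]
      (valueAt (pairCoeff hV hA p n' m' ξ v) ![z, T ^ (k + 1) * z]) := by
  obtain ⟨S, M, hS⟩ := exists_symData hV hA hξ hv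
  have h1 := hasValueAt_fused (hV := hV) (hA := hA) hT0 hT hp hS hv h hz
  rwa [h1.valueAt_eq]

/-- Regularity of the residue, the residue, and the criterion for a genuine pole. -/
theorem pair_residue (hT0 : T ≠ 0) (hT : ∀ n : ℕ, 0 < n → T ^ n ≠ 1)
    (hp : IsString T p) (hξ : IsHomDual ρ ξ) (hv : IsHomVec ρ v)
    (h : IsFusion T p n m n' m' a k r) (ha : 1 ≤ a) {z : ℂ} (hz : z ≠ 0) :
    IsRegularAt (pairCoeff hV hA p n' m' ξ v) ![z, T ^ (k + 1) * z] ∧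
    Tendsto (fun y : ℂ => (1 - T ^ (k + 1) * z / y) *
        valueAt (pairCoeff hV hA p n m ξ v) ![y, z]) (𝓝[≠] (T ^ (k + 1) * z))
      (𝓝 (resCoeff T a (k + 1) *
        valueAt (pairCoeff hV hA p n' m' ξ v) ![z, T ^ (k + 1) * z])) ∧
    (¬ IsRegularAt (pairCoeff hV hA p n m ξ v) ![T ^ (k + 1) * z, z] ↔
      valueAt (pairCoeff hV hA p n' m' ξ v) ![z, T ^ (k + 1) * z] ≠ 0) := by
  refine ⟨⟨_, isRegularAt_fused hT0 hT hp hξ hv h.pair' hz⟩, ?_, ?_⟩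
  · simpa only [one_mul] using
      tendsto_residue_left (hV := hV) (hA := hA) 1 hT0 hT hp hξ hv h hz
  · obtain ⟨S, M, hS⟩ := exists_symData hV hA hξ hv
    rw [(hasValueAt_fused hT0 hT hp hS hv h.pair' hz).valueAt_eq]
    exact not_isRegularAt_iff hT0 hT hp hS hξ hv h ha hz

/-! ### Products with the trivial composed current -/

theorem hasValueAt_delta {N : ℕ} (c : ℂ) (u : Fin N → ℤ) {z : Fin N → ℂ} (hz : ∀ i, z i ≠ 0) :
    HasValueAt (fun k => c * delta u k) z (c * mono z u) := by
  have h1 : ∀ {y : Fin N → ℂ}, (∀ i, y i ≠ 0) →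
      eval y (C c * monoPoly fun i => (-u i).toNat) / eval y (monoPoly fun i => (u i).toNat) =
        c * mono y u := by
    intro y hy
    have h2 := mono_add hy u fun i => ((-u i).toNat : ℤ)
    have h3 : (u + fun i => ((-u i).toNat : ℤ)) = fun i => ((u i).toNat : ℤ) := by
      ext i; simp only [Pi.add_apply]; omega
    have h4 := mono_ne_zero hy fun i => ((-u i).toNat : ℤ)
    rw [h3] at h2
    rw [map_mul, eval_C, eval_monoPoly, eval_monoPoly, div_inv_eq_mul, h2]
    field_simp
  refine ⟨_, _, ⟨0, fun y hy => ⟨?_, ?_⟩⟩, ?_, (h1 hz).symm⟩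
  · rw [eval_monoPoly]; exact inv_ne_zero (mono_ne_zero hy.1 _)
  · rw [h1 hy.1]
    exact ((hasSum_delta (z := y) u).mul_left c).congr_fun fun k => mul_assoc _ _ _
  · rw [eval_monoPoly]; exact inv_ne_zero (mono_ne_zero hz _)

theorem exists_forall_ne_eq_zero {B : ℤ → Module.End ℂ V} (hB : HomField ρ B)
    (hξ : IsHomDual ρ ξ) (hv : IsHomVec ρ v) : ∃ s : ℤ, ∀ j, j ≠ s → ξ (B j v) = 0 := by
  obtain ⟨s, hs⟩ := (homFam_word (A := fun _ : Fin 1 => B) fun _ => hB).dual hξ hv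
  refine ⟨s, fun j hj => ?_⟩
  by_contra h
  refine hj ?_
  have := hs (fun _ => j) (by simpa [word] using h)
  simpa using this

theorem compCur_zero (j : ℤ) : compCur hV hA p 0 j = if j = 0 then 1 else 0 := by
  ext v
  have h1 : antiProd T A 0 = fun _ => 1 := by
    ext1 k
    rw [antiProd, pairProd, show pairs 0 = ∅ from rfl, Finset.prod_empty, act_one]
    simp [word]
  have h2 : (pairProd fun i j : Fin 0 => p 0 i - T * p 0 j) = 1 := by
    rw [pairProd, show pairs 0 = ∅ from rfl, Finset.prod_empty]
  have h3 : fuse (p 0) (ub_antiProd hV hA 0) j v = if j = 0 then v else 0 := by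
    change ∑ᶠ k, _ = _
    rw [finsum_unique]
    have h4 : (push (fun _ : Fin 0 => (0 : Fin 1)) default = fun _ => j) ↔ j = 0 := by
      constructor
      · intro h; simpa [push] using (congrFun h 0).symm
      · rintro rfl; ext x; simp [push]
    simp only [h1]
    split_ifs with h5 h6 h6
    · simp [mono]
    · exact absurd (h4.mp h5) h6
    · exact absurd (h4.mpr h6) h5
    · rfl
  rw [compCur, h2, inv_one, one_smul, show (pairs 0).card = 0 from rfl, Nat.cast_zero, sub_zero, h3]
  split_ifs <;> rfl

/-- In an iterated residue the fused product has a partner of order 0, which is the identity, so its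
argument y is immaterial. By the grading the matrix coefficient is a single monomial. -/
theorem hasValueAt_single (hξ : IsHomDual ρ ξ) (hv : IsHomVec ρ v) {z y : ℂ} (hz : z ≠ 0)
    (hy : y ≠ 0) (n : ℕ) :
    ∃ w, HasValueAt (matrixCoeff ![compCur hV hA p n] ξ v) ![z] w ∧
      HasValueAt (pairCoeff hV hA p n 0 ξ v) ![z, y] w ∧
      HasValueAt (pairCoeff hV hA p 0 n ξ v) ![y, z] w := by
  obtain ⟨s, hs⟩ := exists_forall_ne_eq_zero (homField_compCur hV hA (p := p) n) hξ hv
  have h1 : matrixCoeff ![compCur hV hA p n] ξ v =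
      fun k => ξ (compCur hV hA p n s v) * delta ![s] k := by
    ext k
    have h2 : matrixCoeff ![compCur hV hA p n] ξ v k = ξ (compCur hV hA p n (k 0) v) := by
      simp [matrixCoeff]
    rw [h2, delta]
    by_cases hk : k 0 = s
    · rw [if_pos (by ext i; fin_cases i; exact hk), mul_one, hk]
    · rw [if_neg (fun h => hk (congrFun h 0)), mul_zero, hs _ hk]
  have h2 : pairCoeff hV hA p n 0 ξ v =
      fun k => ξ (compCur hV hA p n s v) * delta ![s, 0] k := by
    rw [pairCoeff_eq]
    ext k
    rw [delta, pairFam, compCur_zero]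
    by_cases hk1 : k 1 = 0
    · by_cases hk : k 0 = s
      · rw [if_pos hk1, if_pos (by ext i; fin_cases i; exacts [hk, hk1]), mul_one, hk, mul_one]
      · rw [if_pos hk1, if_neg (fun h => hk (congrFun h 0)), mul_zero, mul_one, hs _ hk]
    · rw [if_neg hk1, if_neg (fun h => hk1 (congrFun h 1)), mul_zero, mul_zero,
        LinearMap.zero_apply, map_zero]
  have h3 : pairCoeff hV hA p 0 n ξ v =
      fun k => ξ (compCur hV hA p n s v) * delta ![0, s] k := by
    rw [pairCoeff_eq]
    ext k
    rw [delta, pairFam, compCur_zero]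
    by_cases hk1 : k 0 = 0
    · by_cases hk : k 1 = s
      · rw [if_pos hk1, if_pos (by ext i; fin_cases i; exacts [hk1, hk]), mul_one, hk, one_mul]
      · rw [if_pos hk1, if_neg (fun h => hk (congrFun h 1)), mul_zero, one_mul, hs _ hk]
    · rw [if_neg hk1, if_neg (fun h => hk1 (congrFun h 0)), mul_zero, zero_mul,
        LinearMap.zero_apply, map_zero]
  refine ⟨ξ (compCur hV hA p n s v) * z ^ (-s), ?_, ?_, ?_⟩
  · rw [h1]
    convert hasValueAt_delta (ξ (compCur hV hA p n s v)) ![s] (z := ![z]) ?_ using 2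
    · simp [mono]
    · intro i; fin_cases i; exact hz
  · rw [h2]
    convert hasValueAt_delta (ξ (compCur hV hA p n s v)) ![s, 0] (z := ![z, y]) ?_ using 2
    · simp [mono]
    · intro i; fin_cases i; exacts [hz, hy]
  · rw [h3]
    convert hasValueAt_delta (ξ (compCur hV hA p n s v)) ![0, s] (z := ![y, z]) ?_ using 2
    · simp [mono]
    · intro i; fin_cases i; exacts [hy, hz]

/-! ### Normalized composed currents -/

theorem matrixCoeff_smul_one (c : ℂ) (B : ℤ → Module.End ℂ V) :
    matrixCoeff ![fun j => c • B j] ξ v = fun k => c * matrixCoeff ![B] ξ v k := by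
  ext k; simp [matrixCoeff]

theorem matrixCoeff_smul_two (c c' : ℂ) (B B' : ℤ → Module.End ℂ V) :
    matrixCoeff ![fun j => c • B j, fun j => c' • B' j] ξ v =
      fun k => c * c' * matrixCoeff ![B, B'] ξ v k := by
  ext k; simp [matrixCoeff, List.ofFn_succ, mul_assoc]; ring

/-- The matrix coefficients of the product of two normalized composed currents at
`z_2 = T ^ (k + 1) z_1`. -/
def fusedProd (hV : IsHighestDegree ρ) (hA : IsCurrent ρ T A) (p : ∀ n : ℕ, Fin n → ℂ) (N : ℕ → ℂ)
    (n' m' k : ℕ) (ξ : Module.Dual ℂ V) (v : V) (z : ℂ) : ℂ :=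
  prodValue ![fun j => N n' • compCur hV hA p n' j, fun j => N m' • compCur hV hA p m' j] ξ v
    ![z, T ^ (k + 1) * z]

theorem hasValueAt_fusedProd (hT0 : T ≠ 0) (hT : ∀ n : ℕ, 0 < n → T ^ n ≠ 1)
    (hp : IsString T p) (N : ℕ → ℂ) (hξ : IsHomDual ρ ξ) (hv : IsHomVec ρ v)
    (h : IsPair T p n' m' (a + (k + 1)) r) {z : ℂ} (hz : z ≠ 0) :
    HasValueAt (matrixCoeff ![fun j => N n' • compCur hV hA p n' j,
        fun j => N m' • compCur hV hA p m' j] ξ v) ![z, T ^ (k + 1) * z]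
      (N n' * N m' * valueAt (pairCoeff hV hA p n' m' ξ v) ![z, T ^ (k + 1) * z]) := by
  rw [matrixCoeff_smul_two]
  exact (isRegularAt_fused hT0 hT hp hξ hv h hz).smul _

theorem isFieldOf_fusedProd (hT0 : T ≠ 0) (hT : ∀ n : ℕ, 0 < n → T ^ n ≠ 1)
    (hp : IsString T p) (N : ℕ → ℂ) (h : IsFusion T p n m n' m' a k r) (ha : 1 ≤ a)
    (hG : UB (act (polesPoly T (k + 1 + r)) (pairFam hV hA p n m))) :
    IsFieldOf ρ (fusedProd hV hA p N n' m' k) fun s =>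
      (N n' * N m' * (resCoeff T a (k + 1))⁻¹) • resField T (k + 1 + r) hG k s := by
  intro ξ v hξ hv z hz
  obtain ⟨S, M, hS⟩ := exists_symData hV hA hξ hv
  have h1 := (hasSum_resField hT0 hT hp hS hv h hG hz).mul_left
    (N n' * N m' * (resCoeff T a (k + 1))⁻¹)
  have h2 : fusedProd hV hA p N n' m' k ξ v z = N n' * N m' * (resCoeff T a (k + 1))⁻¹ *
      (resCoeff T a (k + 1) * fusedVal T p S M n' m' a k r z) := by
    rw [fusedProd, prodValue, (hasValueAt_fusedProd hT0 hT hp N hξ hv h.pair' hz).valueAt_eq,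
      (hasValueAt_fused hT0 hT hp hS hv h.pair' hz).valueAt_eq, mul_assoc, mul_assoc,
      inv_mul_cancel_left₀ (resCoeff_ne_zero hT ha _), mul_assoc]
  rw [h2]
  refine h1.congr_fun fun s => ?_
  rw [LinearMap.smul_apply, map_smul, smul_eq_mul]
  ring

/-- Dividing `resField` by the nonzero `resCoeff` turns residues into regular values of fused
products; γ collects what remains after normalization by N. -/
theorem exchange_normalized (hV : IsHighestDegree ρ) (hA : IsCurrent ρ T A) (hT0 : T ≠ 0)
    (hT : ∀ n : ℕ, 0 < n → T ^ n ≠ 1) (hp : IsString T p) (N : ℕ → ℂ)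
    (h : IsPair T p n m a b) (ha : 1 ≤ a) (hb : 1 ≤ b) {R : PowerSeries ℂ}
    (hR : IsExchSeries T p n m R) (n' m' : ℕ → ℕ) (γ : ℕ → ℂ)
    (hf : ∀ l < b, ∃ r, b = l + 1 + r ∧ IsFusion T p n m (n' l) (m' l) a l r)
    (hγ : ∀ l < b, γ l * (N (n' l) * N (m' l)) = N n * N m * resCoeff T a (l + 1)) :
    (∀ l < b, (∀ ξ v, IsHomDual ρ ξ → IsHomVec ρ v → ∀ z : ℂ, z ≠ 0 →
        IsRegularAt (matrixCoeff ![fun j => N (n' l) • compCur hV hA p (n' l) j,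
          fun j => N (m' l) • compCur hV hA p (m' l) j] ξ v) ![z, T ^ (l + 1) * z]) ∧
      IsFieldOf ρ (fusedProd hV hA p N (n' l) (m' l) l)
        (fieldOf ρ (fusedProd hV hA p N (n' l) (m' l) l))) ∧
    ∀ (i j : ℤ) (v : V), ∃ K : ℕ, (∀ x : ℕ, K ≤ x → (N n • compCur hV hA p n (i + x)) v = 0) ∧
      (N n • compCur hV hA p n i) ((N m • compCur hV hA p m j) v) =
        ∑ x ∈ Finset.range K, PowerSeries.coeff x R •
          (N m • compCur hV hA p m (j - x)) ((N n • compCur hV hA p n (i + x)) v) +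
        ∑ l ∈ Finset.range b, (γ l * (T ^ (l + 1)) ^ i) •
          fieldOf ρ (fusedProd hV hA p N (n' l) (m' l) l) (i + j) v := by
  have hG := ub_act_polesPoly hV hA hT0 hp h hR
  have hF : ∀ l < b, IsFieldOf ρ (fusedProd hV hA p N (n' l) (m' l) l) fun s =>
      (N (n' l) * N (m' l) * (resCoeff T a (l + 1))⁻¹) • resField T b hG l s := by
    intro l hl
    obtain ⟨r, rfl, hr⟩ := hf l hl
    exact isFieldOf_fusedProd hT0 hT hp N hr ha hG
  refine ⟨fun l hl => ⟨fun ξ v hξ hv z hz => ?_, ?_⟩, fun i j v => ?_⟩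
  · obtain ⟨r, -, hr⟩ := hf l hl
    exact ⟨_, hasValueAt_fusedProd hT0 hT hp N hξ hv hr.pair' hz⟩
  · rw [(hF l hl).fieldOf_eq hV]; exact hF l hl
  · obtain ⟨K, hK, hex⟩ := exchange hT0 hT hp h hb hR hG i j v
    refine ⟨K, fun x hx => by rw [LinearMap.smul_apply, hK x hx, smul_zero], ?_⟩
    rw [LinearMap.smul_apply, LinearMap.smul_apply, map_smul, hex, smul_add, smul_add,
      Finset.smul_sum, Finset.smul_sum, Finset.smul_sum, Finset.smul_sum]
    congr 1
    · refine Finset.sum_congr rfl fun x _ => ?_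
      rw [LinearMap.smul_apply, LinearMap.smul_apply, map_smul, smul_smul, smul_smul, smul_smul,
        smul_smul]
      congr 1
      ring
    · refine Finset.sum_congr rfl fun l hl => ?_
      have hl' := Finset.mem_range.mp hl
      rw [(hF l hl').fieldOf_eq hV, LinearMap.smul_apply, smul_smul, smul_smul, smul_smul]
      congr 1
      have h1 := hγ l hl'
      have h2 := resCoeff_ne_zero hT ha (l + 1)
      have h3 : N n * N m = γ l * (N (n' l) * N (m' l)) * (resCoeff T a (l + 1))⁻¹ := by
        rw [h1, mul_assoc, mul_inv_cancel₀ h2, mul_one]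
      rw [h3]
      ring

end Values

end DrinfeldSl2

end

noncomputable section

namespace DrinfeldSl2

open MvPolynomial

/-! ### The composed currents of `U_q(sl_2^)` -/

section Main

variable {q : ℂ} {V : Type*} [AddCommGroup V] [Module ℂ V] {ρ : Uq q →ₐ[ℂ] Module.End ℂ V}
  {ξ : Module.Dual ℂ V} {v : V}

theorem isString_risingString {T : ℂ} (hT0 : T ≠ 0) (hT : ∀ n : ℕ, 0 < n → T ^ n ≠ 1) :
    IsString T (risingString T) :=
  isString_of_geometric hT0 hT fun n => risingString_geometric n

theorem isString_endingString {T : ℂ} (hT0 : T ≠ 0) (hT : ∀ n : ℕ, 0 < n → T ^ n ≠ 1) :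
    IsString T (endingString T) :=
  isString_of_geometric hT0 hT fun n => endingString_geometric hT0 n

theorem stringUp_eq (q : ℂ) (n : ℕ) (z : ℂ) :
    stringUp q n z = fun i => risingString (q ^ 2) n i * z := by
  ext i; rw [stringUp, risingString, pow_mul]

theorem stringDown_eq (q : ℂ) (n : ℕ) (z : ℂ) :
    stringDown q n z = fun i => endingString (q⁻¹ ^ 2) n i * z := by
  ext i; rw [stringDown, endingString, pow_mul, inv_pow q, inv_inv]

theorem composed_e (hq0 : q ≠ 0) (hq : ∀ n : ℕ, 0 < n → q ^ n ≠ 1) (hV : IsHighestDegree ρ)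
    (n : ℕ) :
    (∀ ξ v, IsHomDual ρ ξ → IsHomVec ρ v → ∀ z : ℂ, z ≠ 0 →
      IsRegularAt (matrixCoeff (fun _ : Fin n => eCur ρ) ξ v) (stringUp q n z)) ∧
    IsFieldOf ρ (eString ρ n) (compCur hV (isCurrent_eCur ρ) (risingString (q ^ 2)) n) := by
  have hp := isString_risingString (pow_ne_zero 2 hq0) (sq_pow_ne_one hq)
  refine ⟨fun ξ v hξ hv z hz => ?_, fun ξ v hξ hv z hz => ?_⟩ <;>
    obtain ⟨w, h1, h2⟩ := string_value hV (isCurrent_eCur ρ) hp n hξ hv hz <;>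
    rw [← stringUp_eq] at h1
  · exact ⟨w, h1⟩
  · rwa [eString, prodValue, h1.valueAt_eq]

theorem composed_f (hq0 : q ≠ 0) (hq : ∀ n : ℕ, 0 < n → q ^ n ≠ 1) (hV : IsHighestDegree ρ)
    (n : ℕ) :
    (∀ ξ v, IsHomDual ρ ξ → IsHomVec ρ v → ∀ z : ℂ, z ≠ 0 →
      IsRegularAt (matrixCoeff (fun _ : Fin n => fCur ρ) ξ v) (stringDown q n z)) ∧
    IsFieldOf ρ (fString ρ n) (compCur hV (isCurrent_fCur ρ) (endingString (q⁻¹ ^ 2)) n) := by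
  have hp := isString_endingString (pow_ne_zero 2 (inv_ne_zero hq0))
    (sq_pow_ne_one (inv_pow_ne_one hq))
  refine ⟨fun ξ v hξ hv z hz => ?_, fun ξ v hξ hv z hz => ?_⟩ <;>
    obtain ⟨w, h1, h2⟩ := string_value hV (isCurrent_fCur ρ) hp n hξ hv hz <;>
    rw [← stringDown_eq] at h1
  · exact ⟨w, h1⟩
  · rwa [fString, prodValue, h1.valueAt_eq]

theorem eTilde_eq (hq0 : q ≠ 0) (hq : ∀ n : ℕ, 0 < n → q ^ n ≠ 1) (hV : IsHighestDegree ρ)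
    (n : ℕ) : eTilde ρ n = compCur hV (isCurrent_eCur ρ) (risingString (q ^ 2)) n :=
  (composed_e hq0 hq hV n).2.fieldOf_eq hV

theorem fTilde_eq (hq0 : q ≠ 0) (hq : ∀ n : ℕ, 0 < n → q ^ n ≠ 1) (hV : IsHighestDegree ρ)
    (n : ℕ) : fTilde ρ n = compCur hV (isCurrent_fCur ρ) (endingString (q⁻¹ ^ 2)) n :=
  (composed_f hq0 hq hV n).2.fieldOf_eq hV

theorem eComp_eq (hq0 : q ≠ 0) (hq : ∀ n : ℕ, 0 < n → q ^ n ≠ 1) (hV : IsHighestDegree ρ)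
    (n : ℕ) : eComp ρ n = fun j =>
      compNorm q n • compCur hV (isCurrent_eCur ρ) (risingString (q ^ 2)) n j := by
  ext1 j; rw [eComp, eTilde_eq hq0 hq hV]

theorem fComp_eq (hq0 : q ≠ 0) (hq : ∀ n : ℕ, 0 < n → q ^ n ≠ 1) (hV : IsHighestDegree ρ)
    (n : ℕ) : fComp ρ n = fun j =>
      compNorm q n • compCur hV (isCurrent_fCur ρ) (endingString (q⁻¹ ^ 2)) n j := by
  ext1 j; rw [fComp, fTilde_eq hq0 hq hV]

/-! ### Iterated residues -/

theorem compNorm_succ (hq0 : q ≠ 0) (hq : ∀ n : ℕ, 0 < n → q ^ n ≠ 1) (k : ℕ) :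
    compNorm q (1 + (k + 1)) =
      compNorm q 1 * compNorm q (k + 1) * ((q - q⁻¹) * resConst q 1 (k + 1)) := by
  have h := compNorm_mul hq0 hq 0 k 0
  rwa [add_zero, exchConst, if_pos rfl, one_mul, compNorm_zero, mul_one, zero_add] at h

theorem iterated_residue_e (hq0 : q ≠ 0) (hq : ∀ n : ℕ, 0 < n → q ^ n ≠ 1)
    (hV : IsHighestDegree ρ) (hξ : IsHomDual ρ ξ) (hv : IsHomVec ρ v) (k : ℕ) {z : ℂ}
    (hz : z ≠ 0) :
    Tendsto (fun y : ℂ => (1 - q ^ (2 * (k + 1)) * z / y) *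
        prodValue ![eComp ρ 1, eComp ρ (k + 1)] ξ v ![y, z])
      (𝓝[≠] (q ^ (2 * (k + 1)) * z)) (𝓝 (prodValue ![eComp ρ (k + 1 + 1)] ξ v ![z])) := by
  have hT0 := pow_ne_zero 2 hq0
  have hT := sq_pow_ne_one hq
  obtain ⟨w, h1, h2, -⟩ := hasValueAt_single (hV := hV) (hA := isCurrent_eCur ρ)
    (p := risingString (q ^ 2)) hξ hv hz (mul_ne_zero (pow_ne_zero (k + 1) hT0) hz) (1 + (k + 1))
  have h3 := tendsto_residue_left (hV := hV) (hA := isCurrent_eCur ρ)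
    (compNorm q 1 * compNorm q (k + 1)) hT0 hT (isString_risingString hT0 hT) hξ hv
    (isFusion_risingString hT0 hT 1 k 0) hz
  rw [resCoeff_sq hq0 hq, ← compNorm_succ hq0 hq, h2.valueAt_eq] at h3
  simp only [eComp_eq hq0 hq hV, prodValue, matrixCoeff_smul_one, matrixCoeff_smul_two, pow_mul]
  rw [add_comm (k + 1) 1, (h1.smul _).valueAt_eq]
  exact h3

theorem iterated_residue_f (hq0 : q ≠ 0) (hq : ∀ n : ℕ, 0 < n → q ^ n ≠ 1)
    (hV : IsHighestDegree ρ) (hξ : IsHomDual ρ ξ) (hv : IsHomVec ρ v) (k : ℕ) {z : ℂ}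
    (hz : z ≠ 0) :
    Tendsto (fun y : ℂ => (1 - q ^ (2 * (k + 1)) * z / y) *
        prodValue ![fComp ρ (k + 1), fComp ρ 1] ξ v ![z, y])
      (𝓝[≠] (q ^ (2 * (k + 1)) * z)) (𝓝 (prodValue ![fComp ρ (k + 1 + 1)] ξ v ![z])) := by
  have hT0 := pow_ne_zero 2 (inv_ne_zero hq0)
  have hT := sq_pow_ne_one (inv_pow_ne_one hq)
  have hz' : q ^ (2 * (k + 1)) * z ≠ 0 := mul_ne_zero (pow_ne_zero _ hq0) hz
  -- The pole is approached in the second argument. With base point z' = q^(2(k+1)) z, the first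
  -- argument is T^(k+1) z' = z, as the fusion requires.
  have hzz : (q⁻¹ ^ 2) ^ (k + 1) * (q ^ (2 * (k + 1)) * z) = z := by
    rw [← pow_mul, inv_pow, inv_mul_cancel_left₀ (pow_ne_zero _ hq0)]
  obtain ⟨w, h1, -, h2⟩ := hasValueAt_single (hV := hV) (hA := isCurrent_fCur ρ)
    (p := endingString (q⁻¹ ^ 2)) hξ hv hz hz' (1 + (k + 1))
  have h3 := tendsto_residue_right (hV := hV) (hA := isCurrent_fCur ρ)
    (compNorm q (k + 1) * compNorm q 1) hT0 hT (isString_endingString hT0 hT) hξ hv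
    (isFusion_endingString hT0 hT 1 k 0) hz'
  have h4 : -(compNorm q (k + 1) * compNorm q 1 * resCoeff (q⁻¹ ^ 2) 1 (k + 1)) =
      compNorm q (1 + (k + 1)) := by
    rw [resCoeff_sq (inv_ne_zero hq0) (inv_pow_ne_one hq), compNorm_succ hq0 hq, resConst_inv,
      inv_inv]
    ring
  rw [hzz, h4, h2.valueAt_eq] at h3
  simp only [fComp_eq hq0 hq hV, prodValue, matrixCoeff_smul_one, matrixCoeff_smul_two]
  rw [add_comm (k + 1) 1, (h1.smul _).valueAt_eq]
  exact h3

/-! ### Poles, zeros and residues -/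

theorem hasPolesAndZeros_e (hq0 : q ≠ 0) (hq : ∀ n : ℕ, 0 < n → q ^ n ≠ 1)
    (hV : IsHighestDegree ρ) (hξ : IsHomDual ρ ξ) (hv : IsHomVec ρ v) (n m : ℕ) :
    HasPolesAndZeros q (matrixCoeff ![eTilde ρ n, eTilde ρ m] ξ v) (ePoles n m) (eZeros n m) := by
  have hT0 := pow_ne_zero 2 hq0
  have hT := sq_pow_ne_one hq
  have hp := isString_risingString hT0 hT
  have hT' : ∀ j : ℤ, q ^ (2 * j) = (q ^ 2) ^ j := fun j => by
    rw [zpow_mul]; norm_cast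
  obtain ⟨S, M, hS⟩ := exists_symData hV (isCurrent_eCur ρ) hξ hv
  rw [eTilde_eq hq0 hq hV, eTilde_eq hq0 hq hV]
  refine hasPolesAndZeros_of_act (T := q ^ 2) (p := risingString (q ^ 2)) (S := S) (M := M)
    (n := n) (m := m) (farFin_pairCoeff hv n m) ?_
  simp only [hT', ePoles, eZeros]
  rcases le_or_gt m n with h | h
  -- For e one has a = n and b = m, so the factor is used uncancelled when m ≤ n and in the form of
  -- `act_polesPoly_of_le` otherwise.
  · rw [if_pos h, if_pos h]
    convert act_polesPoly (hV := hV) (hA := isCurrent_eCur ρ) hp hS hv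
      (isPair_risingString hT0 hT n m) using 3
    · rw [polesPoly]
      convert prod_Icc_eq (fun j => lin (0 : Fin 2) 1 ((q ^ 2) ^ j)) 0 m using 2
      · simp
      · norm_cast
    · rw [zerosPoly]
      congr 1
      convert prod_Icc_eq (fun j => lin (0 : Fin 2) 1 ((q ^ 2) ^ j)) (-n) m using 2
      rw [sub_eq_add_neg]
  · rw [if_neg h.not_ge, if_neg h.not_ge]
    convert act_polesPoly_of_le (hV := hV) (hA := isCurrent_eCur ρ) hp hS hv
      (isPair_risingString hT0 hT n m) h.le using 3
    · convert prod_Icc_eq (fun j => lin (0 : Fin 2) 1 ((q ^ 2) ^ j)) (m - n) n using 2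
      · simp
      · rw [← zpow_natCast]; push_cast [h.le]; rfl
    · congr 1
      convert prod_Icc_eq (fun j => lin (0 : Fin 2) 1 ((q ^ 2) ^ j)) (-n) n using 2
      · simp
      · rw [sub_eq_add_neg]

/-- Since T = q⁻², the exponents change sign relative to powers of q²; since (a, b) = (m, n), the
cancelled form of the factor now belongs to the case m ≤ n. -/
theorem hasPolesAndZeros_f (hq0 : q ≠ 0) (hq : ∀ n : ℕ, 0 < n → q ^ n ≠ 1)
    (hV : IsHighestDegree ρ) (hξ : IsHomDual ρ ξ) (hv : IsHomVec ρ v) (n m : ℕ) :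
    HasPolesAndZeros q (matrixCoeff ![fTilde ρ n, fTilde ρ m] ξ v) (fPoles n m) (fZeros n m) := by
  have hT0 := pow_ne_zero 2 (inv_ne_zero hq0)
  have hT := sq_pow_ne_one (inv_pow_ne_one hq)
  have hp := isString_endingString hT0 hT
  have hT' : ∀ j : ℤ, q ^ (2 * j) = (q⁻¹ ^ 2) ^ (-j) := fun j => by
    rw [zpow_mul, inv_pow, inv_zpow', neg_neg]; norm_cast
  obtain ⟨S, M, hS⟩ := exists_symData hV (isCurrent_fCur ρ) hξ hv
  rw [fTilde_eq hq0 hq hV, fTilde_eq hq0 hq hV]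
  refine hasPolesAndZeros_of_act (T := q⁻¹ ^ 2) (p := endingString (q⁻¹ ^ 2)) (S := S) (M := M)
    (n := n) (m := m) (farFin_pairCoeff hv n m) ?_
  simp only [hT', fPoles, fZeros]
  rcases le_or_gt m n with h | h
  · rw [if_pos h, if_pos h]
    convert act_polesPoly_of_le (hV := hV) (hA := isCurrent_fCur ρ) hp hS hv
      (isPair_endingString hT0 hT n m) h using 3
    · convert prod_Icc_eq_neg (fun j => lin (0 : Fin 2) 1 ((q⁻¹ ^ 2) ^ (-j))) (m - n) m using 2
      · rw [sub_sub_cancel_left]; congr 1; ring_nf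
      · rw [← zpow_natCast]; push_cast [h]; congr 1; ring_nf
    · congr 1
      convert prod_Icc_eq_neg (fun j => lin (0 : Fin 2) 1 ((q⁻¹ ^ 2) ^ (-j))) m m using 2
      · simp
      · simp
  · rw [if_neg h.not_ge, if_neg h.not_ge]
    convert act_polesPoly (hV := hV) (hA := isCurrent_fCur ρ) hp hS hv
      (isPair_endingString hT0 hT n m) using 3
    · rw [polesPoly]
      convert prod_Icc_eq_neg (fun j => lin (0 : Fin 2) 1 ((q⁻¹ ^ 2) ^ (-j))) 0 n using 2
      · simp
      · rw [← zpow_natCast]; push_cast; congr 1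
    · rw [zerosPoly]
      congr 1
      convert prod_Icc_eq_neg (fun j => lin (0 : Fin 2) 1 ((q⁻¹ ^ 2) ^ (-j))) m n using 2
      simp

theorem inv_sq_pow (q : ℂ) (k : ℕ) : (q⁻¹ ^ 2) ^ k = (q ^ (2 * k))⁻¹ := by
  rw [← pow_mul, inv_pow]

theorem residues_e (hq0 : q ≠ 0) (hq : ∀ n : ℕ, 0 < n → q ^ n ≠ 1) (hV : IsHighestDegree ρ)
    (hξ : IsHomDual ρ ξ) (hv : IsHomVec ρ v) {n m k : ℕ} (hn : 1 ≤ n) (hk : 1 ≤ k) (hkm : k ≤ m)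
    {z : ℂ} (hz : z ≠ 0) :
    IsRegularAt (matrixCoeff ![eTilde ρ (n + k), eTilde ρ (m - k)] ξ v) ![z, q ^ (2 * k) * z] ∧
    Tendsto (fun y : ℂ =>
        (1 - q ^ (2 * k) * z / y) * prodValue ![eTilde ρ n, eTilde ρ m] ξ v ![y, z])
      (𝓝[≠] (q ^ (2 * k) * z))
      (𝓝 ((q - q⁻¹) * resConst q n k *
        prodValue ![eTilde ρ (n + k), eTilde ρ (m - k)] ξ v ![z, q ^ (2 * k) * z])) ∧
    (¬ IsRegularAt (matrixCoeff ![eTilde ρ n, eTilde ρ m] ξ v) ![q ^ (2 * k) * z, z] ↔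
      prodValue ![eTilde ρ (n + k), eTilde ρ (m - k)] ξ v ![z, q ^ (2 * k) * z] ≠ 0) := by
  have hT0 := pow_ne_zero 2 hq0
  have hT := sq_pow_ne_one hq
  obtain ⟨k, rfl⟩ := Nat.exists_eq_add_of_le' hk
  obtain ⟨r, rfl⟩ := Nat.exists_eq_add_of_le hkm
  rw [Nat.add_sub_cancel_left]
  simp only [eTilde_eq hq0 hq hV, pow_mul, prodValue]
  rw [← resCoeff_sq hq0 hq]
  exact pair_residue hT0 hT (isString_risingString hT0 hT) hξ hv
    (isFusion_risingString hT0 hT n k r) hn hz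

theorem residues_f (hq0 : q ≠ 0) (hq : ∀ n : ℕ, 0 < n → q ^ n ≠ 1) (hV : IsHighestDegree ρ)
    (hξ : IsHomDual ρ ξ) (hv : IsHomVec ρ v) {n m k : ℕ} (hm : 1 ≤ m) (hk : 1 ≤ k) (hkn : k ≤ n)
    {z : ℂ} (hz : z ≠ 0) :
    IsRegularAt (matrixCoeff ![fTilde ρ (n - k), fTilde ρ (m + k)] ξ v)
      ![z, (q ^ (2 * k))⁻¹ * z] ∧
    Tendsto (fun y : ℂ =>
        (1 - (q ^ (2 * k))⁻¹ * z / y) * prodValue ![fTilde ρ n, fTilde ρ m] ξ v ![y, z])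
      (𝓝[≠] ((q ^ (2 * k))⁻¹ * z))
      (𝓝 ((q⁻¹ - q) * resConst q m k *
        prodValue ![fTilde ρ (n - k), fTilde ρ (m + k)] ξ v ![z, (q ^ (2 * k))⁻¹ * z])) ∧
    (¬ IsRegularAt (matrixCoeff ![fTilde ρ n, fTilde ρ m] ξ v) ![(q ^ (2 * k))⁻¹ * z, z] ↔
      prodValue ![fTilde ρ (n - k), fTilde ρ (m + k)] ξ v ![z, (q ^ (2 * k))⁻¹ * z] ≠ 0) := by
  have hT0 := pow_ne_zero 2 (inv_ne_zero hq0)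
  have hT := sq_pow_ne_one (inv_pow_ne_one hq)
  obtain ⟨k, rfl⟩ := Nat.exists_eq_add_of_le' hk
  obtain ⟨r, rfl⟩ := Nat.exists_eq_add_of_le hkn
  -- The q-numbers are invariant under q ↦ q⁻¹, so passing from e to f changes only the sign of the
  -- prefactor.
  have h1 : (q⁻¹ - q) * resConst q m (k + 1) = resCoeff (q⁻¹ ^ 2) m (k + 1) := by
    rw [resCoeff_sq (inv_ne_zero hq0) (inv_pow_ne_one hq), resConst_inv, inv_inv]
  rw [Nat.add_sub_cancel_left]
  simp only [fTilde_eq hq0 hq hV, ← inv_sq_pow, prodValue]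
  rw [h1]
  exact pair_residue hT0 hT (isString_endingString hT0 hT) hξ hv
    (isFusion_endingString hT0 hT m k r) hm hz

/-! ### Exchange relations -/

theorem eResidue_eq (hq0 : q ≠ 0) (hq : ∀ n : ℕ, 0 < n → q ^ n ≠ 1) (hV : IsHighestDegree ρ)
    (n m l : ℕ) : eResidue ρ n m (l + 1) = fusedProd hV (isCurrent_eCur ρ) (risingString (q ^ 2))
      (compNorm q) (n + (l + 1)) (m - (l + 1)) l := by
  ext ξ v z
  rw [eResidue, fusedProd, eComp_eq hq0 hq hV, eComp_eq hq0 hq hV, pow_mul]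

theorem fResidue_eq (hq0 : q ≠ 0) (hq : ∀ n : ℕ, 0 < n → q ^ n ≠ 1) (hV : IsHighestDegree ρ)
    (n m l : ℕ) : fResidue ρ n m (l + 1) = fusedProd hV (isCurrent_fCur ρ)
      (endingString (q⁻¹ ^ 2)) (compNorm q) (n - (l + 1)) (m + (l + 1)) l := by
  ext ξ v z
  rw [fResidue, fusedProd, fComp_eq hq0 hq hV, fComp_eq hq0 hq hV, inv_sq_pow]

theorem sum_Icc_one {M : Type*} [AddCommMonoid M] (f : ℕ → M) (m : ℕ) :
    ∑ k ∈ Finset.Icc 1 m, f k = ∑ l ∈ Finset.range m, f (l + 1) := by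
  rw [Finset.range_eq_Ico, Finset.sum_Ico_add' f 0 m 1]
  rfl

theorem exchange_e (hq0 : q ≠ 0) (hq : ∀ n : ℕ, 0 < n → q ^ n ≠ 1) (hV : IsHighestDegree ρ)
    {n m : ℕ} (hn : 1 ≤ n) (hm : 1 ≤ m) :
    (∀ k : ℕ, 1 ≤ k → k ≤ m →
      (∀ ξ v, IsHomDual ρ ξ → IsHomVec ρ v → ∀ z : ℂ, z ≠ 0 →
        IsRegularAt (matrixCoeff ![eComp ρ (n + k), eComp ρ (m - k)] ξ v)
          ![z, q ^ (2 * k) * z]) ∧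
      IsFieldOf ρ (eResidue ρ n m k) (fieldOf ρ (eResidue ρ n m k))) ∧
    ∀ (i j : ℤ) (v : V),
      ∃ N : ℕ, (∀ p : ℕ, N ≤ p → eComp ρ n (i + p) v = 0) ∧
        eComp ρ n i (eComp ρ m j v) =
          ∑ p ∈ Finset.range N, PowerSeries.coeff p (exchSeries q (q ^ (-2 : ℤ)) n m) •
            eComp ρ m (j - p) (eComp ρ n (i + p) v) +
          ∑ k ∈ Finset.Icc 1 m, (exchConst q m k * q ^ (2 * (k : ℤ) * i)) •
            fieldOf ρ (eResidue ρ n m k) (i + j) v := by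
  have hT0 := pow_ne_zero 2 hq0
  have hT := sq_pow_ne_one hq
  have h := exchange_normalized hV (isCurrent_eCur ρ) hT0 hT (isString_risingString hT0 hT)
    (compNorm q) (isPair_risingString hT0 hT n m) hn hm (isExchSeries_risingString hq0 n m)
    (fun l => n + (l + 1)) (fun l => m - (l + 1)) (fun l => exchConst q m (l + 1))
    (fun l hl => by
      obtain ⟨r, rfl⟩ := Nat.exists_eq_add_of_le (show l + 1 ≤ _ from hl)
      refine ⟨r, rfl, ?_⟩
      rw [Nat.add_sub_cancel_left]
      exact isFusion_risingString hT0 hT n l r)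
    (fun l hl => by
      obtain ⟨r, rfl⟩ := Nat.exists_eq_add_of_le (show l + 1 ≤ _ from hl)
      obtain ⟨a, rfl⟩ := Nat.exists_eq_add_of_le' hn
      rw [Nat.add_sub_cancel_left, resCoeff_sq hq0 hq]
      exact compNorm_mul hq0 hq a l r)
  refine ⟨fun k hk hkm => ?_, fun i j v => ?_⟩
  · obtain ⟨k, rfl⟩ := Nat.exists_eq_add_of_le' hk
    rw [eResidue_eq hq0 hq hV]
    simp only [eComp_eq hq0 hq hV, pow_mul]
    exact h.1 k hkm
  · have hpow : ∀ l : ℕ, q ^ (2 * ((l + 1 : ℕ) : ℤ) * i) = ((q ^ 2) ^ (l + 1)) ^ i := fun l => by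
      rw [zpow_mul, zpow_mul]; norm_cast
    simp only [sum_Icc_one, eResidue_eq hq0 hq hV, eComp_eq hq0 hq hV, hpow]
    exact h.2 i j v

theorem exchange_f (hq0 : q ≠ 0) (hq : ∀ n : ℕ, 0 < n → q ^ n ≠ 1) (hV : IsHighestDegree ρ)
    {n m : ℕ} (hn : 1 ≤ n) (hm : 1 ≤ m) :
    (∀ k : ℕ, 1 ≤ k → k ≤ n →
      (∀ ξ v, IsHomDual ρ ξ → IsHomVec ρ v → ∀ z : ℂ, z ≠ 0 →
        IsRegularAt (matrixCoeff ![fComp ρ (n - k), fComp ρ (m + k)] ξ v)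
          ![z, (q ^ (2 * k))⁻¹ * z]) ∧
      IsFieldOf ρ (fResidue ρ n m k) (fieldOf ρ (fResidue ρ n m k))) ∧
    ∀ (i j : ℤ) (v : V),
      ∃ N : ℕ, (∀ p : ℕ, N ≤ p → fComp ρ n (i + p) v = 0) ∧
        fComp ρ n i (fComp ρ m j v) =
          ∑ p ∈ Finset.range N, PowerSeries.coeff p (exchSeries q (q ^ (2 : ℤ)) n m) •
            fComp ρ m (j - p) (fComp ρ n (i + p) v) -
          ∑ k ∈ Finset.Icc 1 n, (exchConst q n k * q ^ (-(2 * (k : ℤ) * i))) •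
            fieldOf ρ (fResidue ρ n m k) (i + j) v := by
  have hT0 := pow_ne_zero 2 (inv_ne_zero hq0)
  have hT := sq_pow_ne_one (inv_pow_ne_one hq)
  have h := exchange_normalized hV (isCurrent_fCur ρ) hT0 hT (isString_endingString hT0 hT)
    (compNorm q) (isPair_endingString hT0 hT n m) hm hn (isExchSeries_endingString hq0 n m)
    (fun l => n - (l + 1)) (fun l => m + (l + 1)) (fun l => -exchConst q n (l + 1))
    (fun l hl => by
      obtain ⟨r, rfl⟩ := Nat.exists_eq_add_of_le (show l + 1 ≤ _ from hl)
      refine ⟨r, rfl, ?_⟩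
      rw [Nat.add_sub_cancel_left]
      exact isFusion_endingString hT0 hT m l r)
    (fun l hl => by
      obtain ⟨r, rfl⟩ := Nat.exists_eq_add_of_le (show l + 1 ≤ _ from hl)
      obtain ⟨a, rfl⟩ := Nat.exists_eq_add_of_le' hm
      rw [Nat.add_sub_cancel_left,
        resCoeff_sq (inv_ne_zero hq0) (inv_pow_ne_one hq), resConst_inv, inv_inv]
      linear_combination -compNorm_mul hq0 hq a l r)
  refine ⟨fun k hk hkn => ?_, fun i j v => ?_⟩
  · obtain ⟨k, rfl⟩ := Nat.exists_eq_add_of_le' hk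
    rw [fResidue_eq hq0 hq hV]
    simp only [fComp_eq hq0 hq hV, ← inv_sq_pow]
    exact h.1 k hkn
  · have hpow : ∀ l : ℕ, q ^ (-(2 * ((l + 1 : ℕ) : ℤ) * i)) = ((q⁻¹ ^ 2) ^ (l + 1)) ^ i :=
      fun l => by
        rw [inv_sq_pow, inv_zpow', zpow_neg, zpow_mul, zpow_neg]; norm_cast
    obtain ⟨N, h1, h2⟩ := h.2 i j v
    simp only [sum_Icc_one, fResidue_eq hq0 hq hV, fComp_eq hq0 hq hV, hpow]
    refine ⟨N, h1, h2.trans ?_⟩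
    rw [sub_eq_add_neg, ← Finset.sum_neg_distrib]
    simp only [neg_mul, neg_smul]

end Main

end DrinfeldSl2

end

open DrinfeldSl2 in
theorem mainTheorem6 (q : ℂ) (hq0 : q ≠ 0) (hq : ∀ n : ℕ, 0 < n → q ^ n ≠ 1)
    {V : Type*} [AddCommGroup V] [Module ℂ V] (ρ : Uq q →ₐ[ℂ] Module.End ℂ V)
    (hV : IsHighestDegree ρ) :
    -- the composed currents are well defined
    (∀ n : ℕ,
      (∀ ξ v, IsHomDual ρ ξ → IsHomVec ρ v → ∀ z : ℂ, z ≠ 0 →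
        IsRegularAt (matrixCoeff (fun _ : Fin n => eCur ρ) ξ v) (stringUp q n z) ∧
        IsRegularAt (matrixCoeff (fun _ : Fin n => fCur ρ) ξ v) (stringDown q n z)) ∧
      IsFieldOf ρ (eString ρ n) (eTilde ρ n) ∧
      IsFieldOf ρ (fString ρ n) (fTilde ρ n)) ∧
    -- the normalized composed currents are the iterated residues
    (∀ n : ℕ, 1 ≤ n → ∀ ξ v, IsHomDual ρ ξ → IsHomVec ρ v → ∀ z : ℂ, z ≠ 0 →
      Tendsto (fun y : ℂ =>
          (1 - q ^ (2 * n) * z / y) * prodValue ![eComp ρ 1, eComp ρ n] ξ v ![y, z])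
        (𝓝[≠] (q ^ (2 * n) * z)) (𝓝 (prodValue ![eComp ρ (n + 1)] ξ v ![z])) ∧
      Tendsto (fun y : ℂ =>
          (1 - q ^ (2 * n) * z / y) * prodValue ![fComp ρ n, fComp ρ 1] ξ v ![z, y])
        (𝓝[≠] (q ^ (2 * n) * z)) (𝓝 (prodValue ![fComp ρ (n + 1)] ξ v ![z]))) ∧
    -- poles, zeros and residues
    (∀ n m : ℕ, 1 ≤ n → 1 ≤ m → ∀ ξ v, IsHomDual ρ ξ → IsHomVec ρ v →
      HasPolesAndZeros q (matrixCoeff ![eTilde ρ n, eTilde ρ m] ξ v) (ePoles n m) (eZeros n m) ∧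
      HasPolesAndZeros q (matrixCoeff ![fTilde ρ n, fTilde ρ m] ξ v) (fPoles n m) (fZeros n m) ∧
      (∀ k : ℕ, 1 ≤ k → m + 1 ≤ n + k → k ≤ m → ∀ z : ℂ, z ≠ 0 →
        IsRegularAt (matrixCoeff ![eTilde ρ (n + k), eTilde ρ (m - k)] ξ v)
          ![z, q ^ (2 * k) * z] ∧
        Tendsto (fun y : ℂ =>
            (1 - q ^ (2 * k) * z / y) * prodValue ![eTilde ρ n, eTilde ρ m] ξ v ![y, z])
          (𝓝[≠] (q ^ (2 * k) * z))
          (𝓝 ((q - q⁻¹) * resConst q n k *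
            prodValue ![eTilde ρ (n + k), eTilde ρ (m - k)] ξ v ![z, q ^ (2 * k) * z])) ∧
        (¬ IsRegularAt (matrixCoeff ![eTilde ρ n, eTilde ρ m] ξ v) ![q ^ (2 * k) * z, z] ↔
          prodValue ![eTilde ρ (n + k), eTilde ρ (m - k)] ξ v ![z, q ^ (2 * k) * z] ≠ 0)) ∧
      (∀ k : ℕ, 1 ≤ k → n + 1 ≤ m + k → k ≤ n → ∀ z : ℂ, z ≠ 0 →
        IsRegularAt (matrixCoeff ![fTilde ρ (n - k), fTilde ρ (m + k)] ξ v)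
          ![z, (q ^ (2 * k))⁻¹ * z] ∧
        Tendsto (fun y : ℂ =>
            (1 - (q ^ (2 * k))⁻¹ * z / y) * prodValue ![fTilde ρ n, fTilde ρ m] ξ v ![y, z])
          (𝓝[≠] ((q ^ (2 * k))⁻¹ * z))
          (𝓝 ((q⁻¹ - q) * resConst q m k *
            prodValue ![fTilde ρ (n - k), fTilde ρ (m + k)] ξ v ![z, (q ^ (2 * k))⁻¹ * z])) ∧
        (¬ IsRegularAt (matrixCoeff ![fTilde ρ n, fTilde ρ m] ξ v) ![(q ^ (2 * k))⁻¹ * z, z] ↔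
          prodValue ![fTilde ρ (n - k), fTilde ρ (m + k)] ξ v ![z, (q ^ (2 * k))⁻¹ * z] ≠ 0))) ∧
    -- exchange relations, for the coefficients of `z₁ ^ (-i) z₂ ^ (-j)`
    (∀ n m : ℕ, 1 ≤ n → 1 ≤ m →
      (∀ k : ℕ, 1 ≤ k → k ≤ m →
        (∀ ξ v, IsHomDual ρ ξ → IsHomVec ρ v → ∀ z : ℂ, z ≠ 0 →
          IsRegularAt (matrixCoeff ![eComp ρ (n + k), eComp ρ (m - k)] ξ v)
            ![z, q ^ (2 * k) * z]) ∧
        IsFieldOf ρ (eResidue ρ n m k) (fieldOf ρ (eResidue ρ n m k))) ∧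
      (∀ k : ℕ, 1 ≤ k → k ≤ n →
        (∀ ξ v, IsHomDual ρ ξ → IsHomVec ρ v → ∀ z : ℂ, z ≠ 0 →
          IsRegularAt (matrixCoeff ![fComp ρ (n - k), fComp ρ (m + k)] ξ v)
            ![z, (q ^ (2 * k))⁻¹ * z]) ∧
        IsFieldOf ρ (fResidue ρ n m k) (fieldOf ρ (fResidue ρ n m k))) ∧
      ∀ (i j : ℤ) (v : V),
        (∃ N : ℕ, (∀ p : ℕ, N ≤ p → eComp ρ n (i + p) v = 0) ∧
          eComp ρ n i (eComp ρ m j v) =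
            ∑ p ∈ Finset.range N, PowerSeries.coeff p (exchSeries q (q ^ (-2 : ℤ)) n m) •
              eComp ρ m (j - p) (eComp ρ n (i + p) v) +
            ∑ k ∈ Finset.Icc 1 m, (exchConst q m k * q ^ (2 * (k : ℤ) * i)) •
              fieldOf ρ (eResidue ρ n m k) (i + j) v) ∧
        (∃ N : ℕ, (∀ p : ℕ, N ≤ p → fComp ρ n (i + p) v = 0) ∧
          fComp ρ n i (fComp ρ m j v) =
            ∑ p ∈ Finset.range N, PowerSeries.coeff p (exchSeries q (q ^ (2 : ℤ)) n m) •
              fComp ρ m (j - p) (fComp ρ n (i + p) v) -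
            ∑ k ∈ Finset.Icc 1 n, (exchConst q n k * q ^ (-(2 * (k : ℤ) * i))) •
              fieldOf ρ (fResidue ρ n m k) (i + j) v)) := by
  refine ⟨fun n => ⟨fun ξ v hξ hv z hz => ⟨(composed_e hq0 hq hV n).1 ξ v hξ hv z hz,
    (composed_f hq0 hq hV n).1 ξ v hξ hv z hz⟩, ?_, ?_⟩, fun n hn ξ v hξ hv z hz => ?_,
    fun n m hn hm ξ v hξ hv => ⟨hasPolesAndZeros_e hq0 hq hV hξ hv n m,
      hasPolesAndZeros_f hq0 hq hV hξ hv n m,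
      fun k hk _ hkm z hz => residues_e hq0 hq hV hξ hv hn hk hkm hz,
      fun k hk _ hkn z hz => residues_f hq0 hq hV hξ hv hm hk hkn hz⟩,
    fun n m hn hm => ⟨(exchange_e hq0 hq hV hn hm).1, (exchange_f hq0 hq hV hn hm).1,
      fun i j v => ⟨(exchange_e hq0 hq hV hn hm).2 i j v, (exchange_f hq0 hq hV hn hm).2 i j v⟩⟩⟩
  · rw [eTilde_eq hq0 hq hV]
    exact (composed_e hq0 hq hV n).2
  · rw [fTilde_eq hq0 hq hV]
    exact (composed_f hq0 hq hV n).2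
  · obtain ⟨k, rfl⟩ := Nat.exists_eq_add_of_le' hn
    exact ⟨iterated_residue_e hq0 hq hV hξ hv k hz, iterated_residue_f hq0 hq hV hξ hv k hz⟩
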